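/- Corollary (Identity Covariance Sub-gaussian Distributions). Call a probability distribution $X$ on $\mathbb{R}^d$ with mean $\mu_X$ an identity-covariance sub-gaussian distribution with parameter $K>0$ if $\mathrm{Cov}[X]=I$ and $\Pr_{x\sim X}[\,|v\cdot(x-\mu_X)|\ge t\,]\le 2\exp(-t^2/(2K^2))$ for every unit vector $v\in\mathbb{R}^d$ and every $t\ge 0$. A collection $T$ of $n$ points is an $\epsilon$-corrupted version of a collection $S$ of $n$ points if it is obtained from $S$ by replacing at most $\epsilon n$ of its points by arbitrary points of $\mathbb{R}^d$ (the order of the points being irrelevant). For every $K>0$ and every $\epsilon_0\in(0,1/2)$ there are a constant $C>0$, an integer $k\ge 0$ and a deterministic algorithm (a single real-RAM program, with exact field operations and comparisons of real numbers at unit cost and with rational constants only), depending only on $K$ and $\epsilon_0$, such that the following holds for all $d\ge 1$, all $\epsilon\in(0,\epsilon_0]$ and all $n\ge C\,d/\epsilon^2$. (i) On every input consisting of $\epsilon$ and $n$ points $T$ of $\mathbb{R}^d$, the algorithm halts after at most $C\,(nd)^k$ steps and returns a vector $\widehat\mu=\widehat\mu(T)\in\mathbb{R}^d$. (ii) For every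 identity-covariance sub-gaussian distribution $X$ on $\mathbb{R}^d$ with parameter $K$ and every $\tau\in(0,1)$ with $n\ge C\,(d+\log(1/\tau))/\epsilon^2$, with probability at least $1-\tau$ over a collection $S$ of $n$ i.i.d. samples from $X$, every $\epsilon$-corrupted version $T$ of $S$ satisfies $$\|\widehat\mu(T)-\mu_X\|_2\le C\,\epsilon\sqrt{\log(1/\epsilon)}.$$ (In particular $\Omega(d/\epsilon^2)$ samples suffice for every fixed $\tau$, and even for $\tau=e^{-d}$.) -/

import Mathlib

namespace RobustMean

/-! ### A real random access machine

Programs of a small structured language over an idealized machine that stores real numbers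
exactly, performs the field operations and comparisons of reals at unit cost, and has natural
number registers (with addition and truncated subtraction) for counting and addressing.  There is
no conversion from reals to natural numbers (no rounding), and a program contains only finitely
many constants, all natural or rational numbers. -/

/-- Natural number (index) expressions. -/
inductive IExp : Type
  | lit (c : ℕ)
  | var (i : ℕ)
  | add (e f : IExp)
  | sub (e f : IExp)

/-- Real expressions.  `get a e f` reads the entry in row `e` and column `f` of the array with the
fixed name `a`; `ofIdx e` is the value of an index expression as a real number. -/
inductive RExp : Type
  | lit (q : ℚ)
  | var (r : ℕ)
  | ofIdx (e : IExp)
  | get (a : ℕ) (e f : IExp)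
  | add (x y : RExp)
  | sub (x y : RExp)
  | mul (x y : RExp)
  | div (x y : RExp)

/-- Tests: strict comparison of two index expressions, or of two real expressions. -/
inductive Test : Type
  | ilt (e f : IExp)
  | rlt (x y : RExp)

/-- Programs: assignments to an index register, to a real register and to an array entry;
sequential composition, branching and loops. -/
inductive Prog : Type
  | setI (i : ℕ) (e : IExp)
  | setR (r : ℕ) (x : RExp)
  | setM (a : ℕ) (e f : IExp) (x : RExp)
  | seq (p q : Prog)
  | ite (b : Test) (p q : Prog)
  | while (b : Test) (p : Prog)

/-- A memory state: index registers, real registers, and two-dimensional arrays of reals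
(array name, row, column). -/
structure State : Type where
  idx : ℕ → ℕ
  reg : ℕ → ℝ
  mem : ℕ → ℕ → ℕ → ℝ

def IExp.eval (s : State) : IExp → ℕ
  | .lit c => c
  | .var i => s.idx i
  | .add e f => e.eval s + f.eval s
  | .sub e f => e.eval s - f.eval s

noncomputable def RExp.eval (s : State) : RExp → ℝ
  | .lit q => (q : ℝ)
  | .var r => s.reg r
  | .ofIdx e => (e.eval s : ℝ)
  | .get a e f => s.mem a (e.eval s) (f.eval s)
  | .add x y => x.eval s + y.eval s
  | .sub x y => x.eval s - y.eval s
  | .mul x y => x.eval s * y.eval s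
  | .div x y => x.eval s / y.eval s

def Test.Holds (s : State) : Test → Prop
  | .ilt e f => e.eval s < f.eval s
  | .rlt x y => x.eval s < y.eval s

/-- The number of operations performed in evaluating an index expression: one per node. -/
def IExp.cost : IExp → ℕ
  | .lit _ => 1
  | .var _ => 1
  | .add e f => e.cost + f.cost + 1
  | .sub e f => e.cost + f.cost + 1

/-- The number of operations performed in evaluating a real expression: one per node. -/
def RExp.cost : RExp → ℕ
  | .lit _ => 1
  | .var _ => 1
  | .ofIdx e => e.cost + 1
  | .get _ e f => e.cost + f.cost + 1
  | .add x y => x.cost + y.cost + 1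
  | .sub x y => x.cost + y.cost + 1
  | .mul x y => x.cost + y.cost + 1
  | .div x y => x.cost + y.cost + 1

/-- The number of operations performed in evaluating a test. -/
def Test.cost : Test → ℕ
  | .ilt e f => e.cost + f.cost + 1
  | .rlt x y => x.cost + y.cost + 1

def State.setI (s : State) (i v : ℕ) : State :=
  { s with idx := Function.update s.idx i v }

def State.setR (s : State) (r : ℕ) (v : ℝ) : State :=
  { s with reg := Function.update s.reg r v }

def State.setM (s : State) (a i j : ℕ) (v : ℝ) : State :=
  { s with
    mem := fun a' i' j' => if a' = a ∧ i' = i ∧ j' = j then v else s.mem a' i' j' }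

/-- `Exec p s t s'`: the program `p`, started in state `s`, halts in state `s'` after exactly `t`
unit-cost steps. -/
inductive Exec : Prog → State → ℕ → State → Prop
  | setI (i : ℕ) (e : IExp) (s : State) :
      Exec (.setI i e) s (e.cost + 1) (s.setI i (e.eval s))
  | setR (r : ℕ) (x : RExp) (s : State) :
      Exec (.setR r x) s (x.cost + 1) (s.setR r (x.eval s))
  | setM (a : ℕ) (e f : IExp) (x : RExp) (s : State) :
      Exec (.setM a e f x) s (e.cost + f.cost + x.cost + 1)
        (s.setM a (e.eval s) (f.eval s) (x.eval s))
  | seq {p q : Prog} {s s₁ s₂ : State} {t₁ t₂ : ℕ} :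
      Exec p s t₁ s₁ → Exec q s₁ t₂ s₂ → Exec (.seq p q) s (t₁ + t₂) s₂
  | iteTrue {b : Test} {p : Prog} (q : Prog) {s s' : State} {t : ℕ} :
      b.Holds s → Exec p s t s' → Exec (.ite b p q) s (b.cost + t) s'
  | iteFalse {b : Test} (p : Prog) {q : Prog} {s s' : State} {t : ℕ} :
      ¬ b.Holds s → Exec q s t s' → Exec (.ite b p q) s (b.cost + t) s'
  | whileDone {b : Test} (p : Prog) {s : State} :
      ¬ b.Holds s → Exec (.while b p) s b.cost s
  | whileStep {b : Test} {p : Prog} {s s₁ s₂ : State} {t₁ t₂ : ℕ} :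
      b.Holds s → Exec p s t₁ s₁ → Exec (.while b p) s₁ t₂ s₂ →
        Exec (.while b p) s (b.cost + t₁ + t₂) s₂

/-- The initial state for the contamination level `ε` and the points `T 0, …, T (n - 1)` of `ℝ^d`:
index registers `0` and `1` hold `n` and `d`, real register `0` holds `ε`, row `i` of array `0`
holds the coordinates of `T i`, and everything else is `0`. -/
noncomputable def inputState {n d : ℕ} (ε : ℝ) (T : Fin n → EuclideanSpace ℝ (Fin d)) : State where
  idx := fun i => if i = 0 then n else if i = 1 then d else 0
  reg := fun r => if r = 0 then ε else 0
  mem := fun a i j =>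
    if h : a = 0 ∧ i < n ∧ j < d then T ⟨i, h.2.1⟩ ⟨j, h.2.2⟩ else 0

/-- The vector of `ℝ^d` that a halting program leaves in row `0` of array `1`. -/
noncomputable def outputVec (d : ℕ) (s : State) : EuclideanSpace ℝ (Fin d) :=
  WithLp.toLp 2 fun j => s.mem 1 0 j

/-- On the input `ε, T`, the program `p` halts after `t` steps with output `y`. -/
def Computes {n d : ℕ} (p : Prog) (ε : ℝ) (T : Fin n → EuclideanSpace ℝ (Fin d)) (t : ℕ)
    (y : EuclideanSpace ℝ (Fin d)) : Prop :=
  ∃ s', Exec p (inputState ε T) t s' ∧ outputVec d s' = y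

/-! ### Distributions and contamination -/

/-- The mean vector of a distribution on `ℝ^d`. -/
noncomputable def mean {d : ℕ} (P : MeasureTheory.Measure (EuclideanSpace ℝ (Fin d))) :
    EuclideanSpace ℝ (Fin d) :=
  ∫ x, x ∂P

/-- The distribution `P` on `ℝ^d` has identity covariance, and every univariate projection of it
has Gaussian tails around its mean, with parameter `K`. -/
structure IsIdentityCovSubgaussian {d : ℕ} (K : ℝ)
    (P : MeasureTheory.Measure (EuclideanSpace ℝ (Fin d))) : Prop where
  cov_eq : ∀ i j : Fin d,
    ProbabilityTheory.covariance (fun x : EuclideanSpace ℝ (Fin d) => x i) (fun x => x j) P =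
      if i = j then 1 else 0
  tail_le : ∀ v : EuclideanSpace ℝ (Fin d), ‖v‖ = 1 → ∀ t : ℝ, 0 ≤ t →
    P.real {x | t ≤ |inner ℝ v (x - mean P)|} ≤ 2 * Real.exp (-t ^ 2 / (2 * K ^ 2))

/-- The family `T` of `n` points is an `ε`-corrupted version of the family `S`: up to the order of
the points, it arises from `S` by replacing at most `ε n` of them by arbitrary points. -/
def IsCorruption {n d : ℕ} (ε : ℝ) (S T : Fin n → EuclideanSpace ℝ (Fin d)) : Prop :=
  ∃ σ : Equiv.Perm (Fin n), ({i | T (σ i) ≠ S i}.ncard : ℝ) ≤ ε * n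

end RobustMean

/-! The proof separates probability from a deterministic estimate, and then turns the estimator into
a machine program.

Probability. Let `L` be a number of order `log (1 / ε)`. With probability at least `1 - τ` the
centered sample is `IsStable`: its sum is `O(ε n)`, its second moment in every unit direction is `n`
up to `O(ε n)`, and the squared projections exceeding a multiple of `L` do so by `O(ε n)` in total.
In one direction this is a Chernoff bound with failure probability of order `exp (-ε² n)`, because
Gaussian tails give the squared projection an exponential moment. A net of `125 ^ d` directions and
a union bound finish the argument (`exists_pi_not_isStable_le`).

Filtering. Let `G` be the set of uncorrupted points. Weights start at `1`. Let `M` be the weighted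
scatter matrix and `B = M ^ (n + 1)`. The score of a point is the squared norm of `B` applied to its
deviation from the weighted mean. Suppose the weighted average score exceeds `1 + O(ε L)` times the
squared Frobenius norm of `B`. Stability passes to the projection by the normalized `B`, so the
points outside `G` carry more weighted excess score than those in `G` (`exists_filter_constants`).
Reducing weights in proportion to excess therefore removes more mass outside `G` than inside, and it
annihilates at least one weight; hence `n` rounds suffice.

Termination. Otherwise two consecutive traces of powers of `M` have a small ratio, which bounds the
largest eigenvalue of `M` without computing eigenvectors (`dotProduct_mulVec_le_of_trace_pow_le`).
The surviving bad points have mass at most `ε n` and, in the direction of the error, second moment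
`O(ε L n)`. By Cauchy–Schwarz they displace the mean by `O(ε √L)` (`exists_displacement_constant`).

Computation. Field operations provide no logarithm, so `L` is the number of doublings that take `ε`
to `1`. The estimator is written in a small language of block assignments with sums and maxima,
whose compilation is proved correct with polynomial running time (`HProg.exec_compile`). -/

namespace RobustMean
open MeasureTheory Finset Module

/-! ### Nets of the sphere, and the passage from a net to all directions. -/

section Nets

variable {E : Type*} [NormedAddCommGroup E] [InnerProductSpace ℝ E] [FiniteDimensional ℝ E]

/-- A half-net of the unit ball with at most `5 ^ dim` points. -/
theorem exists_half_net_ball :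
    ∃ N : Finset E, #N ≤ 5 ^ finrank ℝ E ∧ ∀ x : E, ‖x‖ ≤ 1 → ∃ p ∈ N, ‖x - p‖ ≤ 1 / 2 := by
  classical
  -- A largest `1`-separated subset of the ball of radius `2` is a `1`-net of that ball; scaling by
  -- `1 / 2` gives the half-net.
  let A : Set ℕ := {k | ∃ s : Finset E, #s = k ∧ (∀ c ∈ s, ‖c‖ ≤ 2) ∧
    ∀ c ∈ s, ∀ e ∈ s, c ≠ e → 1 ≤ ‖c - e‖}
  have hbdd : BddAbove A := by
    refine ⟨5 ^ finrank ℝ E, ?_⟩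
    rintro k ⟨s, rfl, h1, h2⟩
    exact Besicovitch.card_le_of_separated s h1 h2
  have hne : A.Nonempty := ⟨0, ∅, by simp⟩
  obtain ⟨s, hs, h1, h2⟩ := Nat.sSup_mem hne hbdd
  refine ⟨s.image fun p => (1 / 2 : ℝ) • p,
    card_image_le.trans (Besicovitch.card_le_of_separated s h1 h2), fun x hx => ?_⟩
  by_contra! hcon
  have hfar : ∀ p ∈ s, 1 ≤ ‖(2 : ℝ) • x - p‖ := by
    intro p hp
    have h3 := hcon _ (mem_image_of_mem _ hp)
    have h4 : (2 : ℝ) • x - p = (2 : ℝ) • (x - (1 / 2 : ℝ) • p) := by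
      rw [smul_sub, smul_smul]; norm_num
    rw [h4, norm_smul]
    norm_num
    linarith
  have hx2 : (2 : ℝ) • x ∉ s := by
    intro h
    have := hfar _ h
    simp at this
    linarith
  have hmem : #s + 1 ∈ A := by
    refine ⟨insert ((2 : ℝ) • x) s, card_insert_of_notMem hx2, ?_, ?_⟩
    · intro c hc
      rcases mem_insert.1 hc with rfl | hc
      · rw [norm_smul]; norm_num; linarith
      · exact h1 c hc
    · intro c hc e he hce
      rcases mem_insert.1 hc with rfl | hc <;> rcases mem_insert.1 he with rfl | he
      · exact absurd rfl hce
      · exact hfar e he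
      · rw [norm_sub_rev]; exact hfar c hc
      · exact h2 c hc e he hce
  have := le_csSup hbdd hmem
  omega

/-- Around each point of the net, a copy of a half-net of the unit ball shrunk by `δ` covers the
ball of radius `δ`. -/
theorem exists_refined_net_ball {N : Finset E} {δ : ℝ} (hδ : 0 < δ)
    (hN : ∀ x : E, ‖x‖ ≤ 1 → ∃ p ∈ N, ‖x - p‖ ≤ δ) :
    ∃ N' : Finset E, #N' ≤ #N * 5 ^ finrank ℝ E ∧
      ∀ x : E, ‖x‖ ≤ 1 → ∃ p ∈ N', ‖x - p‖ ≤ δ / 2 := by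
  classical
  obtain ⟨M, hM, hM'⟩ := exists_half_net_ball (E := E)
  refine ⟨image₂ (fun p q => p + δ • q) N M,
    (card_image₂_le _ _ _).trans (Nat.mul_le_mul_left _ hM), fun x hx => ?_⟩
  obtain ⟨p, hp, hxp⟩ := hN x hx
  obtain ⟨q, hq, hxq⟩ := hM' (δ⁻¹ • (x - p)) (by
    rw [norm_smul, Real.norm_of_nonneg (by positivity), inv_mul_le_iff₀ hδ]; linarith)
  refine ⟨p + δ • q, mem_image₂_of_mem hp hq, ?_⟩
  have : x - (p + δ • q) = δ • (δ⁻¹ • (x - p) - q) := by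
    rw [smul_sub, smul_smul, mul_inv_cancel₀ hδ.ne', one_smul]; abel
  rw [this, norm_smul, Real.norm_of_nonneg hδ.le]
  nlinarith

/-- A quarter-net of the unit sphere with at most `125 ^ dim` points. -/
theorem exists_net_sphere :
    ∃ N : Finset E, #N ≤ 125 ^ finrank ℝ E ∧ (∀ p ∈ N, ‖p‖ = 1) ∧
      ∀ x : E, ‖x‖ = 1 → ∃ p ∈ N, ‖x - p‖ ≤ 1 / 4 := by
  classical
  -- Two refinements give radius `1 / 8`. Normalizing a net point near the sphere moves it by at
  -- most another `1 / 8`.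
  obtain ⟨N₁, h₁, h₁'⟩ := exists_half_net_ball (E := E)
  obtain ⟨N₂, h₂, h₂'⟩ := exists_refined_net_ball (by norm_num) h₁'
  obtain ⟨N₃, h₃, h₃'⟩ := exists_refined_net_ball (by norm_num) h₂'
  refine ⟨(N₃.filter (· ≠ 0)).image fun p => ‖p‖⁻¹ • p, ?_, ?_, ?_⟩
  · calc _ ≤ #N₃ := card_image_le.trans (card_filter_le _ _)
      _ ≤ 5 ^ finrank ℝ E * 5 ^ finrank ℝ E * 5 ^ finrank ℝ E :=
        h₃.trans (Nat.mul_le_mul_right _ (h₂.trans (Nat.mul_le_mul_right _ h₁)))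
      _ = 125 ^ finrank ℝ E := by rw [← mul_pow, ← mul_pow]; norm_num
  · intro p hp
    obtain ⟨q, hq, rfl⟩ := mem_image.1 hp
    have : ‖q‖ ≠ 0 := norm_ne_zero_iff.2 (mem_filter.1 hq).2
    rw [norm_smul, norm_inv, norm_norm, inv_mul_cancel₀ this]
  · intro x hx
    obtain ⟨p, hp, hxp⟩ := h₃' x hx.le
    have h4 : |‖x‖ - ‖p‖| ≤ ‖x - p‖ := abs_norm_sub_norm_le x p
    rw [hx] at h4
    have h5 : 0 < ‖p‖ := by
      have := (abs_le.1 (h4.trans hxp)).2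
      linarith
    refine ⟨‖p‖⁻¹ • p, mem_image_of_mem _ (mem_filter.2 ⟨hp, norm_pos_iff.1 h5⟩), ?_⟩
    have h6 : ‖p - ‖p‖⁻¹ • p‖ = |‖p‖ - 1| := by
      have : p - ‖p‖⁻¹ • p = (1 - ‖p‖⁻¹) • p := by rw [sub_smul, one_smul]
      rw [this, norm_smul, Real.norm_eq_abs, ← abs_norm p, ← abs_mul, abs_norm, sub_mul,
        inv_mul_cancel₀ h5.ne', one_mul]
    have h7 : x - ‖p‖⁻¹ • p = (x - p) + (p - ‖p‖⁻¹ • p) := by abel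
    rw [h7]
    refine (norm_add_le _ _).trans ?_
    rw [h6, abs_sub_comm]
    linarith

theorem exists_sphere_max (h0 : ∃ x : E, ‖x‖ = 1) {f : E → ℝ} (hf : Continuous f) :
    ∃ x : E, ‖x‖ = 1 ∧ ∀ z : E, ‖z‖ = 1 → f z ≤ f x := by
  obtain ⟨u, hu⟩ := h0
  obtain ⟨x, hx, hmax⟩ := (isCompact_sphere (0 : E) 1).exists_isMaxOn
    ⟨u, by simpa using hu⟩ hf.continuousOn
  exact ⟨x, by simpa using hx, fun z hz => hmax (by simpa using hz)⟩

variable {ι : Type*} [Fintype ι] (y : ι → E) {N : Finset E} {t : ℝ}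

/-- Replacing the direction of the sum by a net point loses at most a quarter of the norm. -/
theorem norm_sum_le_of_net {E : Type*} [NormedAddCommGroup E] [InnerProductSpace ℝ E]
    {ι : Type*} [Fintype ι] (y : ι → E) {N : Finset E} {t : ℝ} (hN : ∀ x : E, ‖x‖ = 1 → ∃ p ∈ N, ‖x - p‖ ≤ 1 / 4)
    (h : ∀ p ∈ N, ∑ j, inner ℝ p (y j) ≤ t) (ht : 0 ≤ t) : ‖∑ j, y j‖ ≤ 2 * t := by
  set s := ∑ j, y j with hs
  rcases eq_or_ne s 0 with h0 | h0
  · rw [h0, norm_zero]; linarith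
  have hpos : 0 < ‖s‖ := norm_pos_iff.2 h0
  obtain ⟨p, hp, hxp⟩ := hN (‖s‖⁻¹ • s) (by
    rw [norm_smul, norm_inv, norm_norm, inv_mul_cancel₀ hpos.ne'])
  have h1 : inner ℝ (‖s‖⁻¹ • s) s = ‖s‖ := by
    rw [real_inner_smul_left, real_inner_self_eq_norm_sq]; field_simp
  have h2 : inner ℝ p s ≤ t := by rw [hs, inner_sum]; exact h p hp
  have h3 : inner ℝ (‖s‖⁻¹ • s - p) s ≤ 1 / 4 * ‖s‖ :=
    (real_inner_le_norm _ _).trans (mul_le_mul_of_nonneg_right hxp hpos.le)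
  rw [inner_sub_left, h1] at h3
  linarith

/-- At a maximizer `x` of `|Q|` on the sphere and a net point `p` near it, `Q x - Q p` is the
bilinear form of `Q` at `x - p` and `x + p`. Polarization bounds it by `5 / 8` of the maximum, so
the maximum is at most `8 / 3` of the value on the net. -/
theorem abs_quadratic_le_of_net (hN1 : ∀ p ∈ N, ‖p‖ = 1)
    (hN : ∀ x : E, ‖x‖ = 1 → ∃ p ∈ N, ‖x - p‖ ≤ 1 / 4)
    (h : ∀ p ∈ N, |∑ j, ((inner ℝ p (y j)) ^ 2 - 1)| ≤ t) (v : E) (hv : ‖v‖ = 1) :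
    |∑ j, ((inner ℝ v (y j)) ^ 2 - 1)| ≤ 3 * t := by
  let Q : E → ℝ := fun z => ∑ j, ((inner ℝ z (y j)) ^ 2 - ‖z‖ ^ 2)
  have hQ1 : ∀ z : E, ‖z‖ = 1 → Q z = ∑ j, ((inner ℝ z (y j)) ^ 2 - 1) := by
    intro z hz; simp [Q, hz]
  have hcont : Continuous fun z => |Q z| := by
    have : Continuous Q := by fun_prop
    exact this.abs
  obtain ⟨x, hx, hmax⟩ := exists_sphere_max ⟨v, hv⟩ hcont
  have hscale : ∀ (c : ℝ) (z : E), Q (c • z) = c ^ 2 * Q z := by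
    intro c z
    simp only [Q, real_inner_smul_left, norm_smul, mul_sum, Real.norm_eq_abs]
    refine sum_congr rfl fun j _ => ?_
    rw [mul_pow, mul_pow, sq_abs]; ring
  have hgen : ∀ z : E, |Q z| ≤ |Q x| * ‖z‖ ^ 2 := by
    intro z
    rcases eq_or_ne z 0 with h0 | h0
    · simp [h0, Q]
    have hz : 0 < ‖z‖ := norm_pos_iff.2 h0
    have h1 := hmax (‖z‖⁻¹ • z) (by rw [norm_smul, norm_inv, norm_norm, inv_mul_cancel₀ hz.ne'])
    rw [hscale, abs_mul, abs_of_nonneg (by positivity : (0:ℝ) ≤ ‖z‖⁻¹ ^ 2), inv_pow,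
      inv_mul_le_iff₀ (by positivity)] at h1
    linarith
  -- The factors `3` and `1 / 3` balance the norms of `x - p` (at most `1 / 4`) and `x + p` (at most
  -- `2`).
  have hpol : ∀ a b : E, Q ((3 : ℝ) • a + (1 / 3 : ℝ) • b) - Q ((3 : ℝ) • a - (1 / 3 : ℝ) • b) =
      4 * ∑ j, (inner ℝ a (y j) * inner ℝ b (y j) - inner ℝ a b) := by
    intro a b
    simp only [Q, mul_sum, ← sum_sub_distrib]
    refine sum_congr rfl fun j _ => ?_
    rw [norm_add_sq_real, norm_sub_sq_real]
    simp only [inner_add_left, inner_sub_left, real_inner_smul_left, real_inner_smul_right]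
    ring
  obtain ⟨p, hp, hxp⟩ := hN x hx
  have hp1 := hN1 p hp
  have hdiff : Q x - Q p = ∑ j, (inner ℝ (x - p) (y j) * inner ℝ (x + p) (y j)
      - inner ℝ (x - p) (x + p)) := by
    simp only [Q, ← sum_sub_distrib]
    refine sum_congr rfl fun j _ => ?_
    simp only [inner_add_left, inner_sub_left, inner_add_right, real_inner_self_eq_norm_sq,
      real_inner_comm x p]
    ring
  have h4 := hpol (x - p) (x + p)
  have h5 := hgen ((3 : ℝ) • (x - p) + (1 / 3 : ℝ) • (x + p))
  have h6 := hgen ((3 : ℝ) • (x - p) - (1 / 3 : ℝ) • (x + p))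
  have h7 : ‖(3 : ℝ) • (x - p) + (1 / 3 : ℝ) • (x + p)‖ ^ 2 +
      ‖(3 : ℝ) • (x - p) - (1 / 3 : ℝ) • (x + p)‖ ^ 2 =
      2 * (9 * ‖x - p‖ ^ 2 + 1 / 9 * ‖x + p‖ ^ 2) := by
    rw [norm_add_sq_real, norm_sub_sq_real, norm_smul, norm_smul, mul_pow, mul_pow]
    norm_num
    ring
  have h8 : ‖x + p‖ ≤ 2 := (norm_add_le _ _).trans (by rw [hx, hp1]; norm_num)
  have h9 : ‖x - p‖ ^ 2 ≤ 1 / 16 := by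
    have := pow_le_pow_left₀ (norm_nonneg _) hxp 2
    norm_num at this ⊢; linarith
  have h10 : ‖x + p‖ ^ 2 ≤ 4 := by
    have := pow_le_pow_left₀ (norm_nonneg _) h8 2
    norm_num at this ⊢; linarith
  rw [← hdiff] at h4
  have hQp : |Q p| ≤ t := by rw [hQ1 p hp1]; exact h p hp
  have h11 : |Q x| * (‖(3 : ℝ) • (x - p) + (1 / 3 : ℝ) • (x + p)‖ ^ 2 +
      ‖(3 : ℝ) • (x - p) - (1 / 3 : ℝ) • (x + p)‖ ^ 2) ≤ |Q x| * (5 / 2) :=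
    mul_le_mul_of_nonneg_left (by rw [h7]; linarith) (abs_nonneg _)
  have h12 : |Q x| - |Q p| ≤ |Q x - Q p| := abs_sub_abs_le_abs_sub _ _
  have h13 : 4 * |Q x - Q p| ≤ |Q x| * (5 / 2) := by
    have : |4 * (Q x - Q p)| ≤ |Q x| * (5 / 2) := by
      rw [← h4]
      refine (abs_sub _ _).trans ?_
      linarith
    rwa [abs_mul, abs_of_nonneg (by norm_num : (0 : ℝ) ≤ 4)] at this
  have hv' := hmax v hv
  rw [hQ1 v hv] at hv'
  linarith [abs_nonneg (Q p)]

/-- The truncated sum is not quadratic, so the slack between the levels `R` and `3 * R` pays for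
splitting a maximizer `x` as `p + (x - p)`. The remainder, magnified by `4`, is again bounded by the
maximum, and it enters with factor `1 / 8`. -/
theorem excess_le_of_net (hN : ∀ x : E, ‖x‖ = 1 → ∃ p ∈ N, ‖x - p‖ ≤ 1 / 4) {R : ℝ}
    (hR : 0 ≤ R) (h : ∀ p ∈ N, ∑ j, max ((inner ℝ p (y j)) ^ 2 - R) 0 ≤ t) (v : E)
    (hv : ‖v‖ = 1) : ∑ j, max ((inner ℝ v (y j)) ^ 2 - 3 * R) 0 ≤ 3 * t := by
  let f : E → ℝ := fun z => ∑ j, max ((inner ℝ z (y j)) ^ 2 - 3 * R) 0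
  have hcont : Continuous f := by fun_prop
  obtain ⟨x, hx, hmax⟩ := exists_sphere_max ⟨v, hv⟩ hcont
  obtain ⟨p, hp, hxp⟩ := hN x hx
  have hfx : 0 ≤ f x := sum_nonneg fun j _ => le_max_right _ _
  have hr : ∑ j, max (16 * (inner ℝ (x - p) (y j)) ^ 2 - 3 * R) 0 ≤ f x := by
    rcases eq_or_ne (x - p) 0 with h0 | h0
    · refine le_trans (le_of_eq ?_) hfx
      refine sum_eq_zero fun j _ => ?_
      rw [h0, inner_zero_left]
      exact max_eq_right (by linarith)
    have hz : 0 < ‖x - p‖ := norm_pos_iff.2 h0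
    refine le_trans (sum_le_sum fun j _ => ?_) (hmax (‖x - p‖⁻¹ • (x - p)) (by
      rw [norm_smul, norm_inv, norm_norm, inv_mul_cancel₀ hz.ne']))
    refine max_le_max (sub_le_sub_right ?_ _) le_rfl
    rw [real_inner_smul_left, mul_pow]
    refine mul_le_mul_of_nonneg_right ?_ (sq_nonneg _)
    rw [inv_pow]
    rw [le_inv_comm₀ (by norm_num) (by positivity)]
    have := pow_le_pow_left₀ (norm_nonneg _) hxp 2
    norm_num at this ⊢; linarith
  have key : f x ≤ 2 * ∑ j, max ((inner ℝ p (y j)) ^ 2 - R) 0 +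
      1 / 8 * ∑ j, max (16 * (inner ℝ (x - p) (y j)) ^ 2 - 3 * R) 0 := by
    rw [mul_sum, mul_sum, ← sum_add_distrib]
    refine sum_le_sum fun j _ => ?_
    have e : inner ℝ x (y j) = inner ℝ p (y j) + inner ℝ (x - p) (y j) := by
      rw [← inner_add_left]; congr 1; abel
    rw [e]
    set a := inner ℝ p (y j)
    set b := inner ℝ (x - p) (y j)
    have h1 := le_max_left (a ^ 2 - R) 0
    have h2 := le_max_right (a ^ 2 - R) 0
    have h3 := le_max_left (16 * b ^ 2 - 3 * R) 0
    have h4 := le_max_right (16 * b ^ 2 - 3 * R) 0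
    refine max_le ?_ (by linarith)
    nlinarith [sq_nonneg (a - b)]
  have h1 := h p hp
  have h2 := hmax v hv
  change f v ≤ _
  linarith

end Nets
end RobustMean
namespace RobustMean
open MeasureTheory Finset Module

/-! ### Exponential moments and the Chernoff bound. -/

section Moments

variable {Ω : Type*} [MeasurableSpace Ω] {P : Measure Ω} [IsProbabilityMeasure P]

/-- After integration of a centered variable the linear term vanishes and only a term of second
order is left. -/
theorem exp_le_one_add_add_sq_mul_exp_abs (x : ℝ) :
    Real.exp x ≤ 1 + x + x ^ 2 * Real.exp |x| := by
  have h1 : Real.exp x - 1 ≤ x * Real.exp x := by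
    have h2 := Real.add_one_le_exp (-x)
    have h3 := mul_le_mul_of_nonneg_right h2 (Real.exp_pos x).le
    rw [← Real.exp_add, neg_add_cancel, Real.exp_zero] at h3
    linarith
  have h4 := Real.add_one_le_exp x
  rcases le_total 0 x with hx | hx
  · rw [abs_of_nonneg hx]
    nlinarith
  · have h5 : 1 ≤ Real.exp |x| := Real.one_le_exp (abs_nonneg x)
    nlinarith [sq_nonneg x]

/-- Gaussian tails give an exponential moment of the square. -/
theorem lintegral_exp_sq_le {h : Ω → ℝ} (hm : Measurable h) {K : ℝ} (hK : 0 < K)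
    (htail : ∀ t : ℝ, 0 ≤ t → P.real {x | t ≤ |h x|} ≤ 2 * Real.exp (-t ^ 2 / (2 * K ^ 2))) :
    ∫⁻ x, ENNReal.ofReal (Real.exp (1 / (4 * K ^ 2) * h x ^ 2)) ∂P ≤ ENNReal.ofReal 3 := by
  have hmeas : Measurable fun x => Real.exp (1 / (4 * K ^ 2) * h x ^ 2) := by fun_prop
  -- Layer cake formula. The exponent `1 / (4 K²)` is half that of the tail, so the level sets have
  -- measure at most `2 t⁻²`; the parts below and above `1` contribute `1` and `2`.
  rw [lintegral_eq_lintegral_meas_le P (ae_of_all _ fun x => (Real.exp_pos _).le)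
    hmeas.aemeasurable, ← Set.Ioc_union_Ioi_eq_Ioi (zero_le_one' ℝ),
    lintegral_union measurableSet_Ioi (Set.Ioc_disjoint_Ioi le_rfl)]
  have h1 : ∫⁻ t in Set.Ioc (0:ℝ) 1, P {a | t ≤ Real.exp (1 / (4 * K ^ 2) * h a ^ 2)} ≤
      ENNReal.ofReal 1 := by
    calc _ ≤ ∫⁻ _ in Set.Ioc (0:ℝ) 1, 1 := lintegral_mono fun t => prob_le_one
      _ = ENNReal.ofReal 1 := by simp
  have hint : IntegrableOn (fun t : ℝ => 2 * t ^ (-2 : ℝ)) (Set.Ioi 1) :=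
    (integrableOn_Ioi_rpow_of_lt (by norm_num) one_pos).const_mul 2
  have h2 : ∫⁻ t in Set.Ioi (1:ℝ), P {a | t ≤ Real.exp (1 / (4 * K ^ 2) * h a ^ 2)} ≤
      ENNReal.ofReal 2 := by
    calc _ ≤ ∫⁻ t in Set.Ioi (1:ℝ), ENNReal.ofReal (2 * t ^ (-2 : ℝ)) := by
          refine setLIntegral_mono' measurableSet_Ioi fun t ht => ?_
          have ht1 : (1:ℝ) < t := ht
          have ht0 : 0 < t := by linarith
          have hlog : 0 ≤ Real.log t := Real.log_nonneg ht1.le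
          have hsub : {a | t ≤ Real.exp (1 / (4 * K ^ 2) * h a ^ 2)} ⊆
              {a | √(4 * K ^ 2 * Real.log t) ≤ |h a|} := by
            intro a ha
            have h3 : Real.log t ≤ 1 / (4 * K ^ 2) * h a ^ 2 :=
              (Real.log_le_iff_le_exp ht0).2 ha
            refine (Real.sqrt_le_left (abs_nonneg _)).2 ?_
            rw [sq_abs]
            rw [one_div, ← div_eq_inv_mul, le_div_iff₀ (by positivity)] at h3
            linarith
          refine (measure_mono hsub).trans ?_
          rw [← ofReal_measureReal]
          refine ENNReal.ofReal_le_ofReal ((htail _ (Real.sqrt_nonneg _)).trans (le_of_eq ?_))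
          rw [Real.sq_sqrt (by positivity), Real.rpow_def_of_pos ht0]
          congr 2
          field_simp
          ring
      _ = ENNReal.ofReal 2 := by
          rw [← ofReal_integral_eq_lintegral_ofReal hint]
          · rw [integral_const_mul, integral_Ioi_rpow_of_lt (by norm_num) one_pos]
            norm_num
          · filter_upwards [ae_restrict_mem measurableSet_Ioi] with t ht
            have : (0:ℝ) < t := zero_lt_one.trans ht
            simp only [Pi.zero_apply]
            positivity
  calc _ ≤ ENNReal.ofReal 1 + ENNReal.ofReal 2 := add_le_add h1 h2
    _ = ENNReal.ofReal 3 := by rw [← ENNReal.ofReal_add] <;> norm_num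

theorem integrable_exp_sq {h : Ω → ℝ} (hm : Measurable h) {K : ℝ} (hK : 0 < K)
    (htail : ∀ t : ℝ, 0 ≤ t → P.real {x | t ≤ |h x|} ≤ 2 * Real.exp (-t ^ 2 / (2 * K ^ 2))) :
    Integrable (fun x => Real.exp (1 / (4 * K ^ 2) * h x ^ 2)) P ∧
      ∫ x, Real.exp (1 / (4 * K ^ 2) * h x ^ 2) ∂P ≤ 3 := by
  have h1 := lintegral_exp_sq_le hm hK htail
  have hmeas : Measurable fun x => Real.exp (1 / (4 * K ^ 2) * h x ^ 2) := by fun_prop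
  have h0 : 0 ≤ᵐ[P] fun x => Real.exp (1 / (4 * K ^ 2) * h x ^ 2) :=
    ae_of_all _ fun x => (Real.exp_pos _).le
  refine ⟨⟨hmeas.aestronglyMeasurable, ?_⟩, ?_⟩
  · rw [hasFiniteIntegral_iff_ofReal h0]
    exact h1.trans_lt ENNReal.ofReal_lt_top
  · rw [integral_eq_lintegral_of_nonneg_ae h0 hmeas.aestronglyMeasurable]
    exact ENNReal.toReal_le_of_le_ofReal (by norm_num) h1

theorem integrable_of_abs_le_one_add_sq {Ω : Type*} [MeasurableSpace Ω] {P : Measure Ω}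
    [IsFiniteMeasure P] {h w : Ω → ℝ} {a : ℝ} (ha : 0 < a)
    (hi : Integrable (fun x => Real.exp (a * h x ^ 2)) P) (hw : Measurable w)
    (hwh : ∀ x, |w x| ≤ 1 + h x ^ 2) : Integrable w P := by
  refine Integrable.mono' (hi.const_mul (1 + 1 / a)) hw.aestronglyMeasurable
    (ae_of_all _ fun x => ?_)
  rw [Real.norm_eq_abs]
  refine (hwh x).trans ?_
  have h1 := Real.add_one_le_exp (a * h x ^ 2)
  have h2 : 0 ≤ a * h x ^ 2 := by positivity
  have h3 : h x ^ 2 ≤ 1 / a * Real.exp (a * h x ^ 2) := by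
    rw [one_div, ← div_eq_inv_mul, le_div_iff₀ ha]; linarith
  linarith

/-- Moment generating function bound for a centered variable dominated by `1 + h ^ 2`. -/
theorem integral_exp_mul_le {h w : Ω → ℝ} {a : ℝ} (ha : 0 < a)
    (hi : Integrable (fun x => Real.exp (a * h x ^ 2)) P)
    (hi3 : ∫ x, Real.exp (a * h x ^ 2) ∂P ≤ 3) (hw : Measurable w)
    (hwh : ∀ x, |w x| ≤ 1 + h x ^ 2) (hw0 : ∫ x, w x ∂P = 0) {s : ℝ} (hs : |s| ≤ a / 2) :
    Integrable (fun x => Real.exp (s * w x)) P ∧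
      ∫ x, Real.exp (s * w x) ∂P ≤ Real.exp (24 * Real.exp a / a ^ 2 * s ^ 2) := by
  have hbound : ∀ x, Real.exp (s * w x) ≤
      1 + s * w x + 8 * Real.exp a / a ^ 2 * s ^ 2 * Real.exp (a * h x ^ 2) := by
    intro x
    refine (exp_le_one_add_add_sq_mul_exp_abs _).trans (add_le_add_right ?_ _)
    -- This `u` dominates `|s * w x|`. Since `u ^ 2 ≤ 2 * exp u`, the second-order term is
    -- controlled by `exp (2 u)`, which the assumed exponential moment covers.
    set u := a / 2 * |w x| with hu
    have hu0 : 0 ≤ u := by positivity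
    have h1 : |s * w x| ≤ u := by
      rw [abs_mul]; exact mul_le_mul_of_nonneg_right hs (abs_nonneg _)
    have h2 : u ^ 2 ≤ 2 * Real.exp u := by
      have := Real.quadratic_le_exp_of_nonneg hu0
      nlinarith
    have h3 : Real.exp u * Real.exp u ≤ Real.exp a * Real.exp (a * h x ^ 2) := by
      rw [← Real.exp_add, ← Real.exp_add]
      refine Real.exp_le_exp.2 ?_
      have := mul_le_mul_of_nonneg_left (hwh x) ha.le
      rw [hu]; linarith
    have h4 : (s * w x) ^ 2 = 4 / a ^ 2 * s ^ 2 * u ^ 2 := by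
      rw [hu, mul_pow, mul_pow, sq_abs]; field_simp; ring
    calc (s * w x) ^ 2 * Real.exp |s * w x|
        ≤ (s * w x) ^ 2 * Real.exp u :=
          mul_le_mul_of_nonneg_left (Real.exp_le_exp.2 h1) (sq_nonneg _)
      _ = 4 / a ^ 2 * s ^ 2 * (u ^ 2 * Real.exp u) := by rw [h4]; ring
      _ ≤ 4 / a ^ 2 * s ^ 2 * (2 * Real.exp u * Real.exp u) := by gcongr
      _ = 8 / a ^ 2 * s ^ 2 * (Real.exp u * Real.exp u) := by ring
      _ ≤ 8 / a ^ 2 * s ^ 2 * (Real.exp a * Real.exp (a * h x ^ 2)) := by gcongr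
      _ = _ := by ring
  have hwi := integrable_of_abs_le_one_add_sq ha hi hw hwh
  have hri : Integrable (fun x => 1 + s * w x +
      8 * Real.exp a / a ^ 2 * s ^ 2 * Real.exp (a * h x ^ 2)) P :=
    ((integrable_const _).add (hwi.const_mul s)).add (hi.const_mul _)
  have hei : Integrable (fun x => Real.exp (s * w x)) P :=
    hri.mono' (by fun_prop) (ae_of_all _ fun x => by
      rw [Real.norm_eq_abs, abs_of_pos (Real.exp_pos _)]; exact hbound x)
  refine ⟨hei, (integral_mono hei hri hbound).trans ?_⟩
  have hli : Integrable (fun x => 1 + s * w x) P := (integrable_const _).add (hwi.const_mul s)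
  rw [integral_add hli (hi.const_mul _), integral_add (integrable_const _) (hwi.const_mul s), integral_const_mul, integral_const_mul,
    hw0]
  simp only [integral_const, probReal_univ, smul_eq_mul, mul_one, mul_zero, add_zero]
  refine le_trans ?_ (Real.add_one_le_exp _)
  have h8 : 0 ≤ 8 * Real.exp a / a ^ 2 * s ^ 2 := by positivity
  have := mul_le_mul_of_nonneg_left hi3 h8
  have e : 24 * Real.exp a / a ^ 2 * s ^ 2 = 8 * Real.exp a / a ^ 2 * s ^ 2 * 3 := by ring
  rw [e]
  linarith

/-- Chernoff bound for a sum of independent copies. -/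
theorem pi_le_sum_le {n : ℕ} {φ : Ω → ℝ}
    (hi : Integrable (fun x => Real.exp (φ x)) P) {a : ℝ}
    (ha : ∫ x, Real.exp (φ x) ∂P ≤ Real.exp a) (u : ℝ) :
    (Measure.pi fun _ : Fin n => P) {S | n * a + u ≤ ∑ j, φ (S j)} ≤
      ENNReal.ofReal (Real.exp (-u)) := by
  have h1 : Integrable (fun S : Fin n → Ω => ∏ j, Real.exp (φ (S j)))
      (Measure.pi fun _ : Fin n => P) := Integrable.fintype_prod fun _ => hi
  have h2 := mul_meas_ge_le_integral_of_nonneg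
    (ae_of_all _ fun S => prod_nonneg fun j _ => (Real.exp_pos _).le) h1 (Real.exp (n * a + u))
  have h3 : ∫ S : Fin n → Ω, ∏ j, Real.exp (φ (S j)) ∂(Measure.pi fun _ : Fin n => P) ≤
      Real.exp (n * a) := by
    rw [integral_fintype_prod_eq_pow (ι := Fin n) fun x => Real.exp (φ x), Fintype.card_fin,
      Real.exp_nat_mul]
    exact pow_le_pow_left₀ (integral_nonneg fun x => (Real.exp_pos _).le) ha n
  have h4 : {S : Fin n → Ω | Real.exp (n * a + u) ≤ ∏ j, Real.exp (φ (S j))} =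
      {S | n * a + u ≤ ∑ j, φ (S j)} := by
    ext S
    rw [Set.mem_ofPred_eq, Set.mem_ofPred_eq, ← Real.exp_sum, Real.exp_le_exp]
  rw [h4] at h2
  rw [← ofReal_measureReal]
  refine ENNReal.ofReal_le_ofReal ?_
  have h5 := h2.trans h3
  rw [Real.exp_add, mul_assoc] at h5
  have h6 := le_of_mul_le_mul_left (by linarith : Real.exp (n * a) * (Real.exp u *
    (Measure.pi fun _ : Fin n => P).real {S | n * a + u ≤ ∑ j, φ (S j)}) ≤
      Real.exp (n * a) * 1) (Real.exp_pos _)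
  rw [Real.exp_neg, ← one_div, le_div_iff₀ (Real.exp_pos _), mul_comm]
  exact h6

end Moments
end RobustMean
namespace RobustMean
open MeasureTheory Finset Module

/-! ### Stability of a sample with high probability. -/

section Stability

variable {d : ℕ}

/-- The deterministic regularity of a centered sample on which the estimator relies. -/
structure IsStable {n : ℕ} (c ε L : ℝ) (y : Fin n → EuclideanSpace ℝ (Fin d)) : Prop where
  norm_sum_le : ‖∑ j, y j‖ ≤ c * ε * n
  abs_quadratic_le : ∀ v : EuclideanSpace ℝ (Fin d), ‖v‖ = 1 →
    |∑ j, ((inner ℝ v (y j)) ^ 2 - 1)| ≤ c * ε * n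
  excess_le : ∀ v : EuclideanSpace ℝ (Fin d), ‖v‖ = 1 →
    ∑ j, max ((inner ℝ v (y j)) ^ 2 - c * L) 0 ≤ c * ε * n

variable {P : Measure (EuclideanSpace ℝ (Fin d))} [IsProbabilityMeasure P] {K : ℝ}

theorem IsIdentityCovSubgaussian.integrable_exp (hP : IsIdentityCovSubgaussian K P) (hK : 0 < K)
    {v : EuclideanSpace ℝ (Fin d)} (hv : ‖v‖ = 1) :
    Integrable (fun x => Real.exp (1 / (4 * K ^ 2) * (inner ℝ v (x - mean P)) ^ 2)) P ∧
      ∫ x, Real.exp (1 / (4 * K ^ 2) * (inner ℝ v (x - mean P)) ^ 2) ∂P ≤ 3 :=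
  integrable_exp_sq (h := fun x => inner ℝ v (x - mean P)) (by fun_prop) hK (hP.tail_le v hv)

/-- Integrability is not part of the definition, and `mean P` would be `0` by convention without it.
Tails around any fixed vector already force integrability. -/
theorem IsIdentityCovSubgaussian.integrable_id (hP : IsIdentityCovSubgaussian K P) (hK : 0 < K) :
    Integrable (fun x : EuclideanSpace ℝ (Fin d) => x) P := by
  refine Integrable.of_eval_piLp fun i => ?_
  have h1 : ‖EuclideanSpace.single i (1 : ℝ)‖ = 1 := by simp
  have h2 := integrable_of_abs_le_one_add_sq (by positivity) (hP.integrable_exp hK h1).1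
    (w := fun x : EuclideanSpace ℝ (Fin d) => x i - mean P i) (by fun_prop) (fun x => by
      rw [EuclideanSpace.inner_single_left]
      simp only [map_one, one_mul, PiLp.sub_apply]
      rw [abs_le]
      constructor <;> nlinarith [sq_nonneg (x i - mean P i - 1), sq_nonneg (x i - mean P i + 1)])
  have h3 := h2.add (integrable_const (mean P i))
  refine h3.congr (ae_of_all _ fun x => ?_)
  simp

theorem IsIdentityCovSubgaussian.integral_inner_eq_zero (hP : IsIdentityCovSubgaussian K P)
    (hK : 0 < K) (v : EuclideanSpace ℝ (Fin d)) : ∫ x, inner ℝ v (x - mean P) ∂P = 0 := by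
  have hi : Integrable (fun x => x - mean P) P := (hP.integrable_id hK).sub (integrable_const _)
  rw [integral_inner hi, integral_sub (hP.integrable_id hK) (integrable_const _)]
  simp [mean]

theorem IsIdentityCovSubgaussian.integral_inner_sq (hP : IsIdentityCovSubgaussian K P)
    (hK : 0 < K) {v : EuclideanSpace ℝ (Fin d)} (hv : ‖v‖ = 1) :
    ∫ x, (inner ℝ v (x - mean P)) ^ 2 ∂P = 1 := by
  have hcoord : ∀ i : Fin d, mean P i = ∫ x : EuclideanSpace ℝ (Fin d), x i ∂P := fun i =>
    eval_integral_piLp (fun i => (hP.integrable_id hK).eval_piLp i) i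
  have hsq : ∀ i : Fin d, Integrable
      (fun x : EuclideanSpace ℝ (Fin d) => (x i - mean P i) ^ 2) P := by
    intro i
    have h1 : ‖EuclideanSpace.single i (1 : ℝ)‖ = 1 := by simp
    refine integrable_of_abs_le_one_add_sq (by positivity) (hP.integrable_exp hK h1).1
      (by fun_prop) (fun x => ?_)
    rw [EuclideanSpace.inner_single_left]
    simp only [map_one, one_mul, PiLp.sub_apply]
    rw [abs_of_nonneg (sq_nonneg _)]
    linarith
  have hprod : ∀ i k : Fin d, Integrable
      (fun x : EuclideanSpace ℝ (Fin d) => (x i - mean P i) * (x k - mean P k)) P := by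
    intro i k
    refine ((hsq i).add (hsq k)).mono' (by fun_prop) (ae_of_all _ fun x => ?_)
    rw [Real.norm_eq_abs, abs_le]
    simp only [Pi.add_apply]
    constructor <;> nlinarith [sq_nonneg (x i - mean P i - (x k - mean P k)),
      sq_nonneg (x i - mean P i + (x k - mean P k))]
  have hexp : ∀ x : EuclideanSpace ℝ (Fin d), (inner ℝ v (x - mean P)) ^ 2 =
      ∑ i, ∑ k, v i * v k * ((x i - mean P i) * (x k - mean P k)) := by
    intro x
    rw [sq, PiLp.inner_apply, sum_mul_sum]
    refine sum_congr rfl fun i _ => sum_congr rfl fun k _ => ?_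
    simp
    ring
  simp_rw [hexp]
  rw [integral_finsetSum _ fun i _ => integrable_finsetSum _ fun k _ => (hprod i k).const_mul _]
  have hcov : ∀ i k : Fin d, ∫ x : EuclideanSpace ℝ (Fin d),
      (x i - mean P i) * (x k - mean P k) ∂P = if i = k then 1 else 0 := by
    intro i k
    rw [← hP.cov_eq i k, ProbabilityTheory.covariance, hcoord i, hcoord k]
  have : ∀ i : Fin d, ∫ x : EuclideanSpace ℝ (Fin d),
      ∑ k, v i * v k * ((x i - mean P i) * (x k - mean P k)) ∂P = v i ^ 2 := by
    intro i
    rw [integral_finsetSum _ fun k _ => (hprod i k).const_mul _]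
    simp_rw [integral_const_mul, hcov]
    simp [sq]
  simp_rw [this]
  have h1 := EuclideanSpace.norm_sq_eq v
  rw [hv] at h1
  simpa using h1.symm

/-- In a fixed direction, the sample statistics are close to their expectations outside an event
of exponentially small probability. -/
theorem IsIdentityCovSubgaussian.pi_direction_le (hP : IsIdentityCovSubgaussian K P) (hK : 0 < K)
    {p : EuclideanSpace ℝ (Fin d)} (hp : ‖p‖ = 1) {n : ℕ} {ε L a t : ℝ} (hε : 0 < ε)
    (hε2 : ε ≤ 1 / 2) (hL : Real.log (1 / ε) ≤ L) (ha : a = 1 / (4 * K ^ 2))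
    (ht : t = (24 * Real.exp a + 1) / a * (ε * n)) :
    (Measure.pi fun _ : Fin n => P) {S | ¬ (∑ j, inner ℝ p (S j - mean P) ≤ t ∧
      |∑ j, ((inner ℝ p (S j - mean P)) ^ 2 - 1)| ≤ t ∧
      ∑ j, max ((inner ℝ p (S j - mean P)) ^ 2 - L / a) 0 ≤ t)} ≤
      4 * ENNReal.ofReal (Real.exp (-(ε ^ 2 * n))) := by
  have ha0 : 0 < a := by rw [ha]; positivity
  have hexp := hP.integrable_exp hK hp
  rw [← ha] at hexp
  obtain ⟨hi, hi3⟩ := hexp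
  have hεa : |ε * a| ≤ a / 2 := by rw [abs_of_pos (by positivity)]; nlinarith
  have hεa' : |-(ε * a)| ≤ a / 2 := by rwa [abs_neg]
  have hsqi : Integrable (fun x => (inner ℝ p (x - mean P)) ^ 2) P :=
    integrable_of_abs_le_one_add_sq ha0 hi (by fun_prop) fun x => by
      rw [abs_of_nonneg (sq_nonneg _)]; linarith
  have hlin := integral_exp_mul_le ha0 hi hi3 (w := fun x => inner ℝ p (x - mean P)) (by fun_prop)
    (fun x => by
      rw [abs_le]
      constructor <;> nlinarith [sq_nonneg (inner ℝ p (x - mean P) - 1),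
        sq_nonneg (inner ℝ p (x - mean P) + 1)]) (hP.integral_inner_eq_zero hK p) hεa
  have hq := fun (s : ℝ) (hs : |s| ≤ a / 2) =>
    integral_exp_mul_le ha0 hi hi3 (w := fun x => (inner ℝ p (x - mean P)) ^ 2 - 1) (by fun_prop)
    (fun x => by
      rw [abs_le]
      constructor <;> nlinarith [sq_nonneg (inner ℝ p (x - mean P))]) (by
        rw [integral_sub hsqi (integrable_const _), hP.integral_inner_sq hK hp]; simp) hs
  have hq1 := hq _ hεa
  have hq2 := hq _ hεa'
  -- Truncation at `L / a` multiplies the exponential moment by `exp (-L) ≤ ε`. Hence the full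
  -- exponent `a`, rather than `ε * a`, may be used at the cost of `exp (3 * ε)`.
  have hexc : Integrable (fun x => Real.exp (a * max ((inner ℝ p (x - mean P)) ^ 2 - L / a) 0)) P ∧
      ∫ x, Real.exp (a * max ((inner ℝ p (x - mean P)) ^ 2 - L / a) 0) ∂P ≤ Real.exp (3 * ε) := by
    have hb : ∀ x, Real.exp (a * max ((inner ℝ p (x - mean P)) ^ 2 - L / a) 0) ≤
        1 + Real.exp (-L) * Real.exp (a * (inner ℝ p (x - mean P)) ^ 2) := by
      intro x
      rw [← Real.exp_add]
      rcases le_total ((inner ℝ p (x - mean P)) ^ 2 - L / a) 0 with h | h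
      · rw [max_eq_right h, mul_zero, Real.exp_zero]
        linarith [Real.exp_pos (-L + a * (inner ℝ p (x - mean P)) ^ 2)]
      · rw [max_eq_left h, mul_sub, mul_div_cancel₀ _ ha0.ne']
        have : a * (inner ℝ p (x - mean P)) ^ 2 - L = -L + a * (inner ℝ p (x - mean P)) ^ 2 := by
          ring
        rw [this]
        linarith
    have hri := (integrable_const (μ := P) (1 : ℝ)).add (hi.const_mul (Real.exp (-L)))
    have hei : Integrable
        (fun x => Real.exp (a * max ((inner ℝ p (x - mean P)) ^ 2 - L / a) 0)) P :=
      hri.mono' (by fun_prop) (ae_of_all _ fun x => by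
        rw [Real.norm_eq_abs, abs_of_pos (Real.exp_pos _)]; exact hb x)
    refine ⟨hei, (integral_mono hei hri hb).trans ?_⟩
    simp only [Pi.add_apply]
    rw [integral_add (integrable_const _) (hi.const_mul _), integral_const_mul]
    simp only [integral_const, probReal_univ, smul_eq_mul, mul_one]
    have h1 : Real.exp (-L) ≤ ε := by
      rw [one_div, Real.log_inv] at hL
      calc Real.exp (-L) ≤ Real.exp (Real.log ε) := Real.exp_le_exp.2 (by linarith)
        _ = ε := Real.exp_log hε
    have h2 := Real.add_one_le_exp (3 * ε)
    have h3 : Real.exp (-L) * ∫ x, Real.exp (a * (inner ℝ p (x - mean P)) ^ 2) ∂P ≤ ε * 3 :=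
      mul_le_mul h1 hi3 (integral_nonneg fun x => (Real.exp_pos _).le) hε.le
    linarith
  -- With exponent of size `ε * a`, both the logarithmic moment term and `u` are of order `ε² n`;
  -- division by `ε * a` gives exactly `t`, of order `ε n`.
  set u := ε ^ 2 * n with hu
  have e1 : n * (24 * Real.exp a / a ^ 2 * (ε * a) ^ 2) + u = ε * a * t := by
    rw [ht, hu]; field_simp
  have e2 : n * (24 * Real.exp a / a ^ 2 * (-(ε * a)) ^ 2) + u = ε * a * t := by
    rw [neg_sq]; exact e1
  have c1 := pi_le_sum_le (n := n) hlin.1 hlin.2 u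
  have c2 := pi_le_sum_le (n := n) hq1.1 hq1.2 u
  have c3 := pi_le_sum_le (n := n) hq2.1 hq2.2 u
  have c4 := pi_le_sum_le (n := n) hexc.1 hexc.2 u
  rw [e1] at c1 c2
  rw [e2] at c3
  set A₁ := {S : Fin n → EuclideanSpace ℝ (Fin d) |
    ε * a * t ≤ ∑ j, ε * a * inner ℝ p (S j - mean P)}
  set A₂ := {S : Fin n → EuclideanSpace ℝ (Fin d) |
    ε * a * t ≤ ∑ j, ε * a * ((inner ℝ p (S j - mean P)) ^ 2 - 1)}
  set A₃ := {S : Fin n → EuclideanSpace ℝ (Fin d) |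
    ε * a * t ≤ ∑ j, -(ε * a) * ((inner ℝ p (S j - mean P)) ^ 2 - 1)}
  set A₄ := {S : Fin n → EuclideanSpace ℝ (Fin d) |
    n * (3 * ε) + u ≤ ∑ j, a * max ((inner ℝ p (S j - mean P)) ^ 2 - L / a) 0}
  have hpos : 0 < ε * a := by positivity
  have hsub : {S : Fin n → EuclideanSpace ℝ (Fin d) | ¬ (∑ j, inner ℝ p (S j - mean P) ≤ t ∧
      |∑ j, ((inner ℝ p (S j - mean P)) ^ 2 - 1)| ≤ t ∧
      ∑ j, max ((inner ℝ p (S j - mean P)) ^ 2 - L / a) 0 ≤ t)} ⊆ (A₁ ∪ A₂) ∪ (A₃ ∪ A₄) := by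
    intro S hS
    by_contra hcon
    simp only [Set.mem_union, not_or] at hcon
    obtain ⟨⟨n1, n2⟩, n3, n4⟩ := hcon
    simp only [A₁, A₂, A₃, A₄, Set.mem_ofPred_eq, not_le, ← mul_sum] at n1 n2 n3 n4
    refine hS ⟨(lt_of_mul_lt_mul_left n1 hpos.le).le, ?_, ?_⟩
    · rw [abs_le]
      have := lt_of_mul_lt_mul_left n2 hpos.le
      rw [neg_mul, ← mul_neg] at n3
      have := lt_of_mul_lt_mul_left n3 hpos.le
      constructor <;> linarith
    · have h1 : (n:ℝ) * (3 * ε) + u ≤ a * t := by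
        have h2 : a * t = (24 * Real.exp a + 1) * (ε * n) := by rw [ht]; field_simp
        rw [h2, hu]
        have h3 : 1 ≤ Real.exp a := Real.one_le_exp ha0.le
        have h4 : 0 ≤ ε * n := by positivity
        nlinarith
      exact (lt_of_mul_lt_mul_left (n4.trans_le h1) ha0.le).le
  calc _ ≤ (Measure.pi fun _ : Fin n => P) ((A₁ ∪ A₂) ∪ (A₃ ∪ A₄)) := measure_mono hsub
    _ ≤ _ := (measure_union_le _ _).trans (add_le_add (measure_union_le _ _)
        (measure_union_le _ _))
    _ ≤ _ := add_le_add (add_le_add c1 c2) (add_le_add c3 c4)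
    _ = _ := by ring

/-- Union bound over the net, with four events per direction. The `7` comes from `4 * 125 ^ d ≤ 500
^ d ≤ exp (7 * d)`. The bound is for an outer measure, so the unstable set need not be measurable.
-/
theorem exists_pi_not_isStable_le (hK : 0 < K) :
    ∃ c : ℝ, 0 < c ∧ ∀ (d n : ℕ) (ε L τ : ℝ), 1 ≤ d → 0 < ε → ε ≤ 1 / 2 →
      Real.log (1 / ε) ≤ L → 0 < τ → τ < 1 → 7 * (d + Real.log (1 / τ)) ≤ ε ^ 2 * n →
      ∀ (P : Measure (EuclideanSpace ℝ (Fin d))) [IsProbabilityMeasure P],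
        IsIdentityCovSubgaussian K P →
        (Measure.pi fun _ : Fin n => P) {S | ¬ IsStable c ε L fun j => S j - mean P} ≤
          ENNReal.ofReal τ := by
  set a := 1 / (4 * K ^ 2) with ha
  have ha0 : 0 < a := by rw [ha]; positivity
  have hea : 1 ≤ Real.exp a := Real.one_le_exp ha0.le
  set b := (24 * Real.exp a + 1) / a with hb
  have hb0 : 0 < b := by positivity
  have hba : 1 / a ≤ b := div_le_div_of_nonneg_right (by linarith) ha0.le
  refine ⟨3 * b, by positivity, ?_⟩
  intro d n ε L τ hd hε hε2 hL hτ hτ1 hn P _ hP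
  have hL0 : 0 ≤ L := (Real.log_nonneg (by rw [le_div_iff₀ hε]; linarith)).trans hL
  obtain ⟨N, hNc, hN1, hN⟩ := exists_net_sphere (E := EuclideanSpace ℝ (Fin d))
  set t := b * (ε * n) with ht
  have ht0 : 0 ≤ t := by positivity
  have hct : 3 * b * ε * n = 3 * t := by rw [ht]; ring
  have hsub : {S : Fin n → EuclideanSpace ℝ (Fin d) | ¬ IsStable (3 * b) ε L fun j => S j - mean P} ⊆
      ⋃ p ∈ N, {S | ¬ (∑ j, inner ℝ p (S j - mean P) ≤ t ∧
      |∑ j, ((inner ℝ p (S j - mean P)) ^ 2 - 1)| ≤ t ∧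
      ∑ j, max ((inner ℝ p (S j - mean P)) ^ 2 - L / a) 0 ≤ t)} := by
    intro S hS
    by_contra hcon
    simp only [Set.mem_iUnion, Set.mem_ofPred_eq, not_exists, not_not] at hcon
    refine hS ⟨?_, fun v hv => ?_, fun v hv => ?_⟩
    · rw [hct]
      exact (norm_sum_le_of_net _ hN (fun p hp => (hcon p hp).1) ht0).trans (by linarith)
    · rw [hct]
      exact abs_quadratic_le_of_net _ hN1 hN (fun p hp => (hcon p hp).2.1) v hv
    · rw [hct]
      refine le_trans (sum_le_sum fun j _ => max_le_max (sub_le_sub_left ?_ _) le_rfl)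
        (excess_le_of_net _ hN (by positivity : 0 ≤ L / a) (fun p hp => (hcon p hp).2.2) v hv)
      rw [div_eq_mul_one_div, mul_assoc]
      have := mul_le_mul_of_nonneg_left hba hL0
      linarith
  have hcard : (4 : ℝ) * 125 ^ d * Real.exp (-(ε ^ 2 * n)) ≤ τ := by
    have h7 : (500 : ℝ) ≤ Real.exp 7 := by
      have h1 := Real.exp_one_gt_d9
      have h2 : Real.exp 7 = Real.exp 1 ^ 7 := by rw [← Real.exp_nat_mul]; norm_num
      rw [h2]
      calc (500 : ℝ) ≤ 2.7 ^ 7 := by norm_num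
        _ ≤ _ := pow_le_pow_left₀ (by norm_num) (by linarith) 7
    have h2 : (4 : ℝ) * 125 ^ d ≤ Real.exp (7 * d) := by
      calc (4 : ℝ) * 125 ^ d ≤ 4 ^ d * 125 ^ d := by
            refine mul_le_mul_of_nonneg_right ?_ (by positivity)
            exact le_self_pow₀ (by norm_num) (by omega)
        _ = 500 ^ d := by rw [← mul_pow]; norm_num
        _ ≤ Real.exp 7 ^ d := pow_le_pow_left₀ (by norm_num) h7 d
        _ = Real.exp (7 * d) := by rw [← Real.exp_nat_mul, mul_comm]
    have hlog : 0 ≤ Real.log (1 / τ) := Real.log_nonneg (by rw [le_div_iff₀ hτ]; linarith)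
    calc (4 : ℝ) * 125 ^ d * Real.exp (-(ε ^ 2 * n))
        ≤ Real.exp (7 * d) * Real.exp (-(7 * d + Real.log (1 / τ))) := by
          refine mul_le_mul h2 (Real.exp_le_exp.2 ?_) (Real.exp_pos _).le (Real.exp_pos _).le
          linarith
      _ = τ := by
          rw [← Real.exp_add, one_div, Real.log_inv]
          have : 7 * (d:ℝ) + -(7 * d + -Real.log τ) = Real.log τ := by ring
          rw [this, Real.exp_log hτ]
  calc _ ≤ _ := measure_mono hsub
    _ ≤ ∑ p ∈ N, _ := measure_biUnion_finset_le _ _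
    _ ≤ ∑ p ∈ N, 4 * ENNReal.ofReal (Real.exp (-(ε ^ 2 * n))) :=
        sum_le_sum fun p hp => hP.pi_direction_le hK (hN1 p hp) hε hε2 hL ha ht
    _ = ENNReal.ofReal (#N * (4 * Real.exp (-(ε ^ 2 * n)))) := by
        rw [sum_const, nsmul_eq_mul, ENNReal.ofReal_mul (by positivity),
          ENNReal.ofReal_mul (by norm_num), ENNReal.ofReal_natCast]
        norm_num
    _ ≤ ENNReal.ofReal τ := by
        refine ENNReal.ofReal_le_ofReal (le_trans ?_ hcard)
        have : (#N : ℝ) ≤ 125 ^ d := by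
          have := hNc
          rw [finrank_euclideanSpace_fin] at this
          exact_mod_cast this
        have h0 := Real.exp_pos (-(ε ^ 2 * n))
        nlinarith

end Stability
end RobustMean
namespace RobustMean
open Finset

/-! ### Regular families and balanced weights. -/

section Regular

/-- Regularity of vectors `η 0, …, η (n - 1)` that project a stable sample. -/
structure IsRegular {n : ℕ} {F : Type*} [NormedAddCommGroup F] [InnerProductSpace ℝ F]
    (c ε L : ℝ) (η : Fin n → F) : Prop where
  norm_sum_le : ‖∑ j, η j‖ ≤ c * ε * n
  sum_sq_le : ∑ j, ‖η j‖ ^ 2 ≤ n + c * ε * n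
  excess_le : ∑ j, max (‖η j‖ ^ 2 - c * L) 0 ≤ c * ε * n

/-- The weights `w` agree with the indicator of `G` up to a small total mass, and have removed
at least as much mass outside `G` as inside. -/
structure IsBalanced {n : ℕ} (ε : ℝ) (G : Finset (Fin n)) (w : Fin n → ℝ) : Prop where
  nonneg : ∀ j, 0 ≤ w j
  le_one : ∀ j, w j ≤ 1
  card_le : (#Gᶜ : ℝ) ≤ ε * n
  removed_le : ∑ j ∈ G, (1 - w j) ≤ ∑ j ∈ Gᶜ, (1 - w j)

variable {n d : ℕ} {c ε L : ℝ}

theorem IsStable.sum_inner_sq_le {y : Fin n → EuclideanSpace ℝ (Fin d)} (hy : IsStable c ε L y)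
    (b : EuclideanSpace ℝ (Fin d)) :
    ∑ j, (inner ℝ b (y j)) ^ 2 ≤ ‖b‖ ^ 2 * (n + c * ε * n) := by
  rcases eq_or_ne b 0 with h0 | h0
  · simp [h0]
  have hb : 0 < ‖b‖ := norm_pos_iff.2 h0
  have h1 := (abs_le.1 (hy.abs_quadratic_le (‖b‖⁻¹ • b) (by
    rw [norm_smul, norm_inv, norm_norm, inv_mul_cancel₀ hb.ne']))).2
  simp only [real_inner_smul_left, mul_pow, sum_sub_distrib, ← mul_sum, inv_pow] at h1
  simp only [sum_const, card_univ, Fintype.card_fin, nsmul_eq_mul, mul_one] at h1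
  rw [← inv_mul_le_iff₀ (by positivity)]
  linarith

theorem IsStable.sum_inner_excess_le {y : Fin n → EuclideanSpace ℝ (Fin d)}
    (hy : IsStable c ε L y) (b : EuclideanSpace ℝ (Fin d)) :
    ∑ j, max ((inner ℝ b (y j)) ^ 2 - ‖b‖ ^ 2 * (c * L)) 0 ≤ ‖b‖ ^ 2 * (c * ε * n) := by
  rcases eq_or_ne b 0 with h0 | h0
  · simp [h0]
  have hb : 0 < ‖b‖ := norm_pos_iff.2 h0
  have h1 := hy.excess_le (‖b‖⁻¹ • b) (by
    rw [norm_smul, norm_inv, norm_norm, inv_mul_cancel₀ hb.ne'])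
  refine le_trans (le_of_eq ?_) (mul_le_mul_of_nonneg_left h1 (sq_nonneg ‖b‖))
  rw [mul_sum]
  refine sum_congr rfl fun j _ => ?_
  rw [mul_max_of_nonneg _ _ (sq_nonneg ‖b‖), mul_zero, real_inner_smul_left]
  congr 1
  field_simp

/-- Each bound in direction `b k` scales with `‖b k‖ ^ 2`, and these squares sum to `1`: a
projection of Frobenius norm `1` is an average of directions. For the excess, subadditivity of the
positive part is used. -/
theorem IsStable.isRegular {y : Fin n → EuclideanSpace ℝ (Fin d)} (hy : IsStable c ε L y)
    (b : Fin d → EuclideanSpace ℝ (Fin d)) (hb : ∑ k, ‖b k‖ ^ 2 = 1) :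
    IsRegular c ε L fun j => WithLp.toLp 2 fun k => (inner ℝ (b k) (y j) : ℝ) := by
  have hsq : ∀ j, ‖(WithLp.toLp 2 fun k => (inner ℝ (b k) (y j) : ℝ) :
      EuclideanSpace ℝ (Fin d))‖ ^ 2 = ∑ k, (inner ℝ (b k) (y j)) ^ 2 := by
    intro j
    rw [EuclideanSpace.norm_sq_eq]
    simp
  refine ⟨?_, ?_, ?_⟩
  · refine le_trans ?_ hy.norm_sum_le
    rw [← Real.sqrt_sq (norm_nonneg (∑ j, y j)), EuclideanSpace.norm_eq]
    refine Real.sqrt_le_sqrt ?_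
    calc _ ≤ ∑ k, ‖b k‖ ^ 2 * ‖∑ j, y j‖ ^ 2 := by
          refine sum_le_sum fun k _ => ?_
          have : (∑ j, (WithLp.toLp 2 fun k => (inner ℝ (b k) (y j) : ℝ) :
              EuclideanSpace ℝ (Fin d))) k = inner ℝ (b k) (∑ j, y j) := by
            simp [inner_sum]
          rw [this, Real.norm_eq_abs, ← mul_pow]
          exact pow_le_pow_left₀ (abs_nonneg _) (abs_real_inner_le_norm _ _) 2
      _ = ‖∑ j, y j‖ ^ 2 := by rw [← sum_mul, hb, one_mul]
  · simp_rw [hsq]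
    rw [sum_comm]
    refine (sum_le_sum fun k _ => hy.sum_inner_sq_le (b k)).trans (le_of_eq ?_)
    rw [← sum_mul, hb, one_mul]
  · simp_rw [hsq]
    calc _ ≤ ∑ j, ∑ k, max ((inner ℝ (b k) (y j)) ^ 2 - ‖b k‖ ^ 2 * (c * L)) 0 := by
          refine sum_le_sum fun j _ => max_le ?_ (sum_nonneg fun k _ => le_max_right _ _)
          calc _ = ∑ k, ((inner ℝ (b k) (y j)) ^ 2 - ‖b k‖ ^ 2 * (c * L)) := by
                rw [sum_sub_distrib, ← sum_mul, hb, one_mul]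
            _ ≤ _ := sum_le_sum fun k _ => le_max_left _ _
      _ ≤ ∑ k, ‖b k‖ ^ 2 * (c * ε * n) := by
          rw [sum_comm]
          exact sum_le_sum fun k _ => hy.sum_inner_excess_le (b k)
      _ = _ := by rw [← sum_mul, hb, one_mul]

variable {F : Type*} [NormedAddCommGroup F] [InnerProductSpace ℝ F]

/-- Weighted Cauchy–Schwarz inequality. -/
theorem norm_sum_smul_sq_le {ι : Type*} (s : Finset ι) {b : ι → ℝ} (hb : ∀ j ∈ s, 0 ≤ b j)
    (z : ι → F) : ‖∑ j ∈ s, b j • z j‖ ^ 2 ≤ (∑ j ∈ s, b j) * ∑ j ∈ s, b j * ‖z j‖ ^ 2 := by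
  have h1 : ‖∑ j ∈ s, b j • z j‖ ≤ ∑ j ∈ s, b j * ‖z j‖ :=
    (norm_sum_le _ _).trans (sum_le_sum fun j hj => by
      rw [norm_smul, Real.norm_of_nonneg (hb j hj)])
  refine (pow_le_pow_left₀ (norm_nonneg _) h1 2).trans ?_
  exact sum_sq_le_sum_mul_sum_of_sq_le_mul s hb
    (fun j hj => mul_nonneg (hb j hj) (sq_nonneg _)) fun j hj => le_of_eq (by ring)

/-- A part of small mass of a regular family has a small second moment. -/
theorem IsRegular.sum_mul_sq_le {η : Fin n → F} (h : IsRegular c ε L η) (hc : 0 ≤ c)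
    (hε : 0 ≤ ε) (hL : 1 ≤ L) {b : Fin n → ℝ} (hb0 : ∀ j, 0 ≤ b j) (hb1 : ∀ j, b j ≤ 1)
    (hb : ∑ j, b j ≤ 2 * ε * n) : ∑ j, b j * ‖η j‖ ^ 2 ≤ 3 * c * (ε * L) * n := by
  -- Split at the level `c * L`: the part below costs `2 c ε L n`, the part above at most `c ε n`.
  have h1 : ∑ j, b j * ‖η j‖ ^ 2 ≤ ∑ j, (b j * (c * L) + max (‖η j‖ ^ 2 - c * L) 0) := by
    refine sum_le_sum fun j _ => ?_
    have h2 := le_max_left (‖η j‖ ^ 2 - c * L) 0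
    have h3 := le_max_right (‖η j‖ ^ 2 - c * L) 0
    nlinarith [hb0 j, hb1 j]
  rw [sum_add_distrib, ← sum_mul] at h1
  have h4 := h.excess_le
  have h5 : (∑ j, b j) * (c * L) ≤ 2 * ε * n * (c * L) :=
    mul_le_mul_of_nonneg_right hb (by positivity)
  have h6 : c * ε * n ≤ c * ε * n * L := le_mul_of_one_le_right (by positivity) hL
  linarith

theorem norm_add_sq_le_two (x z : F) : ‖x + z‖ ^ 2 ≤ 2 * ‖x‖ ^ 2 + 2 * ‖z‖ ^ 2 := by
  have := parallelogram_law_with_norm ℝ x z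
  nlinarith [sq_nonneg ‖x - z‖]

/-- Removing a part of small mass from a regular family leaves a small sum. -/
theorem IsRegular.norm_sum_sq_le {η : Fin n → F} (h : IsRegular c ε L η) (hc : 0 ≤ c)
    (hε : 0 ≤ ε) (hL : 1 ≤ L) {b : Fin n → ℝ} (hb0 : ∀ j, 0 ≤ b j) (hb1 : ∀ j, b j ≤ 1)
    (hb : ∑ j, b j ≤ 2 * ε * n) :
    ‖∑ j, (1 - b j) • η j‖ ^ 2 ≤ (2 * c ^ 2 + 12 * c) * (ε ^ 2 * L * n ^ 2) := by
  -- The full sum contributes `2 c²`; the removed part, by Cauchy–Schwarz, contributes `2 * 2 * 3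
  -- c`.
  have e : ∑ j, (1 - b j) • η j = ∑ j, η j + -∑ j, b j • η j := by
    rw [← sub_eq_add_neg, ← sum_sub_distrib]
    exact sum_congr rfl fun j _ => by rw [sub_smul, one_smul]
  rw [e]
  refine (norm_add_sq_le_two _ _).trans ?_
  rw [norm_neg]
  have h1 := pow_le_pow_left₀ (norm_nonneg _) h.norm_sum_le 2
  have h2 := norm_sum_smul_sq_le univ (fun j _ => hb0 j) η
  have h3 := h.sum_mul_sq_le hc hε hL hb0 hb1 hb
  have h4 : (∑ j, b j) * ∑ j, b j * ‖η j‖ ^ 2 ≤ 2 * ε * n * (3 * c * (ε * L) * n) :=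
    mul_le_mul hb h3 (sum_nonneg fun j _ => mul_nonneg (hb0 j) (sq_nonneg _)) (by positivity)
  have h5 : (c * ε * n) ^ 2 ≤ (c * ε * n) ^ 2 * L := le_mul_of_one_le_right (by positivity) hL
  nlinarith

variable {G : Finset (Fin n)} {w : Fin n → ℝ}

theorem IsBalanced.sum_compl_le (h : IsBalanced ε G w) : ∑ j ∈ Gᶜ, w j ≤ ε * n := by
  refine le_trans (sum_le_sum fun j _ => h.le_one j) ?_
  simpa using h.card_le

theorem IsBalanced.add_le_sum (h : IsBalanced ε G w) :
    ∑ j ∈ Gᶜ, w j + (1 - 2 * ε) * n ≤ ∑ j ∈ G, w j := by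
  have h1 := h.removed_le
  have h2 := h.card_le
  have h3 : (#G : ℝ) + #Gᶜ = n := by
    have := card_add_card_compl G
    rw [Fintype.card_fin] at this
    exact_mod_cast this
  simp only [sum_sub_distrib, sum_const, nsmul_eq_mul, mul_one] at h1
  linarith

theorem IsBalanced.sum_le (h : IsBalanced ε G w) : ∑ j ∈ G, w j ≤ n := by
  refine le_trans (sum_le_sum fun j _ => h.le_one j) ?_
  have : #G ≤ n := (card_le_univ G).trans (by simp)
  simpa using this

/-- The mass that the weights `w`, restricted to `G`, are missing. -/
def missing (G : Finset (Fin n)) (w : Fin n → ℝ) (j : Fin n) : ℝ := if j ∈ G then 1 - w j else 1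

theorem IsBalanced.missing_nonneg (h : IsBalanced ε G w) (j : Fin n) : 0 ≤ missing G w j := by
  unfold missing; split_ifs <;> linarith [h.le_one j]

theorem IsBalanced.missing_le_one (h : IsBalanced ε G w) (j : Fin n) : missing G w j ≤ 1 := by
  unfold missing; split_ifs <;> linarith [h.nonneg j]

/-- By balance, the mass removed inside `G` is at most that removed outside, hence at most `ε n`;
omitting `Gᶜ` altogether costs another `ε n`. -/
theorem IsBalanced.sum_missing_le (h : IsBalanced ε G w) : ∑ j, missing G w j ≤ 2 * ε * n := by
  have h1 : ∑ j, missing G w j = ∑ j ∈ G, (1 - w j) + #Gᶜ := by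
    rw [← sum_add_sum_compl G]
    congr 1
    · exact sum_congr rfl fun j hj => by simp [missing, hj]
    · rw [card_eq_sum_ones, Nat.cast_sum]
      exact sum_congr rfl fun j hj => by simp [missing, mem_compl.1 hj]
  have h2 : ∑ j ∈ Gᶜ, (1 - w j) ≤ #Gᶜ := by
    refine (sum_le_sum fun j _ => (by linarith [h.nonneg j] : 1 - w j ≤ 1)).trans ?_
    simp
  linarith [h.removed_le, h.card_le]

theorem sum_one_sub_missing_smul (η : Fin n → F) :
    ∑ j, (1 - missing G w j) • η j = ∑ j ∈ G, w j • η j := by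
  rw [← sum_add_sum_compl G, sum_eq_zero (s := Gᶜ), add_zero]
  · exact sum_congr rfl fun j hj => by simp [missing, hj]
  · exact fun j hj => by simp [missing, mem_compl.1 hj]

theorem sum_one_sub_missing_mul (f : Fin n → ℝ) :
    ∑ j, (1 - missing G w j) * f j = ∑ j ∈ G, w j * f j := by
  simpa using sum_one_sub_missing_smul (G := G) (w := w) f

/-- The weight `s` allows a factor arbitrarily close to `1` on one term. This is what makes every
`ε₀ < 1 / 2` admissible. -/
theorem norm_sub_sq_le_weighted {s : ℝ} (hs : 0 < s) (x z : F) :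
    ‖x - z‖ ^ 2 ≤ (1 + 1 / s) * ‖x‖ ^ 2 + (1 + s) * ‖z‖ ^ 2 := by
  have h1 : 0 ≤ s⁻¹ * ‖x + s • z‖ ^ 2 := by positivity
  rw [norm_add_sq_real, norm_smul, real_inner_smul_right, Real.norm_of_nonneg hs.le] at h1
  rw [norm_sub_sq_real]
  have h2 : s⁻¹ * (‖x‖ ^ 2 + 2 * (s * inner ℝ x z) + (s * ‖z‖) ^ 2) =
      1 / s * ‖x‖ ^ 2 + 2 * inner ℝ x z + s * ‖z‖ ^ 2 := by
    field_simp
  rw [h2] at h1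
  linarith

end Regular
end RobustMean
namespace RobustMean
open Finset

/-! ### Bad points carry most of the excess, and small variance forces a small error. -/

section Filter

variable {n : ℕ} {c ε L : ℝ} {F : Type*} [NormedAddCommGroup F] [InnerProductSpace ℝ F]
  {G : Finset (Fin n)} {w : Fin n → ℝ} {a η : Fin n → F} {m : F}

theorem sum_weight_smul_sub (hm : (∑ j, w j) • m = ∑ j, w j • a j) :
    ∑ j, w j • (a j - m) = 0 := by
  simp only [smul_sub, sum_sub_distrib, ← sum_smul, hm, sub_self]

/-- The displacement of the good part is compensated by the bad part. -/
theorem IsBalanced.norm_displacement_sq_le (h : IsBalanced ε G w)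
    (hm : (∑ j, w j) • m = ∑ j, w j • a j) (ha : ∀ j ∈ G, a j = η j) :
    ‖(∑ j ∈ G, w j) • m - ∑ j ∈ G, w j • η j‖ ^ 2 ≤
      (∑ j ∈ Gᶜ, w j) * ∑ j ∈ Gᶜ, w j * ‖a j - m‖ ^ 2 := by
  have h1 := sum_weight_smul_sub hm
  rw [← sum_add_sum_compl G] at h1
  have h2 : ∑ j ∈ G, w j • (a j - m) = ∑ j ∈ G, w j • η j - (∑ j ∈ G, w j) • m := by
    rw [sum_smul, ← sum_sub_distrib]
    exact sum_congr rfl fun j hj => by rw [smul_sub, ha j hj]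
  rw [h2] at h1
  have h3 : (∑ j ∈ G, w j) • m - ∑ j ∈ G, w j • η j = ∑ j ∈ Gᶜ, w j • (a j - m) := by
    rw [← sub_eq_zero, ← neg_eq_zero, ← h1]; abel
  rw [h3]
  exact norm_sum_smul_sq_le _ (fun j _ => h.nonneg j) _

theorem sum_good_sq_eq (ha : ∀ j ∈ G, a j = η j) :
    ∑ j ∈ G, w j * ‖a j - m‖ ^ 2 = ∑ j ∈ G, w j * ‖η j‖ ^ 2 -
      2 * inner ℝ m (∑ j ∈ G, w j • η j) + (∑ j ∈ G, w j) * ‖m‖ ^ 2 := by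
  rw [inner_sum, mul_sum, sum_mul, ← sum_sub_distrib, ← sum_add_distrib]
  refine sum_congr rfl fun j hj => ?_
  rw [ha j hj, norm_sub_sq_real, real_inner_smul_right, real_inner_comm]
  ring

set_option maxHeartbeats 1000000 in
/-- The arithmetic behind the filter step. -/
theorem filter_arith {ε₀ s c ε L N c₃ k₁ k₂ k₃ k₄ k₅ CT Cθ : ℝ} (hε₀' : ε₀ < 1 / 2)
    (hs : s = (1 - ε₀ / (1 - ε₀)) / 4) (hc : 0 ≤ c) (hc₃ : 0 ≤ c₃)
    (hk₃ : k₃ = (1 + 1 / s) * c₃ / (1 - 2 * ε₀))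
    (hk₁ : k₁ = (1 + 1 / s) * c + CT + (1 + s) * k₃) (hk₂ : k₂ = k₁ / (2 * s))
    (hk₄ : k₄ = k₂ + CT + k₃)
    (hk₅ : k₅ = c + k₄ / (1 - 2 * ε₀) + c₃ + k₄ + k₂ + CT) (hCT : 0 ≤ CT)
    (hCθ : k₅ + 2 ≤ Cθ * (1 - 2 * ε₀))
    (hε : 0 < ε) (hεε₀ : ε ≤ ε₀) (hL : 1 ≤ L) (hN : 0 < N)
    {good bad WG WB D Q Tot : ℝ} (hbad : 0 ≤ bad) (hWB0 : 0 ≤ WB) (hD : 0 ≤ D)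
    (hWB : WB ≤ ε * N) (hWG : WB + (1 - 2 * ε) * N ≤ WG)
    (f1 : good ≤ (1 + 1 / s) * (c * ε * N) + (1 + s) * (WG * D))
    (f2 : WG ^ 2 * D ≤ (1 + s) * (WB * (bad + CT * L * WB)) + (1 + 1 / s) * Q)
    (f3 : Q ≤ c₃ * (ε ^ 2 * L * N ^ 2))
    (f4 : Tot ≤ N + c * ε * N + N * D + Q / N + WG * D + bad + CT * L * WB)
    (f5 : (1 + Cθ * (ε * L)) * (WG + WB) < Tot) : good < bad := by
  -- If the good excess were at least the bad one, a self-bounding inequality would make both `O(ε L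
  -- N)`. Then the total would be `N + O(ε L N)`, below the activation threshold.
  by_contra! hcon
  have hε₀ : 0 < ε₀ := hε.trans_le hεε₀
  obtain ⟨r, hr⟩ : ∃ r, r = ε₀ / (1 - ε₀) := ⟨_, rfl⟩
  rw [← hr] at hs
  have h1ε : 0 < 1 - ε₀ := by linarith
  have hr1 : r < 1 := by rw [hr, div_lt_one h1ε]; linarith
  have hr0 : 0 < r := by rw [hr]; positivity
  have hs0 : 0 < s := by rw [hs]; linarith
  have hrs : r = 1 - 4 * s := by rw [hs]; ring
  have hc₀ : 0 < 1 - 2 * ε₀ := by linarith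
  obtain ⟨κ, hκ⟩ : ∃ κ, κ = ε * L := ⟨_, rfl⟩
  rw [← hκ] at f5
  have hκ0 : 0 < κ := by rw [hκ]; positivity
  have hεκ : ε ≤ κ := by rw [hκ]; exact le_mul_of_one_le_right hε.le hL
  have hεN : 0 ≤ (ε₀ - ε) * N := mul_nonneg (by linarith) hN.le
  have hWG0 : (1 - 2 * ε₀) * N ≤ WG := by linarith
  have hWGpos : 0 < WG := lt_of_lt_of_le (by positivity) hWG0
  -- The margin `r < 1` is where `ε₀ < 1 / 2` enters; `s` is chosen so that `r = 1 - 4 * s`.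
  have hWBr : WB ≤ r * WG := by
    rw [hr, div_mul_eq_mul_div, le_div_iff₀ h1ε]
    have h1 : 0 ≤ ε₀ * (WG - (WB + (1 - 2 * ε) * N)) := mul_nonneg hε₀.le (by linarith)
    have h2 : 0 ≤ (1 - 2 * ε₀) * (ε * N - WB) := mul_nonneg hc₀.le (by linarith)
    linarith
  have h1s : 0 < 1 + 1 / s := by positivity
  have hk₃0 : 0 ≤ k₃ := by rw [hk₃]; positivity
  have hk₁0 : 0 ≤ k₁ := by rw [hk₁]; positivity
  have hk₂0 : 0 ≤ k₂ := by rw [hk₂]; positivity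
  have hk₄0 : 0 ≤ k₄ := by rw [hk₄]; positivity
  have hL0 : 0 ≤ L := by linarith
  have hTW : CT * L * WB ≤ CT * κ * N := by
    calc CT * L * WB ≤ CT * L * (ε * N) := by gcongr
      _ = CT * κ * N := by rw [hκ]; ring
  have hQ' : (1 + 1 / s) * Q ≤ WG * (k₃ * κ * N) := by
    calc (1 + 1 / s) * Q ≤ (1 + 1 / s) * (c₃ * (ε ^ 2 * L * N ^ 2)) := by gcongr
      _ = ε * ((1 - 2 * ε₀) * N * (k₃ * κ * N)) := by rw [hk₃, hκ]; field_simp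
      _ ≤ 1 * (WG * (k₃ * κ * N)) := by gcongr; linarith
      _ = _ := one_mul _
  have hWGD : WG * D ≤ (1 + s) * r * (bad + CT * κ * N) + k₃ * κ * N := by
    have h1 : WG * (WG * D) ≤ WG * ((1 + s) * r * (bad + CT * κ * N) + k₃ * κ * N) := by
      calc WG * (WG * D) = WG ^ 2 * D := by ring
        _ ≤ (1 + s) * (WB * (bad + CT * L * WB)) + (1 + 1 / s) * Q := f2
        _ ≤ (1 + s) * (r * WG * (bad + CT * κ * N)) + WG * (k₃ * κ * N) := by gcongr
        _ = _ := by ring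
    exact le_of_mul_le_mul_left h1 hWGpos
  have hbk : bad + CT * κ * N ≥ 0 := by positivity
  have hsr2 : (1 + s) * ((1 + s) * r) ≤ 1 - 2 * s := by
    have h1 : (1 + s) * ((1 + s) * (1 - 4 * s)) = 1 - 2 * s - (7 * s ^ 2 + 4 * s ^ 3) := by ring
    have h2 : 0 ≤ 7 * s ^ 2 + 4 * s ^ 3 := by positivity
    rw [hrs, h1]; linarith only [h2]
  have hsr1 : (1 + s) * r ≤ 1 := by
    have h1 : (1 + s) * (1 - 4 * s) = 1 - (3 * s + 4 * s ^ 2) := by ring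
    have h2 : 0 ≤ 3 * s + 4 * s ^ 2 := by positivity
    rw [hrs, h1]; linarith only [h2]
  -- The bad points shift the mean, and the shift creates good excess, in all at most `(1 - 2 * s) *
  -- bad + O(κ N)`. Under `hcon` the factor below `1` lets `good` be absorbed on the left.
  have hgood : good ≤ k₂ * κ * N := by
    have h1 : good ≤ (1 + 1 / s) * (c * κ * N) + (1 - 2 * s) * (bad + CT * κ * N) +
        (1 + s) * k₃ * κ * N := by
      calc good ≤ (1 + 1 / s) * (c * ε * N) + (1 + s) * (WG * D) := f1
        _ ≤ (1 + 1 / s) * (c * κ * N) + (1 + s) * ((1 + s) * r * (bad + CT * κ * N) + k₃ * κ * N) := by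
          gcongr
        _ = (1 + 1 / s) * (c * κ * N) + (1 + s) * ((1 + s) * r) * (bad + CT * κ * N) +
          (1 + s) * k₃ * κ * N := by ring
        _ ≤ _ := by gcongr
    have h2 : (1 - 2 * s) * (bad + CT * κ * N) ≤ (1 - 2 * s) * good + CT * κ * N := by
      have h3 : 0 ≤ 1 - 2 * s := by linarith only [hrs, hr0, hs0]
      have h4 : 0 ≤ s * (CT * κ * N) := by positivity
      have h5 := mul_le_mul_of_nonneg_left hcon h3
      linarith only [h4, h5]
    have h3 : 2 * s * good ≤ k₁ * κ * N := by
      rw [hk₁]; linarith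
    rw [hk₂, div_mul_eq_mul_div, div_mul_eq_mul_div, le_div_iff₀ (by positivity)]
    linarith
  have hbad' : bad ≤ k₂ * κ * N := hcon.trans hgood
  have hWGD' : WG * D ≤ k₄ * κ * N := by
    have : (1 + s) * r * (bad + CT * κ * N) ≤ 1 * (k₂ * κ * N + CT * κ * N) := by gcongr
    rw [hk₄]; linarith
  have hND : N * D ≤ k₄ / (1 - 2 * ε₀) * κ * N := by
    rw [div_mul_eq_mul_div, div_mul_eq_mul_div, le_div_iff₀ hc₀]
    have := mul_le_mul_of_nonneg_right hWG0 hD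
    linarith
  have hQN : Q / N ≤ c₃ * κ * N := by
    rw [div_le_iff₀ hN]
    refine f3.trans ?_
    have : ε ^ 2 * L * N ^ 2 ≤ κ * N * N := by
      calc ε ^ 2 * L * N ^ 2 = ε * (κ * N * N) := by rw [hκ]; ring
        _ ≤ 1 * (κ * N * N) := by gcongr; linarith
        _ = _ := one_mul _
    calc c₃ * (ε ^ 2 * L * N ^ 2) ≤ c₃ * (κ * N * N) := by gcongr
      _ = _ := by ring
  have hcε : c * ε * N ≤ c * κ * N := by gcongr
  have hTot : Tot ≤ N + k₅ * (κ * N) := by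
    rw [hk₅]; linarith
  have hk₅0 : 0 ≤ k₅ := by rw [hk₅]; positivity
  have hCθ0 : 0 ≤ Cθ := by
    by_contra! h
    linarith only [mul_neg_of_neg_of_pos h hc₀, hk₅0, hCθ]
  have hlow : (1 - 2 * ε) * N + Cθ * κ * ((1 - 2 * ε₀) * N) ≤ (1 + Cθ * κ) * (WG + WB) := by
    have h1 : Cθ * κ * ((1 - 2 * ε₀) * N) ≤ Cθ * κ * (WG + WB) := by
      gcongr; linarith
    linarith
  have h5 : (k₅ + 2) * (κ * N) ≤ Cθ * (1 - 2 * ε₀) * (κ * N) := by gcongr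
  have h6 : ε * N ≤ κ * N := by gcongr
  linarith

/-- `CT` must absorb the level `c * L` enlarged by the factor `1 + 1 / s`, and `Cθ` all later error
terms. Both are natural numbers because they become literals of the program. -/
theorem exists_filter_constants {ε₀ c : ℝ} (hε₀ : 0 < ε₀) (hε₀' : ε₀ < 1 / 2) (hc : 0 ≤ c) :
    ∃ CT Cθ : ℕ, ∀ {n : ℕ} {ε L : ℝ} {F : Type} [NormedAddCommGroup F] [InnerProductSpace ℝ F]
      {G : Finset (Fin n)} {w : Fin n → ℝ} {a η : Fin n → F} {m : F}, 0 < ε → ε ≤ ε₀ → 1 ≤ L →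
      0 < n → IsBalanced ε G w → IsRegular c ε L η → (∑ j, w j) • m = ∑ j, w j • a j →
      (∀ j ∈ G, a j = η j) →
      (1 + Cθ * (ε * L)) * ∑ j, w j < ∑ j, w j * ‖a j - m‖ ^ 2 →
      ∑ j ∈ G, w j * max (‖a j - m‖ ^ 2 - CT * L) 0 <
        ∑ j ∈ Gᶜ, w j * max (‖a j - m‖ ^ 2 - CT * L) 0 := by
  set s := (1 - ε₀ / (1 - ε₀)) / 4 with hs
  set c₃ := 2 * c ^ 2 + 12 * c with hc₃
  obtain ⟨CT, hCT⟩ := exists_nat_ge ((1 + 1 / s) * c)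
  set k₃ := (1 + 1 / s) * c₃ / (1 - 2 * ε₀) with hk₃
  set k₁ := (1 + 1 / s) * c + CT + (1 + s) * k₃ with hk₁
  set k₂ := k₁ / (2 * s) with hk₂
  set k₄ := k₂ + CT + k₃ with hk₄
  set k₅ := c + k₄ / (1 - 2 * ε₀) + c₃ + k₄ + k₂ + CT with hk₅
  obtain ⟨Cθ, hCθ⟩ := exists_nat_ge ((k₅ + 2) / (1 - 2 * ε₀))
  rw [div_le_iff₀ (by linarith)] at hCθ
  refine ⟨CT, Cθ, ?_⟩
  intro n ε L F _ _ G w a η m hε hεε₀ hL hn hw hη hm ha htot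
  have hs0 : 0 < s := by
    have : ε₀ / (1 - ε₀) < 1 := by rw [div_lt_one (by linarith)]; linarith
    rw [hs]; linarith
  have hq := hη.norm_sum_sq_le hc hε.le hL hw.missing_nonneg hw.missing_le_one hw.sum_missing_le
  rw [sum_one_sub_missing_smul] at hq
  have hdisp := hw.norm_displacement_sq_le hm ha
  have hN : (0 : ℝ) < n := by exact_mod_cast hn
  have hWG := hw.add_le_sum
  have hWB := hw.sum_compl_le
  have hWB0 : 0 ≤ ∑ j ∈ Gᶜ, w j := sum_nonneg fun j _ => hw.nonneg j
  have hWG0 : 0 ≤ ∑ j ∈ G, w j := sum_nonneg fun j _ => hw.nonneg j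
  have hWGn := hw.sum_le
  have hgeq := sum_good_sq_eq (w := w) (m := m) ha
  set q := ∑ j ∈ G, w j • η j with hqdef
  set WG := ∑ j ∈ G, w j with hWGdef
  set WB := ∑ j ∈ Gᶜ, w j with hWBdef
  have hbadsq : ∑ j ∈ Gᶜ, w j * ‖a j - m‖ ^ 2 ≤
      ∑ j ∈ Gᶜ, w j * max (‖a j - m‖ ^ 2 - CT * L) 0 + CT * L * WB := by
    rw [hWBdef, mul_sum, ← sum_add_distrib]
    refine sum_le_sum fun j _ => ?_
    nlinarith [hw.nonneg j, le_max_left (‖a j - m‖ ^ 2 - CT * L) 0]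
  have hcT : (1 + 1 / s) * (c * L) ≤ CT * L := by
    rw [← mul_assoc]; exact mul_le_mul_of_nonneg_right hCT (by linarith)
  refine filter_arith (ε₀ := ε₀) (N := n) (D := ‖m‖ ^ 2) (Q := ‖q‖ ^ 2) (WG := WG) (WB := WB)
    hε₀' hs hc (by positivity) hk₃ hk₁ hk₂ hk₄ hk₅ (Nat.cast_nonneg _) hCθ hε hεε₀ hL hN
    (sum_nonneg fun j _ => mul_nonneg (hw.nonneg j) (le_max_right _ _)) hWB0 (sq_nonneg _) hWB hWG
    ?_ ?_ hq (Tot := ∑ j, w j * ‖a j - m‖ ^ 2) ?_ ?_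
  · have h1 : ∀ j ∈ G, w j * max (‖a j - m‖ ^ 2 - CT * L) 0 ≤
        (1 + 1 / s) * max (‖η j‖ ^ 2 - c * L) 0 + (1 + s) * (w j * ‖m‖ ^ 2) := by
      intro j hj
      have h2 := norm_sub_sq_le_weighted hs0 (η j) m
      have h3 := le_max_left (‖η j‖ ^ 2 - c * L) 0
      have h4 := le_max_right (‖η j‖ ^ 2 - c * L) 0
      have h5 : max (‖a j - m‖ ^ 2 - CT * L) 0 ≤
          (1 + 1 / s) * max (‖η j‖ ^ 2 - c * L) 0 + (1 + s) * ‖m‖ ^ 2 := by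
        rw [ha j hj]
        refine max_le ?_ (by positivity)
        have h6 : (1 + 1 / s) * (‖η j‖ ^ 2 - c * L) ≤
            (1 + 1 / s) * max (‖η j‖ ^ 2 - c * L) 0 := by gcongr
        linarith
      have h7 : w j * ((1 + 1 / s) * max (‖η j‖ ^ 2 - c * L) 0) ≤
          1 * ((1 + 1 / s) * max (‖η j‖ ^ 2 - c * L) 0) := by
        gcongr; exact hw.le_one j
      have h8 := mul_le_mul_of_nonneg_left h5 (hw.nonneg j)
      linarith
    refine (sum_le_sum h1).trans ?_
    rw [sum_add_distrib, ← mul_sum, ← mul_sum, ← sum_mul]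
    refine add_le_add_left (mul_le_mul_of_nonneg_left ?_ (by positivity)) _
    exact (sum_le_sum_of_subset_of_nonneg (subset_univ G) fun j _ _ => le_max_right _ _).trans
      hη.excess_le
  · have h2 := norm_sub_sq_le_weighted hs0 q (q - WG • m)
    rw [sub_sub_cancel, norm_smul, mul_pow, Real.norm_eq_abs, sq_abs, norm_sub_rev] at h2
    have h3 : (1 + s) * ‖WG • m - q‖ ^ 2 ≤ (1 + s) * (WB *
        (∑ j ∈ Gᶜ, w j * max (‖a j - m‖ ^ 2 - CT * L) 0 + CT * L * WB)) := by
      gcongr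
      exact hdisp.trans (mul_le_mul_of_nonneg_left hbadsq hWB0)
    linarith
  · rw [← sum_add_sum_compl G, hgeq]
    have h1 : ∑ j ∈ G, w j * ‖η j‖ ^ 2 ≤ n + c * ε * n := by
      refine le_trans ?_ hη.sum_sq_le
      refine (sum_le_sum fun j _ => mul_le_of_le_one_left (sq_nonneg _) (hw.le_one j)).trans ?_
      exact sum_le_sum_of_subset_of_nonneg (subset_univ G) fun j _ _ => sq_nonneg _
    have h2 : -(2 * inner ℝ m q) ≤ n * ‖m‖ ^ 2 + ‖q‖ ^ 2 / n := by
      have h3 := abs_real_inner_le_norm m q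
      have h4 := neg_abs_le (inner ℝ m q)
      have h5 : 0 ≤ (n * ‖m‖ - ‖q‖) ^ 2 / n := by positivity
      have h6 : (n * ‖m‖ - ‖q‖) ^ 2 / n = n * ‖m‖ ^ 2 - 2 * (‖m‖ * ‖q‖) + ‖q‖ ^ 2 / n := by
        field_simp; ring
      linarith
    linarith
  · rw [hWGdef, hWBdef, sum_add_sum_compl]
    exact htot

set_option maxHeartbeats 1000000 in
/-- Small variance in the direction of the displacement forces a small displacement. -/
theorem exists_displacement_constant {ε₀ c : ℝ} (hε₀' : ε₀ < 1 / 2) (hc : 0 ≤ c)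
    {C' : ℝ} (hC' : 0 ≤ C') :
    ∃ C : ℝ, 0 < C ∧ ∀ {n : ℕ} {ε L : ℝ} {G : Finset (Fin n)} {w : Fin n → ℝ} {a η : Fin n → ℝ}
      {m : ℝ}, 0 < ε → ε ≤ ε₀ → 1 ≤ L → 0 < n → IsBalanced ε G w → IsRegular c ε L η →
      n - c * ε * n ≤ ∑ j, ‖η j‖ ^ 2 →
      (∑ j, w j) • m = ∑ j, w j • a j → (∀ j ∈ G, a j = η j) →
      ∑ j, w j * ‖a j - m‖ ^ 2 ≤ (1 + C' * (ε * L)) * ∑ j, w j →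
      |m| ≤ C * (ε * √L) := by
  set c₀ := 1 - 2 * ε₀ with hc₀
  have hc₀0 : 0 < c₀ := by linarith
  set c₃ := 2 * c ^ 2 + 12 * c with hc₃
  set e₅ := C' + 4 * c + c₃ / c₀ with he₅
  refine ⟨√(2 * (e₅ + c₃) / c₀ ^ 2) + 1, by positivity, ?_⟩
  intro n ε L G w a η m hε hεε₀ hL hn hw hη hlow hm ha htot
  have hq := hη.norm_sum_sq_le hc hε.le hL hw.missing_nonneg hw.missing_le_one hw.sum_missing_le
  rw [sum_one_sub_missing_smul] at hq
  have hsm := hη.sum_mul_sq_le hc hε.le hL hw.missing_nonneg hw.missing_le_one hw.sum_missing_le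
  have hdisp := hw.norm_displacement_sq_le hm ha
  have hN : (0 : ℝ) < n := by exact_mod_cast hn
  have hWG := hw.add_le_sum
  have hWB := hw.sum_compl_le
  have hWB0 : 0 ≤ ∑ j ∈ Gᶜ, w j := sum_nonneg fun j _ => hw.nonneg j
  have hgeq := sum_good_sq_eq (w := w) (m := m) ha
  have hgood : ∑ j ∈ G, w j * ‖η j‖ ^ 2 = ∑ j, ‖η j‖ ^ 2 - ∑ j, missing G w j * ‖η j‖ ^ 2 := by
    rw [← sum_one_sub_missing_mul, ← sum_sub_distrib]
    exact sum_congr rfl fun j _ => by ring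
  have hWle : ∑ j, w j ≤ n := by
    refine (sum_le_sum fun j _ => hw.le_one j).trans ?_
    simp
  rw [← sum_add_sum_compl G fun j => w j * ‖a j - m‖ ^ 2, hgeq, hgood] at htot
  set q := ∑ j ∈ G, w j • η j with hqdef
  set WG := ∑ j ∈ G, w j with hWGdef
  set WB := ∑ j ∈ Gᶜ, w j with hWBdef
  set bad := ∑ j ∈ Gᶜ, w j * ‖a j - m‖ ^ 2 with hbad
  simp only [smul_eq_mul, Real.norm_eq_abs, sq_abs] at hq hdisp htot hlow hsm
  have hinner : inner ℝ m q = m * q := by simp [mul_comm]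
  rw [hinner] at htot
  set κ := ε * L with hκ
  rw [← hc₃] at hq
  clear_value q WG WB bad κ e₅ c₃ c₀
  have hκ0 : 0 < κ := by rw [hκ]; positivity
  have hεκ : ε ≤ κ := by rw [hκ]; exact le_mul_of_one_le_right hε.le hL
  have hc₃0 : 0 ≤ c₃ := by rw [hc₃]; positivity
  have he₅0 : 0 ≤ e₅ := by rw [he₅]; positivity
  have hbad0 : 0 ≤ bad := by rw [hbad]; exact sum_nonneg fun j _ => mul_nonneg (hw.nonneg j) (sq_nonneg _)
  have hWG0 : c₀ * n ≤ WG := by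
    have h1 : 0 ≤ (ε₀ - ε) * n := mul_nonneg (by linarith) hN.le
    rw [hc₀]; linarith
  have hWGpos : 0 < WG := lt_of_lt_of_le (by positivity) hWG0
  -- Completing the square in `m` removes the unknown error from the cross term.
  have hcross : 2 * (m * q) - WG * m ^ 2 ≤ c₃ / c₀ * κ * n := by
    have h1 : 2 * (m * q) - WG * m ^ 2 ≤ q ^ 2 / WG := by
      rw [le_div_iff₀ hWGpos]; linarith only [sq_nonneg (WG * m - q)]
    refine h1.trans ?_
    rw [div_le_iff₀ hWGpos]
    calc q ^ 2 ≤ c₃ * (ε ^ 2 * L * n ^ 2) := hq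
      _ = ε * (c₃ / c₀ * κ * n * (c₀ * n)) := by rw [hκ]; field_simp
      _ ≤ 1 * (c₃ / c₀ * κ * n * WG) := by gcongr; linarith
      _ = _ := one_mul _
  -- The total is at most `n + O(κ n)`, while the good points keep `n - O(κ n)` by the lower bound
  -- on their second moment; the bad points receive only the difference.
  have hbadle : bad ≤ e₅ * κ * n := by
    have h1 : (1 + C' * κ) * ∑ j, w j ≤ (1 + C' * κ) * n := by gcongr
    have h2 : c * ε * n ≤ c * κ * n := by gcongr
    rw [he₅]
    linarith
  have hd : (WG * m - q) ^ 2 ≤ e₅ * (ε ^ 2 * L * n ^ 2) := by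
    calc (WG * m - q) ^ 2 ≤ WB * bad := hdisp
      _ ≤ ε * n * (e₅ * κ * n) := by
          gcongr
      _ = _ := by rw [hκ]; ring
  have hWm : (c₀ * n) ^ 2 * m ^ 2 ≤ 2 * (e₅ + c₃) * (ε ^ 2 * L * n ^ 2) := by
    calc (c₀ * n) ^ 2 * m ^ 2 ≤ WG ^ 2 * m ^ 2 := by gcongr
      _ ≤ 2 * (WG * m - q) ^ 2 + 2 * q ^ 2 := by linarith only [sq_nonneg (WG * m - 2 * q)]
      _ ≤ _ := by linarith
  have hm2 : m ^ 2 ≤ 2 * (e₅ + c₃) / c₀ ^ 2 * (ε ^ 2 * L) := by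
    rw [div_mul_eq_mul_div, le_div_iff₀ (by positivity)]
    have : n ^ 2 * (m ^ 2 * c₀ ^ 2) ≤ (n:ℝ) ^ 2 * (2 * (e₅ + c₃) * (ε ^ 2 * L)) := by linarith
    exact le_of_mul_le_mul_left this (by positivity)
  calc |m| = √(m ^ 2) := (Real.sqrt_sq_eq_abs m).symm
    _ ≤ √(2 * (e₅ + c₃) / c₀ ^ 2 * (ε ^ 2 * L)) := Real.sqrt_le_sqrt hm2
    _ = √(2 * (e₅ + c₃) / c₀ ^ 2) * (ε * √L) := by
        rw [Real.sqrt_mul (by positivity), Real.sqrt_mul (by positivity), Real.sqrt_sq hε.le]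
    _ ≤ _ := by
        have : 0 ≤ ε * √L := by positivity
        linarith

end Filter
end RobustMean
namespace RobustMean
open Finset Matrix

/-! ### Bounding the top eigenvalue through traces of powers. -/

section Spectral

variable {d : ℕ} {M : Matrix (Fin d) (Fin d) ℝ}

theorem trace_pow_eq_sum_eigenvalues (hM : M.IsHermitian) (k : ℕ) :
    (M ^ k).trace = ∑ i, hM.eigenvalues i ^ k := by
  conv_lhs => rw [hM.spectral_theorem, ← map_pow, Unitary.conjStarAlgAut_apply, trace_mul_cycle]
  simp [diagonal_pow, trace_diagonal]

theorem dotProduct_mulVec_le_of_eigenvalues_le (hM : M.IsHermitian) {s : ℝ}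
    (hs : ∀ i, hM.eigenvalues i ≤ s) (v : Fin d → ℝ) : v ⬝ᵥ (M *ᵥ v) ≤ s * (v ⬝ᵥ v) := by
  set U : Matrix (Fin d) (Fin d) ℝ := hM.eigenvectorUnitary.1 with hU
  have hUU : U * star U = 1 := Unitary.coe_mul_star_self hM.eigenvectorUnitary
  have hM' : M = U * diagonal hM.eigenvalues * star U := by
    conv_lhs => rw [hM.spectral_theorem, Unitary.conjStarAlgAut_apply]
    rfl
  set z := star U *ᵥ v with hz
  have hzU : ∀ x : Fin d → ℝ, v ⬝ᵥ (U *ᵥ x) = z ⬝ᵥ x := by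
    intro x
    rw [dotProduct_mulVec, hz]
    congr 1
    rw [star_eq_conjTranspose, conjTranspose_eq_transpose_of_trivial, mulVec_transpose]
  have h1 : v ⬝ᵥ (M *ᵥ v) = ∑ i, hM.eigenvalues i * (z i * z i) := by
    conv_lhs => rw [hM']
    rw [← mulVec_mulVec, ← mulVec_mulVec, hzU, ← hz]
    simp only [dotProduct, mulVec_diagonal]
    exact sum_congr rfl fun i _ => by ring
  have h2 : v ⬝ᵥ v = ∑ i, z i * z i := by
    have : v = U *ᵥ z := by rw [hz, mulVec_mulVec, hUU, one_mulVec]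
    conv_lhs => rw [this, dotProduct_comm, dotProduct_comm, ← this]
    nth_rewrite 2 [this]
    rw [hzU]; rfl
  rw [h1, h2, mul_sum]
  exact sum_le_sum fun i _ => mul_le_mul_of_nonneg_right (hs i) (mul_self_nonneg _)

/-- A small ratio of consecutive traces of powers bounds the quadratic form. -/
theorem dotProduct_mulVec_le_of_trace_pow_le (hM : M.PosSemidef) {q : ℕ} {θ ε : ℝ} (hθ : 0 ≤ θ)
    (hε : 0 < ε) (hd : d ≤ q * ε ^ 2) (h : (M ^ (q + 1)).trace ≤ θ * (M ^ q).trace)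
    (v : Fin d → ℝ) : v ⬝ᵥ (M *ᵥ v) ≤ θ * (1 + ε) * (v ⬝ᵥ v) := by
  refine dotProduct_mulVec_le_of_eigenvalues_le hM.1 (fun i₀ => ?_) v
  by_contra! hi
  rw [trace_pow_eq_sum_eigenvalues hM.1, trace_pow_eq_sum_eigenvalues hM.1, mul_sum,
    ← sub_nonpos, ← sum_sub_distrib] at h
  set l := hM.1.eigenvalues with hl
  have hl0 : ∀ i, 0 ≤ l i := hM.eigenvalues_nonneg
  have hterm : ∀ i, l i ^ (q + 1) - θ * l i ^ q = l i ^ q * (l i - θ) := fun i => by ring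
  simp only [hterm] at h
  have hpos : 0 < l i₀ := lt_of_le_of_lt (by positivity) hi
  -- Eigenvalues below `θ` compensate at most `d * θ ^ (q + 1)` in total. One above `θ * (1 + ε)`
  -- contributes more, since `(1 + ε) ^ q * ε ≥ q * ε ^ 2 ≥ d` by Bernoulli.
  have hlow : ∀ i, -(θ ^ q * θ) ≤ l i ^ q * (l i - θ) := by
    intro i
    rcases le_total θ (l i) with h1 | h1
    · have : 0 ≤ l i ^ q * (l i - θ) := mul_nonneg (pow_nonneg (hl0 i) q) (by linarith)
      have : 0 ≤ θ ^ q * θ := by positivity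
      linarith
    · have h2 : l i ^ q * (θ - l i) ≤ θ ^ q * θ :=
        mul_le_mul (pow_le_pow_left₀ (hl0 i) h1 q) (by linarith [hl0 i]) (by linarith)
          (by positivity)
      linarith
  have h1 : l i₀ ^ q * (l i₀ - θ) ≤ d * (θ ^ q * θ) := by
    have h2 : ∑ i ∈ univ.erase i₀, -(θ ^ q * θ) ≤
        ∑ i ∈ univ.erase i₀, l i ^ q * (l i - θ) := sum_le_sum fun i _ => hlow i
    rw [← add_sum_erase _ _ (mem_univ i₀)] at h
    rw [sum_const, nsmul_eq_mul, card_erase_of_mem (mem_univ i₀), card_univ, Fintype.card_fin] at h2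
    have h3 : ((d - 1 : ℕ) : ℝ) * (θ ^ q * θ) ≤ d * (θ ^ q * θ) :=
      mul_le_mul_of_nonneg_right (by exact_mod_cast Nat.sub_le d 1) (by positivity)
    linarith
  have h2 : (θ * (1 + ε)) ^ q * (θ * ε) < l i₀ ^ q * (l i₀ - θ) := by
    calc (θ * (1 + ε)) ^ q * (θ * ε) ≤ l i₀ ^ q * (θ * ε) := by
          gcongr
      _ < l i₀ ^ q * (l i₀ - θ) := by
          have : 0 < l i₀ ^ q := by positivity
          gcongr
          linarith
  have h3 : d * (θ ^ q * θ) ≤ (θ * (1 + ε)) ^ q * (θ * ε) := by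
    have h4 : 1 + q * ε ≤ (1 + ε) ^ q := one_add_mul_le_pow (by linarith) q
    have h5 : (d : ℝ) ≤ (1 + ε) ^ q * ε := by
      have := mul_le_mul_of_nonneg_right h4 hε.le
      nlinarith
    calc (d : ℝ) * (θ ^ q * θ) ≤ (1 + ε) ^ q * ε * (θ ^ q * θ) := by gcongr
      _ = _ := by rw [mul_pow]; ring
  linarith

end Spectral
end RobustMean
namespace RobustMean
open Finset Matrix

/-! ### Running maxima, as a loop computes them. -/

section RunMax

/-- The maximum of `0` and of `f 0, …, f (k - 1)`. -/
noncomputable def runMax (f : ℕ → ℝ) : ℕ → ℝ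
  | 0 => 0
  | k + 1 => if runMax f k < f k then f k else runMax f k

theorem le_runMax (f : ℕ → ℝ) {k N : ℕ} (h : k < N) : f k ≤ runMax f N := by
  induction N with
  | zero => omega
  | succ N ih =>
    rw [runMax]
    rcases Nat.lt_succ_iff_lt_or_eq.1 h with h1 | rfl <;> split_ifs with h2
    · exact (ih h1).trans h2.le
    · exact ih h1
    · exact le_rfl
    · exact not_lt.1 h2

theorem runMax_eq (f : ℕ → ℝ) (N : ℕ) : runMax f N = 0 ∨ ∃ k < N, runMax f N = f k := by
  induction N with
  | zero => exact Or.inl rfl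
  | succ N ih =>
    rw [runMax]
    split_ifs with h2
    · exact Or.inr ⟨N, N.lt_succ_self, rfl⟩
    · rcases ih with h | ⟨k, hk, h⟩
      · exact Or.inl h
      · exact Or.inr ⟨k, hk.trans N.lt_succ_self, h⟩

theorem runMax_congr {f g : ℕ → ℝ} {N : ℕ} (h : ∀ k < N, f k = g k) : runMax f N = runMax g N := by
  induction N with
  | zero => rfl
  | succ N ih =>
    rw [runMax, runMax, ih fun k hk => h k (hk.trans N.lt_succ_self), h N N.lt_succ_self]

end RunMax

/-! ### The filter estimator and its trace identities. -/

section Estimator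

variable {n d : ℕ} (CT Cθ : ℕ) (ε L : ℝ) (T : Fin n → EuclideanSpace ℝ (Fin d)) (w : Fin n → ℝ)

noncomputable def wMean : EuclideanSpace ℝ (Fin d) := (∑ j, w j)⁻¹ • ∑ j, w j • T j

/-- The weighted scatter matrix around the weighted mean. -/
noncomputable def scatter : Matrix (Fin d) (Fin d) ℝ :=
  Matrix.of fun k l => ∑ j, w j * ((T j - wMean T w) k * (T j - wMean T w) l)

/-- A high power stands in for the top eigenspace, which exact field operations cannot produce. -/
noncomputable def filterMatrix : Matrix (Fin d) (Fin d) ℝ := scatter T w ^ (n + 1)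

noncomputable def score (j : Fin n) : ℝ :=
  ∑ k, (∑ l, filterMatrix T w k l * (T j - wMean T w) l) ^ 2

noncomputable def frobSq : ℝ := ∑ k, ∑ l, filterMatrix T w k l ^ 2

/-- The level is multiplied by `frobSq` instead of normalizing the matrix, which would need a square
root. -/
noncomputable def excess (j : Fin n) : ℝ := max (score T w j - CT * L * frobSq T w) 0

/-- Only points of positive weight count, so that in a step with positive maximum the weights stay
nonnegative and a nonzero weight drops to `0`. -/
noncomputable def maxExcess : ℝ :=
  runMax (fun k => if h : k < n then if 0 < w ⟨k, h⟩ then excess CT L T w ⟨k, h⟩ else 0 else 0) n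

/-- The weighted variance in the tested directions exceeds the threshold. -/
def IsActive : Prop :=
  (1 + Cθ * (ε * L)) * (∑ j, w j) * frobSq T w < ∑ j, w j * score T w j

open Classical in
/-- One step of the filter. -/
noncomputable def filterStep (j : Fin n) : ℝ :=
  if IsActive Cθ ε L T w then w j * (1 - excess CT L T w j / maxExcess CT L T w) else w j

/-- The filter estimator. -/
noncomputable def filterMean : EuclideanSpace ℝ (Fin d) :=
  wMean T ((filterStep CT Cθ ε L T)^[n] fun _ => 1)

variable {CT Cθ ε L T w}

theorem excess_nonneg (j : Fin n) : 0 ≤ excess CT L T w j := le_max_right _ _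

theorem excess_le_maxExcess {j : Fin n} (h : 0 < w j) :
    excess CT L T w j ≤ maxExcess CT L T w := by
  have := le_runMax
    (fun k => if h : k < n then if 0 < w ⟨k, h⟩ then excess CT L T w ⟨k, h⟩ else 0 else 0) j.2
  simpa [h, maxExcess] using this

theorem exists_excess_eq_maxExcess (h : 0 < maxExcess CT L T w) :
    ∃ j, 0 < w j ∧ excess CT L T w j = maxExcess CT L T w := by
  rcases runMax_eq
    (fun k => if h : k < n then if 0 < w ⟨k, h⟩ then excess CT L T w ⟨k, h⟩ else 0 else 0) n
    with h1 | ⟨k, hk, h1⟩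
  · exact absurd h1 h.ne'
  · change maxExcess CT L T w = _ at h1
    simp only [hk, dif_pos] at h1
    split_ifs at h1 with h2
    · exact ⟨_, h2, h1.symm⟩
    · exact absurd h1 h.ne'

theorem transpose_scatter : (scatter T w)ᵀ = scatter T w := by
  ext k l
  simp only [scatter, transpose_apply, of_apply]
  exact sum_congr rfl fun j _ => by ring

theorem dotProduct_scatter_mulVec (v : Fin d → ℝ) :
    v ⬝ᵥ (scatter T w *ᵥ v) = ∑ j, w j * (v ⬝ᵥ (T j - wMean T w).ofLp) ^ 2 := by
  simp only [dotProduct, mulVec, scatter, of_apply, mul_sum, sum_mul, sq]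
  rw [sum_comm]
  conv_lhs => enter [2, l]; rw [sum_comm]
  rw [sum_comm]
  refine sum_congr rfl fun j _ => sum_congr rfl fun l _ => sum_congr rfl fun k _ => by ring

theorem posSemidef_scatter (hw : ∀ j, 0 ≤ w j) : (scatter T w).PosSemidef := by
  refine PosSemidef.of_dotProduct_mulVec_nonneg ?_ fun v => ?_
  · rw [IsHermitian, conjTranspose_eq_transpose_of_trivial, transpose_scatter]
  · rw [star_trivial, dotProduct_scatter_mulVec]
    exact sum_nonneg fun j _ => mul_nonneg (hw j) (sq_nonneg _)

theorem transpose_filterMatrix : (filterMatrix T w)ᵀ = filterMatrix T w := by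
  rw [filterMatrix, transpose_pow, transpose_scatter]

theorem frobSq_eq_trace : frobSq T w = (scatter T w ^ (2 * (n + 1))).trace := by
  have h : scatter T w ^ (2 * (n + 1)) = filterMatrix T w * (filterMatrix T w)ᵀ := by
    rw [transpose_filterMatrix, filterMatrix, two_mul, pow_add]
  rw [h]
  simp only [frobSq, trace, diag_apply, mul_apply, transpose_apply, sq]

/-- Together with `frobSq_eq_trace`, this turns inactivity into a bound on the ratio of two
consecutive traces. -/
theorem sum_mul_score_eq_trace :
    ∑ j, w j * score T w j = (scatter T w ^ (2 * (n + 1) + 1)).trace := by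
  have h : scatter T w ^ (2 * (n + 1) + 1) =
      filterMatrix T w * scatter T w * (filterMatrix T w)ᵀ := by
    rw [transpose_filterMatrix, filterMatrix, ← pow_succ, ← pow_add]
    congr 1; ring
  rw [h]
  have h2 : ∀ k, (filterMatrix T w * scatter T w * (filterMatrix T w)ᵀ) k k =
      ∑ j, w j * (∑ l, filterMatrix T w k l * (T j - wMean T w) l) ^ 2 := by
    intro k
    have := dotProduct_scatter_mulVec (T := T) (w := w) (filterMatrix T w k)
    rw [mul_assoc]
    simpa [mul_apply, dotProduct, mulVec] using this
  simp only [trace, diag_apply, h2, score, mul_sum]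
  rw [sum_comm]

theorem sum_weight_smul_wMean (hW : ∑ j, w j ≠ 0) :
    (∑ j, w j) • wMean T w = ∑ j, w j • T j := by
  rw [wMean, smul_smul, mul_inv_cancel₀ hW, one_smul]

end Estimator

/-! ### Accuracy of the filter on corruptions of stable samples. -/

section Guarantee

variable {n d : ℕ} {CT Cθ : ℕ} {ε L c : ℝ} {S T : Fin n → EuclideanSpace ℝ (Fin d)}
  {w : Fin n → ℝ} {μ : EuclideanSpace ℝ (Fin d)} {G : Finset (Fin n)}

theorem IsBalanced.sum_pos (hw : IsBalanced ε G w) (hε : ε < 1 / 2) (hn : 0 < n) :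
    0 < ∑ j, w j := by
  have h1 := hw.add_le_sum
  have h2 : 0 ≤ ∑ j ∈ Gᶜ, w j := sum_nonneg fun j _ => hw.nonneg j
  have h3 : (0 : ℝ) < (1 - 2 * ε) * n :=
    mul_pos (by linarith) (by exact_mod_cast hn)
  rw [← sum_add_sum_compl G]
  linarith

/-- An active filter step removes more mass outside `G` than inside. -/
theorem sum_mul_excess_lt {ε₀ : ℝ}
    (hfilter : ∀ {n : ℕ} {ε L : ℝ} {F : Type} [NormedAddCommGroup F] [InnerProductSpace ℝ F]
      {G : Finset (Fin n)} {w : Fin n → ℝ} {a η : Fin n → F} {m : F}, 0 < ε → ε ≤ ε₀ → 1 ≤ L →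
      0 < n → IsBalanced ε G w → IsRegular c ε L η → (∑ j, w j) • m = ∑ j, w j • a j →
      (∀ j ∈ G, a j = η j) →
      (1 + Cθ * (ε * L)) * ∑ j, w j < ∑ j, w j * ‖a j - m‖ ^ 2 →
      ∑ j ∈ G, w j * max (‖a j - m‖ ^ 2 - CT * L) 0 <
        ∑ j ∈ Gᶜ, w j * max (‖a j - m‖ ^ 2 - CT * L) 0)
    (hε₀' : ε₀ < 1 / 2) (hε : 0 < ε) (hεε₀ : ε ≤ ε₀) (hL : 1 ≤ L) (hn : 0 < n)
    (hw : IsBalanced ε G w) (hS : IsStable c ε L fun j => S j - μ) (hG : ∀ j ∈ G, T j = S j)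
    (hact : IsActive Cθ ε L T w) :
    ∑ j ∈ G, w j * excess CT L T w j < ∑ j ∈ Gᶜ, w j * excess CT L T w j := by
  have hWpos := hw.sum_pos (by linarith) hn
  have hf0 : 0 ≤ frobSq T w := sum_nonneg fun k _ => sum_nonneg fun l _ => sq_nonneg _
  -- If the matrix vanished, all scores would vanish and activity would read `0 < 0`.
  have hfpos : 0 < frobSq T w := by
    refine lt_of_le_of_ne hf0 fun h0 => ?_
    have hz : ∀ k l, filterMatrix T w k l = 0 := by
      intro k l
      have h1 := (sum_eq_zero_iff_of_nonneg fun k _ => sum_nonneg fun l _ => sq_nonneg _).1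
        h0.symm k (mem_univ k)
      have h2 := (sum_eq_zero_iff_of_nonneg fun l _ => sq_nonneg _).1 h1 l (mem_univ l)
      exact pow_eq_zero_iff (two_ne_zero) |>.1 h2
    have hs : ∀ j, score T w j = 0 := by
      intro j; simp [score, hz]
    simp [IsActive, ← h0, hs] at hact
  set f := √(frobSq T w) with hfdef
  have hf : 0 < f := Real.sqrt_pos.2 hfpos
  have hf2 : f ^ 2 = frobSq T w := Real.sq_sqrt hf0
  -- The rows of the filter matrix divided by its Frobenius norm are the directions to which
  -- `IsStable.isRegular` applies.
  let b : Fin d → EuclideanSpace ℝ (Fin d) := fun k => f⁻¹ • WithLp.toLp 2 (filterMatrix T w k)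
  have hb : ∑ k, ‖b k‖ ^ 2 = 1 := by
    have : ∀ k, ‖b k‖ ^ 2 = (f ^ 2)⁻¹ * ∑ l, filterMatrix T w k l ^ 2 := by
      intro k
      rw [norm_smul, mul_pow, EuclideanSpace.norm_sq_eq, Real.norm_eq_abs, sq_abs, inv_pow]
      simp
    simp only [this, ← mul_sum]
    rw [hf2]
    exact inv_mul_cancel₀ hfpos.ne'
  let Λ : EuclideanSpace ℝ (Fin d) →ₗ[ℝ] EuclideanSpace ℝ (Fin d) :=
    { toFun := fun x => WithLp.toLp 2 fun k => (inner ℝ (b k) x : ℝ)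
      map_add' := fun x z => by ext k; simp [inner_add_right]
      map_smul' := fun r x => by ext k; simp [real_inner_smul_right] }
  have hscore : ∀ j, ‖Λ (T j - μ) - Λ (wMean T w - μ)‖ ^ 2 = (f ^ 2)⁻¹ * score T w j := by
    intro j
    rw [← map_sub, sub_sub_sub_cancel_right, EuclideanSpace.norm_sq_eq, score, mul_sum]
    refine sum_congr rfl fun k _ => ?_
    change ‖(inner ℝ (b k) (T j - wMean T w) : ℝ)‖ ^ 2 = _
    rw [Real.norm_eq_abs, sq_abs, real_inner_smul_left, mul_pow, inv_pow, PiLp.inner_apply]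
    congr 2
    refine sum_congr rfl fun l _ => ?_
    simp [mul_comm]
  have key := hfilter (a := fun j => Λ (T j - μ)) (η := fun j => Λ (S j - μ))
    (m := Λ (wMean T w - μ)) hε hεε₀ hL hn hw (hS.isRegular b hb) (by
      rw [← map_smul, smul_sub, sum_weight_smul_wMean hWpos.ne']
      simp only [← map_smul, ← map_sum, smul_sub, sum_sub_distrib, sum_smul])
    (fun j hj => by rw [hG j hj]) (by
      simp only [hscore]
      rw [IsActive, ← hf2] at hact
      have : ∑ j, w j * ((f ^ 2)⁻¹ * score T w j) = (f ^ 2)⁻¹ * ∑ j, w j * score T w j := by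
        rw [mul_sum]; exact sum_congr rfl fun j _ => by ring
      rw [this, ← div_eq_inv_mul, lt_div_iff₀ (by positivity)]
      exact hact)
  have hexc : ∀ j, w j * max (‖Λ (T j - μ) - Λ (wMean T w - μ)‖ ^ 2 - CT * L) 0 =
      (f ^ 2)⁻¹ * (w j * excess CT L T w j) := by
    intro j
    rw [hscore, excess, ← hf2, mul_left_comm]
    congr 1
    rw [mul_max_of_nonneg _ _ (by positivity), mul_zero, mul_sub]
    congr 2
    field_simp
  simp only [hexc, ← mul_sum] at key
  exact lt_of_mul_lt_mul_left key (by positivity)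

theorem filterStep_of_not_isActive (h : ¬ IsActive Cθ ε L T w) :
    filterStep CT Cθ ε L T w = w := by
  funext j; simp [filterStep, h]

/-- An active step keeps the weights balanced and annihilates a weight. -/
theorem IsBalanced.filterStep (hw : IsBalanced ε G w)
    (hact : IsActive Cθ ε L T w)
    (hlt : ∑ j ∈ G, w j * excess CT L T w j < ∑ j ∈ Gᶜ, w j * excess CT L T w j) :
    IsBalanced ε G (filterStep CT Cθ ε L T w) ∧
      #{j | filterStep CT Cθ ε L T w j ≠ 0} < #{j | w j ≠ 0} := by
  have hexpos : ∃ j, 0 < w j * excess CT L T w j := by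
    by_contra! h
    have h1 : ∑ j ∈ Gᶜ, w j * excess CT L T w j ≤ 0 := sum_nonpos fun j _ => h j
    have h2 : 0 ≤ ∑ j ∈ G, w j * excess CT L T w j :=
      sum_nonneg fun j _ => mul_nonneg (hw.nonneg j) (excess_nonneg j)
    linarith
  obtain ⟨j₀, hj₀⟩ := hexpos
  have hw₀ : 0 < w j₀ := lt_of_le_of_ne (hw.nonneg j₀) fun h => by simp [← h] at hj₀
  have hM : 0 < maxExcess CT L T w :=
    (pos_of_mul_pos_right hj₀ hw₀.le).trans_le (excess_le_maxExcess hw₀)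
  set M := maxExcess CT L T w with hMdef
  have hstep : ∀ j, RobustMean.filterStep CT Cθ ε L T w j =
      w j - M⁻¹ * (w j * excess CT L T w j) := by
    intro j
    rw [RobustMean.filterStep, if_pos hact, ← hMdef]
    ring
  have hle : ∀ j, M⁻¹ * (w j * excess CT L T w j) ≤ w j := by
    intro j
    rcases (hw.nonneg j).eq_or_lt with h | h
    · simp [← h]
    · rw [inv_mul_le_iff₀ hM, mul_comm M]
      exact mul_le_mul_of_nonneg_left (excess_le_maxExcess h) h.le
  have hnn : ∀ j, 0 ≤ M⁻¹ * (w j * excess CT L T w j) := fun j =>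
    mul_nonneg (inv_nonneg.2 hM.le) (mul_nonneg (hw.nonneg j) (excess_nonneg j))
  refine ⟨⟨fun j => ?_, fun j => ?_, hw.card_le, ?_⟩, ?_⟩
  · rw [hstep]; linarith [hle j]
  · rw [hstep]; linarith [hnn j, hw.le_one j]
  · have h1 : ∀ s : Finset (Fin n), ∑ j ∈ s, (1 - RobustMean.filterStep CT Cθ ε L T w j) =
        ∑ j ∈ s, (1 - w j) + M⁻¹ * ∑ j ∈ s, w j * excess CT L T w j := by
      intro s
      rw [mul_sum, ← sum_add_distrib]
      exact sum_congr rfl fun j _ => by rw [hstep]; ring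
    rw [h1, h1]
    exact add_le_add hw.removed_le (mul_le_mul_of_nonneg_left hlt.le (inv_nonneg.2 hM.le))
  · obtain ⟨j₁, hj₁, he⟩ := exists_excess_eq_maxExcess hM
    refine card_lt_card ?_
    rw [ssubset_iff_of_subset]
    · refine ⟨j₁, by simpa using hj₁.ne', ?_⟩
      simp only [mem_filter, mem_univ, true_and, not_not]
      rw [hstep, he, ← hMdef]
      field_simp
      ring
    · intro j
      simp only [mem_filter, mem_univ, true_and]
      refine mt fun h => ?_
      rw [hstep, h]; ring

theorem isBalanced_one (hcard : (#Gᶜ : ℝ) ≤ ε * n) : IsBalanced ε G fun _ => 1 :=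
  ⟨fun _ => zero_le_one, fun _ => le_rfl, hcard, by simp⟩

/-- When the filter is inactive, the weighted mean is accurate. -/
theorem norm_wMean_sub_le {ε₀ C : ℝ}
    (hdisp : ∀ {n : ℕ} {ε L : ℝ} {G : Finset (Fin n)} {w : Fin n → ℝ} {a η : Fin n → ℝ}
      {m : ℝ}, 0 < ε → ε ≤ ε₀ → 1 ≤ L → 0 < n → IsBalanced ε G w → IsRegular c ε L η →
      n - c * ε * n ≤ ∑ j, ‖η j‖ ^ 2 →
      (∑ j, w j) • m = ∑ j, w j • a j → (∀ j ∈ G, a j = η j) →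
      ∑ j, w j * ‖a j - m‖ ^ 2 ≤ (1 + (2 * Cθ + 1) * (ε * L)) * ∑ j, w j →
      |m| ≤ C * (ε * √L))
    (hε₀' : ε₀ < 1 / 2) (hC : 0 < C) (hε : 0 < ε) (hεε₀ : ε ≤ ε₀) (hL : 1 ≤ L) (hn : 0 < n)
    (hnd : d ≤ n * ε ^ 2)
    (hw : IsBalanced ε G w) (hS : IsStable c ε L fun j => S j - μ) (hG : ∀ j ∈ G, T j = S j)
    (hact : ¬ IsActive Cθ ε L T w) : ‖wMean T w - μ‖ ≤ C * (ε * √L) := by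
  have hWpos := hw.sum_pos (by linarith) hn
  set δ := wMean T w - μ with hδ
  rcases eq_or_ne δ 0 with h0 | h0
  · rw [h0, norm_zero]; positivity
  have hpos : 0 < ‖δ‖ := norm_pos_iff.2 h0
  set v := ‖δ‖⁻¹ • δ with hv
  have hv1 : ‖v‖ = 1 := by rw [hv, norm_smul, norm_inv, norm_norm, inv_mul_cancel₀ hpos.ne']
  have hvδ : inner ℝ v δ = ‖δ‖ := by
    rw [hv, real_inner_smul_left, real_inner_self_eq_norm_sq]; field_simp
  have hquad := abs_le.1 (hS.abs_quadratic_le v hv1)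
  simp only [sum_sub_distrib, sum_const, card_univ, Fintype.card_fin, nsmul_eq_mul,
    mul_one] at hquad
  have hreg : IsRegular c ε L fun j => (inner ℝ v (S j - μ) : ℝ) := by
    refine ⟨?_, ?_, ?_⟩
    · rw [← inner_sum]
      refine (norm_inner_le_norm _ _).trans ?_
      rw [hv1, one_mul]
      exact hS.norm_sum_le
    · simp only [Real.norm_eq_abs, sq_abs]; linarith [hquad.2]
    · simp only [Real.norm_eq_abs, sq_abs]; exact hS.excess_le v hv1
  -- The spectral bound is used only in the direction `v` of the error. The condition on `q` follows
  -- from `d ≤ n * ε ^ 2`.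
  have hspec := dotProduct_mulVec_le_of_trace_pow_le (posSemidef_scatter (T := T) hw.nonneg)
    (q := 2 * (n + 1)) (θ := (1 + Cθ * (ε * L)) * ∑ j, w j) (ε := ε) (by positivity) hε (by
      refine hnd.trans (mul_le_mul_of_nonneg_right ?_ (sq_nonneg _))
      push_cast
      have : (0 : ℝ) ≤ n := Nat.cast_nonneg n
      linarith) (by
      rw [← sum_mul_score_eq_trace, ← frobSq_eq_trace]
      exact not_lt.1 hact) v.ofLp
  have hvv : v.ofLp ⬝ᵥ v.ofLp = 1 := by
    have := EuclideanSpace.norm_sq_eq v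
    rw [hv1] at this
    simpa [dotProduct, sq] using this.symm
  rw [hvv, mul_one, dotProduct_scatter_mulVec] at hspec
  have hdot : ∀ z : EuclideanSpace ℝ (Fin d), v.ofLp ⬝ᵥ z.ofLp = inner ℝ v z := by
    intro z
    rw [PiLp.inner_apply, dotProduct]
    exact sum_congr rfl fun k _ => by simp [mul_comm]
  simp only [hdot] at hspec
  have h := hdisp (a := fun j => (inner ℝ v (T j - μ) : ℝ)) (m := inner ℝ v δ) hε hεε₀ hL hn hw
    hreg (by simp only [Real.norm_eq_abs, sq_abs]; linarith [hquad.1]) (by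
      simp only [smul_eq_mul, ← real_inner_smul_right, ← inner_sum]
      rw [hδ, smul_sub, sum_weight_smul_wMean hWpos.ne']
      simp only [smul_sub, sum_sub_distrib, sum_smul])
    (fun j hj => by rw [hG j hj]) (by
      simp only [← inner_sub_right, hδ, sub_sub_sub_cancel_right, Real.norm_eq_abs, sq_abs]
      refine hspec.trans ?_
      have h1 : ε ≤ ε * L := le_mul_of_one_le_right hε.le hL
      have h2 : Cθ * (ε * L) * ε ≤ Cθ * (ε * L) * 1 := by gcongr; linarith
      -- The spectral loss `1 + ε` is absorbed by passing from `Cθ` to `2 * Cθ + 1`.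
      have h3 : (1 + Cθ * (ε * L)) * (1 + ε) ≤ 1 + (2 * Cθ + 1) * (ε * L) := by linarith
      calc _ = (1 + Cθ * (ε * L)) * (1 + ε) * ∑ j, w j := by ring
        _ ≤ _ := by gcongr)
  rwa [hvδ, abs_of_pos hpos] at h

/-- On corruptions of stable samples the filter estimator is accurate. -/
theorem exists_norm_filterMean_sub_le {ε₀ c : ℝ} (hε₀ : 0 < ε₀) (hε₀' : ε₀ < 1 / 2)
    (hc : 0 ≤ c) :
    ∃ (CT Cθ : ℕ) (C : ℝ), 0 < C ∧ ∀ {n d : ℕ} {ε L : ℝ}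
      {S T : Fin n → EuclideanSpace ℝ (Fin d)} {μ : EuclideanSpace ℝ (Fin d)}
      {G : Finset (Fin n)}, 0 < ε → ε ≤ ε₀ → 1 ≤ L → 0 < n → d ≤ n * ε ^ 2 →
      (#Gᶜ : ℝ) ≤ ε * n → (IsStable c ε L fun j => S j - μ) → (∀ j ∈ G, T j = S j) →
      ‖filterMean CT Cθ ε L T - μ‖ ≤ C * (ε * √L) := by
  obtain ⟨CT, Cθ, hfilter⟩ := exists_filter_constants hε₀ hε₀' hc
  obtain ⟨C, hC, hdisp⟩ := exists_displacement_constant hε₀' hc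
    (by positivity : (0 : ℝ) ≤ 2 * Cθ + 1)
  refine ⟨CT, Cθ, C, hC, ?_⟩
  intro n d ε L S T μ G hε hεε₀ hL hn hnd hcard hS hG
  -- Inactivity is permanent because an inactive step changes nothing. As long as steps are active,
  -- each one lowers the number of nonzero weights, and after `n` of them the total mass would be
  -- `0`.
  have hiter : ∀ k, IsBalanced ε G ((filterStep CT Cθ ε L T)^[k] fun _ => 1) ∧
      (¬ IsActive Cθ ε L T ((filterStep CT Cθ ε L T)^[k] fun _ => 1) ∨
        #{j | ((filterStep CT Cθ ε L T)^[k] fun _ => 1) j ≠ 0} + k ≤ n) := by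
    intro k
    induction k with
    | zero =>
      refine ⟨isBalanced_one hcard, Or.inr ?_⟩
      rw [add_zero]
      exact (card_le_univ _).trans_eq (Fintype.card_fin n)
    | succ k ih =>
      rw [Function.iterate_succ_apply']
      set u := (filterStep CT Cθ ε L T)^[k] fun _ => 1
      by_cases hact : IsActive Cθ ε L T u
      · have hlt := sum_mul_excess_lt hfilter hε₀' hε hεε₀ hL hn ih.1 hS hG hact
        obtain ⟨h1, h2⟩ := ih.1.filterStep hact hlt
        refine ⟨h1, Or.inr ?_⟩
        have := ih.2.resolve_left (not_not.2 hact)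
        omega
      · rw [filterStep_of_not_isActive hact]
        exact ⟨ih.1, Or.inl hact⟩
  obtain ⟨hbal, hlast⟩ := hiter n
  refine norm_wMean_sub_le hdisp hε₀' hC hε hεε₀ hL hn hnd hbal hS hG ?_
  refine hlast.resolve_right fun h => ?_
  have h0 : #{j | ((filterStep CT Cθ ε L T)^[n] fun _ => 1) j ≠ 0} = 0 := by omega
  have hpos := hbal.sum_pos (by linarith) hn
  rw [card_eq_zero, filter_eq_empty_iff] at h0
  rw [sum_eq_zero fun j hj => not_not.1 (h0 hj)] at hpos
  exact lt_irrefl _ hpos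

end Guarantee
end RobustMean
namespace RobustMean

/-! ### Counting loops on the machine. -/

section Loops

/-- Loop bounds of high-level programs. -/
inductive Bound : Type
  | one
  | points
  | dim

def Bound.toIExp : Bound → IExp
  | .one => .lit 1
  | .points => .var 0
  | .dim => .var 1

def Bound.val (n d : ℕ) : Bound → ℕ
  | .one => 1
  | .points => n
  | .dim => d

theorem Bound.eval_toIExp (b : Bound) (s : State) :
    b.toIExp.eval s = b.val (s.idx 0) (s.idx 1) := by
  cases b <;> rfl

theorem Bound.cost_toIExp (b : Bound) : b.toIExp.cost = 1 := by
  cases b <;> rfl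

theorem Bound.val_le {n d : ℕ} (hn : 1 ≤ n) (hd : 1 ≤ d) (b : Bound) : b.val n d ≤ n * d := by
  cases b
  · exact Nat.mul_pos hn hd
  · exact Nat.le_mul_of_pos_right n hd
  · exact Nat.le_mul_of_pos_left d hn

theorem State.setI_idx_self (s : State) (i v : ℕ) : (s.setI i v).idx i = v :=
  Function.update_self _ _ _

theorem State.setI_idx_of_ne (s : State) {i k : ℕ} (v : ℕ) (h : k ≠ i) :
    (s.setI i v).idx k = s.idx k :=
  Function.update_of_ne h _ _

/-- Counting loop with counter register `i`. -/
def forLoop (i : ℕ) (b : Bound) (p : Prog) : Prog :=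
  .seq (.setI i (.lit 0))
    (.while (.ilt (.var i) b.toIExp) (.seq p (.setI i (.add (.var i) (.lit 1)))))

/-- Invariant rule. An iteration pays `3` for the test and `4` for the increment; initialization and
the last test cost `5`. -/
theorem exec_forLoop {i : ℕ} {b : Bound} {p : Prog} {N tb : ℕ} {s : State}
    (Inv : ℕ → State → Prop) (hN : ∀ k s', Inv k s' → b.toIExp.eval s' = N)
    (hidx : ∀ k s', Inv k s' → s'.idx i = k) (h0 : Inv 0 (s.setI i 0))
    (hstep : ∀ k < N, ∀ s', Inv k s' →
      ∃ t s'', Exec p s' t s'' ∧ t ≤ tb ∧ s''.idx i = k ∧ Inv (k + 1) (s''.setI i (k + 1))) :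
    ∃ t s', Exec (forLoop i b p) s t s' ∧ t ≤ N * (tb + 7) + 5 ∧ Inv N s' := by
  have hwhile : ∀ m k, k + m = N → ∀ s', Inv k s' →
      ∃ t s'', Exec (.while (.ilt (.var i) b.toIExp)
        (.seq p (.setI i (.add (.var i) (.lit 1))))) s' t s'' ∧ t ≤ m * (tb + 7) + 3 ∧
        Inv N s'' := by
    have hcost : (Test.ilt (.var i) b.toIExp).cost = 3 := by
      simp [Test.cost, IExp.cost, b.cost_toIExp]
    intro m
    induction m with
    | zero =>
      intro k hk s' hs'
      have hnot : ¬ (Test.ilt (.var i) b.toIExp).Holds s' := by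
        simp only [Test.Holds, IExp.eval]
        rw [hN k s' hs', hidx k s' hs']
        omega
      refine ⟨_, s', Exec.whileDone _ hnot, by rw [hcost]; omega, ?_⟩
      rw [add_zero] at hk
      rwa [hk] at hs'
    | succ m ih =>
      intro k hk s' hs'
      have hholds : (Test.ilt (.var i) b.toIExp).Holds s' := by
        simp only [Test.Holds, IExp.eval]
        rw [hN k s' hs', hidx k s' hs']
        omega
      obtain ⟨t₁, s₁, he₁, ht₁, hi₁, hinv₁⟩ := hstep k (by omega) s' hs'
      obtain ⟨t₂, s₂, he₂, ht₂, hinv₂⟩ := ih (k + 1) (by omega) _ hinv₁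
      have hset := Exec.setI i (.add (.var i) (.lit 1)) s₁
      simp only [IExp.eval, IExp.cost, hi₁] at hset
      refine ⟨_, s₂, Exec.whileStep hholds (Exec.seq he₁ hset) he₂, ?_, hinv₂⟩
      rw [hcost, Nat.succ_mul]
      omega
  obtain ⟨t, s', he, ht, hinv⟩ := hwhile N 0 (by omega) _ h0
  have hset := Exec.setI i (.lit 0) s
  simp only [IExp.eval, IExp.cost] at hset
  exact ⟨_, s', Exec.seq hset he, by omega, hinv⟩

end Loops

/-! ### A language of expressions and its compiler. -/

section Expressions

/-- Indices in high-level expressions: `0` or a loop counter. -/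
inductive Ix : Type
  | zero
  | ctr (k : ℕ)

def Ix.val (env : ℕ → ℕ) : Ix → ℕ
  | .zero => 0
  | .ctr k => env k

/-- The shift by `4` keeps registers `0` and `1` for `n` and `d`, and `2` and `3` for the counters
of repetitions. -/
def Ix.toIExp : Ix → IExp
  | .zero => .lit 0
  | .ctr k => .var (k + 4)

def Ix.Scoped (c : ℕ) : Ix → Prop
  | .zero => True
  | .ctr k => k < c

/-- High-level real expressions, with sums and maxima over loop counters. -/
inductive HExp : Type
  | lit (q : ℚ)
  | eps
  | get (a : ℕ) (e f : Ix)
  | add (x y : HExp)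
  | sub (x y : HExp)
  | mul (x y : HExp)
  | div (x y : HExp)
  | cond (x y u v : HExp)
  | sum (b : Bound) (x : HExp)
  | max (b : Bound) (x : HExp)

/-- The value of an expression in which `c` counters, with the values `env`, are in scope. -/
noncomputable def HExp.eval (n d : ℕ) (ε : ℝ) (m : ℕ → ℕ → ℕ → ℝ) :
    HExp → ℕ → (ℕ → ℕ) → ℝ
  | .lit q, _, _ => (q : ℝ)
  | .eps, _, _ => ε
  | .get a e f, _, env => m a (e.val env) (f.val env)
  | .add x y, c, env => x.eval n d ε m c env + y.eval n d ε m c env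
  | .sub x y, c, env => x.eval n d ε m c env - y.eval n d ε m c env
  | .mul x y, c, env => x.eval n d ε m c env * y.eval n d ε m c env
  | .div x y, c, env => x.eval n d ε m c env / y.eval n d ε m c env
  | .cond x y u v, c, env =>
      if x.eval n d ε m c env < y.eval n d ε m c env then u.eval n d ε m c env
      else v.eval n d ε m c env
  | .sum b x, c, env =>
      ∑ i ∈ Finset.range (b.val n d), x.eval n d ε m (c + 1) (Function.update env c i)
  | .max b x, c, env =>
      runMax (fun i => x.eval n d ε m (c + 1) (Function.update env c i)) (b.val n d)

def HExp.Scoped : HExp → ℕ → Prop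
  | .lit _, _ => True
  | .eps, _ => True
  | .get _ e f, c => e.Scoped c ∧ f.Scoped c
  | .add x y, c => x.Scoped c ∧ y.Scoped c
  | .sub x y, c => x.Scoped c ∧ y.Scoped c
  | .mul x y, c => x.Scoped c ∧ y.Scoped c
  | .div x y, c => x.Scoped c ∧ y.Scoped c
  | .cond x y u v, c => x.Scoped c ∧ y.Scoped c ∧ u.Scoped c ∧ v.Scoped c
  | .sum _ x, c => x.Scoped (c + 1)
  | .max _ x, c => x.Scoped (c + 1)

/-- Name of an array in the machine; the array `2` of the machine is a buffer. -/
def arr (a : ℕ) : ℕ := if a < 2 then a else a + 1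

theorem arr_ne_two (a : ℕ) : arr a ≠ 2 := by
  unfold arr; split_ifs <;> omega

theorem arr_inj {a b : ℕ} : arr a = arr b ↔ a = b := by
  unfold arr; split_ifs <;> omega

/-- Evaluation of an expression into the real register `r`. -/
def HExp.compile : HExp → ℕ → ℕ → Prog
  | .lit q, _, r => .setR r (.lit q)
  | .eps, _, r => .setR r (.var 0)
  | .get a e f, _, r => .setR r (.get (arr a) e.toIExp f.toIExp)
  | .add x y, c, r =>
      .seq (x.compile c r) (.seq (y.compile c (r + 1)) (.setR r (.add (.var r) (.var (r + 1)))))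
  | .sub x y, c, r =>
      .seq (x.compile c r) (.seq (y.compile c (r + 1)) (.setR r (.sub (.var r) (.var (r + 1)))))
  | .mul x y, c, r =>
      .seq (x.compile c r) (.seq (y.compile c (r + 1)) (.setR r (.mul (.var r) (.var (r + 1)))))
  | .div x y, c, r =>
      .seq (x.compile c r) (.seq (y.compile c (r + 1)) (.setR r (.div (.var r) (.var (r + 1)))))
  | .cond x y u v, c, r =>
      .seq (x.compile c r) (.seq (y.compile c (r + 1))
        (.ite (.rlt (.var r) (.var (r + 1))) (u.compile c r) (v.compile c r)))
  | .sum b x, c, r =>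
      .seq (.setR r (.lit 0)) (forLoop (c + 4) b
        (.seq (x.compile (c + 1) (r + 1)) (.setR r (.add (.var r) (.var (r + 1))))))
  | .max b x, c, r =>
      .seq (.setR r (.lit 0)) (forLoop (c + 4) b
        (.seq (x.compile (c + 1) (r + 1)) (.ite (.rlt (.var r) (.var (r + 1)))
          -- The second branch is an idle assignment, as the machine has no empty program.
          (.setR r (.var (r + 1))) (.setR r (.var r)))))

/-- Bound for the running time of an expression when all loop bounds are at most `N`. -/
def HExp.time (N : ℕ) : HExp → ℕ
  | .lit _ => 2
  | .eps => 2
  | .get _ _ _ => 4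
  | .add x y => x.time N + y.time N + 4
  | .sub x y => x.time N + y.time N + 4
  | .mul x y => x.time N + y.time N + 4
  | .div x y => x.time N + y.time N + 4
  | .cond x y u v => x.time N + y.time N + (u.time N + v.time N) + 3
  | .sum _ x => N * (x.time N + 11) + 7
  | .max _ x => N * (x.time N + 12) + 7

/-- The machine state `s` represents the data of a high-level program. -/
structure Represents (n d : ℕ) (ε : ℝ) (m : ℕ → ℕ → ℕ → ℝ) (s : State) : Prop where
  idx_zero : s.idx 0 = n
  idx_one : s.idx 1 = d
  reg_zero : s.reg 0 = ε
  mem_eq : ∀ a, s.mem (arr a) = m a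

/-- `s'` differs from `s` only in index registers from `i` on and real registers from `r` on. -/
structure SameBelow (i r : ℕ) (s s' : State) : Prop where
  idx_eq : ∀ k < i, s'.idx k = s.idx k
  reg_eq : ∀ k < r, s'.reg k = s.reg k
  mem_eq : s'.mem = s.mem

theorem SameBelow.trans {i r i' r' : ℕ} {s s' s'' : State} (h : SameBelow i r s s')
    (h' : SameBelow i' r' s' s'') (hi : i ≤ i') (hr : r ≤ r') : SameBelow i r s s'' :=
  ⟨fun k hk => (h'.idx_eq k (by omega)).trans (h.idx_eq k hk),
    fun k hk => (h'.reg_eq k (by omega)).trans (h.reg_eq k hk), h'.mem_eq.trans h.mem_eq⟩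

theorem sameBelow_setR (i r : ℕ) (s : State) (v : ℝ) : SameBelow i r s (s.setR r v) :=
  ⟨fun _ _ => rfl, fun k hk => Function.update_of_ne (by omega) _ _, rfl⟩

theorem sameBelow_setI (i r : ℕ) (s : State) (v : ℕ) : SameBelow i r s (s.setI i v) :=
  ⟨fun k hk => Function.update_of_ne (by omega) _ _, fun _ _ => rfl, rfl⟩

theorem Represents.of_sameBelow {n d : ℕ} {ε : ℝ} {m : ℕ → ℕ → ℕ → ℝ} {i r : ℕ} {s s' : State}
    (h : Represents n d ε m s) (h' : SameBelow i r s s') (hi : 2 ≤ i) (hr : 1 ≤ r) :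
    Represents n d ε m s' :=
  ⟨(h'.idx_eq 0 (by omega)).trans h.idx_zero, (h'.idx_eq 1 (by omega)).trans h.idx_one,
    (h'.reg_eq 0 (by omega)).trans h.reg_zero, fun a => by rw [h'.mem_eq]; exact h.mem_eq a⟩

theorem Ix.eval_toIExp {e : Ix} {c : ℕ} {env : ℕ → ℕ} {s : State} (he : e.Scoped c)
    (hs : ∀ k < c, s.idx (k + 4) = env k) : e.toIExp.eval s = e.val env := by
  cases e with
  | zero => rfl
  | ctr k => exact hs k he

theorem Ix.cost_toIExp (e : Ix) : e.toIExp.cost = 1 := by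
  cases e <;> rfl

variable {n d : ℕ} {ε : ℝ} {m : ℕ → ℕ → ℕ → ℝ}

/-- Correctness and running time of one expression. -/
def HExp.Correct (n d : ℕ) (ε : ℝ) (m : ℕ → ℕ → ℕ → ℝ) (x : HExp) : Prop :=
  ∀ (c r : ℕ) (env : ℕ → ℕ) (s : State), x.Scoped c → 1 ≤ r → Represents n d ε m s →
    (∀ k < c, s.idx (k + 4) = env k) → ∃ t s', Exec (x.compile c r) s t s' ∧
      t ≤ x.time (n * d) ∧ s'.reg r = x.eval n d ε m c env ∧ SameBelow (c + 4) r s s'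

/-- Two expressions are evaluated one after the other into consecutive registers. -/
theorem HExp.Correct.pair {x y : HExp} (hx : x.Correct n d ε m) (hy : y.Correct n d ε m)
    {c r : ℕ} {env : ℕ → ℕ} {s : State} (hxs : x.Scoped c) (hys : y.Scoped c) (hr : 1 ≤ r)
    (hs : Represents n d ε m s) (henv : ∀ k < c, s.idx (k + 4) = env k) :
    ∃ t₁ s₁ t₂ s₂, Exec (x.compile c r) s t₁ s₁ ∧ Exec (y.compile c (r + 1)) s₁ t₂ s₂ ∧
      t₁ + t₂ ≤ x.time (n * d) + y.time (n * d) ∧ s₂.reg r = x.eval n d ε m c env ∧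
      s₂.reg (r + 1) = y.eval n d ε m c env ∧ SameBelow (c + 4) r s s₂ := by
  obtain ⟨t₁, s₁, he₁, ht₁, hv₁, hb₁⟩ := hx c r env s hxs hr hs henv
  obtain ⟨t₂, s₂, he₂, ht₂, hv₂, hb₂⟩ := hy c (r + 1) env s₁ hys (by omega)
    (hs.of_sameBelow hb₁ (by omega) hr) fun k hk => by
      rw [hb₁.idx_eq _ (by omega)]; exact henv k hk
  exact ⟨t₁, s₁, t₂, s₂, he₁, he₂, by omega, by rw [hb₂.reg_eq r (by omega), hv₁], hv₂,
    hb₁.trans hb₂ le_rfl (by omega)⟩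

/-- Accumulation of the values of an expression in a register. -/
theorem HExp.Correct.accumulate {x : HExp} (hx : x.Correct n d ε m) (hn : 1 ≤ n) (hd : 1 ≤ d)
    {b : Bound} {c r : ℕ} {env : ℕ → ℕ} {s : State} (hxs : x.Scoped (c + 1)) (hr : 1 ≤ r)
    (hs : Represents n d ε m s) (henv : ∀ k < c, s.idx (k + 4) = env k) {p : Prog} {tp : ℕ}
    {f : ℝ → ℝ → ℝ} (hp : ∀ s', ∃ t, Exec p s' t (s'.setR r (f (s'.reg r) (s'.reg (r + 1)))) ∧
      t ≤ tp) (F : ℕ → ℝ) (hF0 : F 0 = 0)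
    (hF : ∀ k, F (k + 1) =
      f (F k) (x.eval n d ε m (c + 1) (Function.update env c k))) :
    ∃ t s', Exec (.seq (.setR r (.lit 0)) (forLoop (c + 4) b
        (.seq (x.compile (c + 1) (r + 1)) p))) s t s' ∧
      t ≤ n * d * (x.time (n * d) + tp + 7) + 7 ∧ s'.reg r = F (b.val n d) ∧
      SameBelow (c + 4) r s s' := by
  have hset := Exec.setR r (.lit 0) s
  simp only [RExp.eval, RExp.cost, Rat.cast_zero] at hset
  set s₀ := s.setR r 0 with hs₀
  have hb₀ : SameBelow (c + 4) r s s₀ := sameBelow_setR _ _ _ _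
  obtain ⟨t, s', he, ht, hreg, hbelow, -⟩ := exec_forLoop (i := c + 4) (b := b)
    (p := .seq (x.compile (c + 1) (r + 1)) p) (N := b.val n d) (tb := x.time (n * d) + tp)
    (s := s₀) (fun k s' => s'.reg r = F k ∧ SameBelow (c + 4) r s s' ∧ s'.idx (c + 4) = k)
    (fun k s' h => by
      have := hs.of_sameBelow h.2.1 (by omega) hr
      rw [b.eval_toIExp, this.idx_zero, this.idx_one])
    (fun k s' h => h.2.2)
    ⟨by rw [hF0]; exact Function.update_self _ _ _,
      hb₀.trans (sameBelow_setI (c + 4) r s₀ 0) le_rfl le_rfl, Function.update_self _ _ _⟩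
    (fun k hk s' ⟨h1, h2, h3⟩ => by
      obtain ⟨t₁, s₁, he₁, ht₁, hv₁, hb₁⟩ := hx (c + 1) (r + 1) (Function.update env c k) s' hxs
        (by omega) (hs.of_sameBelow h2 (by omega) hr) fun l hl => by
          rcases Nat.lt_succ_iff_lt_or_eq.1 hl with h | rfl
          · rw [Function.update_of_ne (by omega), h2.idx_eq _ (by omega)]; exact henv l h
          · rw [Function.update_self]; exact h3
      obtain ⟨t₂, he₂, ht₂⟩ := hp s₁
      have hidx : (s₁.setR r (f (s₁.reg r) (s₁.reg (r + 1)))).idx (c + 4) = k :=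
        (hb₁.idx_eq _ (by omega)).trans h3
      refine ⟨_, _, Exec.seq he₁ he₂, by omega, hidx, ?_, ?_, Function.update_self _ _ _⟩
      · change Function.update s₁.reg r _ r = _
        rw [Function.update_self, hF, hv₁, hb₁.reg_eq r (by omega), h1]
      · refine (h2.trans hb₁ (by omega) (by omega)).trans (s' := s₁) ?_ le_rfl le_rfl
        exact (sameBelow_setR (c + 4) r s₁ _).trans (sameBelow_setI (c + 4) r _ _) le_rfl le_rfl)
  refine ⟨_, s', Exec.seq hset he, ?_, hreg, hbelow⟩
  have := Nat.mul_le_mul_right (x.time (n * d) + tp + 7) (b.val_le hn hd)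
  omega

/-- Structural induction. An expression compiled for `r` changes no real register below `r` and no
counter in scope, so earlier partial results survive. -/
theorem HExp.correct (hn : 1 ≤ n) (hd : 1 ≤ d) (x : HExp) : x.Correct n d ε m := by
  induction x with
  | lit q =>
    intro c r env s _ hr hs henv
    exact ⟨_, _, Exec.setR r _ s, le_rfl, Function.update_self _ _ _, sameBelow_setR _ _ _ _⟩
  | eps =>
    intro c r env s _ hr hs henv
    refine ⟨_, _, Exec.setR r _ s, le_rfl, ?_, sameBelow_setR _ _ _ _⟩
    exact (Function.update_self _ _ _).trans hs.reg_zero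
  | get a e f =>
    intro c r env s hsc hr hs henv
    refine ⟨_, _, Exec.setR r _ s, ?_, ?_, sameBelow_setR _ _ _ _⟩
    · simp [RExp.cost, Ix.cost_toIExp, HExp.time]
    · refine (Function.update_self _ _ _).trans ?_
      simp only [RExp.eval, HExp.eval]
      rw [hs.mem_eq, Ix.eval_toIExp hsc.1 henv, Ix.eval_toIExp hsc.2 henv]
  | add x y hx hy | sub x y hx hy | mul x y hx hy | div x y hx hy =>
    intro c r env s hsc hr hs henv
    obtain ⟨t₁, s₁, t₂, s₂, he₁, he₂, ht, hv₁, hv₂, hb⟩ := hx.pair hy hsc.1 hsc.2 hr hs henv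
    refine ⟨_, _, Exec.seq he₁ (Exec.seq he₂ (Exec.setR r _ s₂)), ?_, ?_,
      hb.trans (sameBelow_setR _ _ _ _) le_rfl le_rfl⟩
    · simp only [RExp.cost, HExp.time]; omega
    · refine (Function.update_self _ _ _).trans ?_
      simp only [RExp.eval, HExp.eval, hv₁, hv₂]
  | cond x y u v hx hy hu hv =>
    intro c r env s hsc hr hs henv
    obtain ⟨t₁, s₁, t₂, s₂, he₁, he₂, ht, hv₁, hv₂, hb⟩ := hx.pair hy hsc.1 hsc.2.1 hr hs henv
    have hs₂ := hs.of_sameBelow hb (by omega) hr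
    have henv₂ : ∀ k < c, s₂.idx (k + 4) = env k := fun k hk => by
      rw [hb.idx_eq _ (by omega)]; exact henv k hk
    by_cases hlt : x.eval n d ε m c env < y.eval n d ε m c env
    · obtain ⟨t₃, s₃, he₃, ht₃, hv₃, hb₃⟩ := hu c r env s₂ hsc.2.2.1 hr hs₂ henv₂
      refine ⟨_, _, Exec.seq he₁ (Exec.seq he₂ (Exec.iteTrue _ ?_ he₃)), ?_, ?_,
        hb.trans hb₃ le_rfl le_rfl⟩
      · simp only [Test.Holds, RExp.eval, hv₁, hv₂]; exact hlt
      · simp only [Test.cost, RExp.cost, HExp.time]; omega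
      · rw [hv₃, HExp.eval, if_pos hlt]
    · obtain ⟨t₃, s₃, he₃, ht₃, hv₃, hb₃⟩ := hv c r env s₂ hsc.2.2.2 hr hs₂ henv₂
      refine ⟨_, _, Exec.seq he₁ (Exec.seq he₂ (Exec.iteFalse _ ?_ he₃)), ?_, ?_,
        hb.trans hb₃ le_rfl le_rfl⟩
      · simp only [Test.Holds, RExp.eval, hv₁, hv₂]; exact hlt
      · simp only [Test.cost, RExp.cost, HExp.time]; omega
      · rw [hv₃, HExp.eval, if_neg hlt]
  | sum b x hx =>
    intro c r env s hsc hr hs henv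
    exact hx.accumulate hn hd hsc hr hs henv (tp := 4) (f := fun u v => u + v)
      (fun s' => ⟨_, Exec.setR r _ s', le_rfl⟩)
      (fun k => ∑ i ∈ Finset.range k, x.eval n d ε m (c + 1) (Function.update env c i))
      (Finset.sum_range_zero _) (fun k => Finset.sum_range_succ _ _)
  | max b x hx =>
    intro c r env s hsc hr hs henv
    refine hx.accumulate hn hd hsc hr hs henv (tp := 5) (f := fun u v => if u < v then v else u)
      (fun s' => ?_)
      (runMax fun i => x.eval n d ε m (c + 1) (Function.update env c i))
      rfl (fun k => rfl)
    by_cases hlt : s'.reg r < s'.reg (r + 1)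
    · rw [if_pos hlt]
      exact ⟨_, Exec.iteTrue _ hlt (Exec.setR r (.var (r + 1)) s'), le_rfl⟩
    · rw [if_neg hlt]
      exact ⟨_, Exec.iteFalse _ hlt (Exec.setR r (.var r) s'), le_rfl⟩

end Expressions

/-! ### A language of block assignments, its compiler and polynomial time bounds. -/

section Programs

/-- High-level programs: simultaneous assignment to a block of an array, sequential composition,
and `n`-fold repetition. -/
inductive HProg : Type
  | assign (a : ℕ) (b₁ b₂ : Bound) (x : HExp)
  | seq (p q : HProg)
  | rep (p : HProg)

/-- Counter values in a block assignment. -/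
def blockEnv (i j : ℕ) : ℕ → ℕ := fun k => if k = 0 then i else j

noncomputable def HProg.run (n d : ℕ) (ε : ℝ) : HProg → (ℕ → ℕ → ℕ → ℝ) → ℕ → ℕ → ℕ → ℝ
  | .assign a b₁ b₂ x, m => fun a' i j =>
      if a' = a ∧ i < b₁.val n d ∧ j < b₂.val n d then x.eval n d ε m 2 (blockEnv i j)
      else m a' i j
  | .seq p q, m => q.run n d ε (p.run n d ε m)
  | .rep p, m => (p.run n d ε)^[n] m

/-- Scoping of expressions; repetitions are nested at most `2 - e` deep. -/
def HProg.Scoped : HProg → ℕ → Prop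
  | .assign _ _ _ x, _ => x.Scoped 2
  | .seq p q, e => p.Scoped e ∧ q.Scoped e
  | .rep p, e => e < 2 ∧ p.Scoped (e + 1)

/-- A block is computed into the buffer and then copied, since its expression may read the array
being overwritten. The argument `e` is the nesting depth of repetitions and selects the counter
register. -/
def HProg.compile : HProg → ℕ → Prog
  | .assign a b₁ b₂ x, _ =>
      .seq (forLoop 4 b₁ (forLoop 5 b₂ (.seq (x.compile 2 1) (.setM 2 (.var 4) (.var 5) (.var 1)))))
        (forLoop 4 b₁ (forLoop 5 b₂ (.setM (arr a) (.var 4) (.var 5) (.get 2 (.var 4) (.var 5)))))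
  | .seq p q, e => .seq (p.compile e) (q.compile e)
  | .rep p, e => forLoop (e + 2) .points (p.compile (e + 1))

def HProg.time (N : ℕ) : HProg → ℕ
  | .assign _ _ _ x => N * (N * (x.time N + 11) + 12) + N * (N * 13 + 12) + 10
  | .seq p q => p.time N + q.time N
  | .rep p => N * (p.time N + 7) + 5

/-- Two nested counting loops whose body writes one entry of the array `A`. -/
theorem exec_blockLoop {b₁ b₂ : Bound} {p : Prog} {A tb : ℕ} {g : ℕ → ℕ → ℝ} {s : State}
    {n d : ℕ} (hn : 1 ≤ n) (hd : 1 ≤ d) (hs0 : s.idx 0 = n) (hs1 : s.idx 1 = d)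
    (hbody : ∀ i j s', (∀ k < 4, s'.idx k = s.idx k) → s'.reg 0 = s.reg 0 →
      (∀ a ≠ A, s'.mem a = s.mem a) → s'.idx 4 = i → s'.idx 5 = j →
      ∃ t s'', Exec p s' t s'' ∧ t ≤ tb ∧ (∀ k < 6, s''.idx k = s'.idx k) ∧
        s''.reg 0 = s'.reg 0 ∧ s''.mem = (s'.setM A i j (g i j)).mem) :
    ∃ t s', Exec (forLoop 4 b₁ (forLoop 5 b₂ p)) s t s' ∧
      t ≤ n * d * (n * d * (tb + 7) + 12) + 5 ∧
      (∀ k < 4, s'.idx k = s.idx k) ∧ s'.reg 0 = s.reg 0 ∧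
      s'.mem = fun a i j => if a = A ∧ i < b₁.val n d ∧
        j < b₂.val n d then g i j else s.mem a i j := by
  have hle₁ := b₁.val_le hn hd
  have hle₂ := b₂.val_le hn hd
  have hbN : ∀ (b : Bound) (s' : State), (∀ k < 4, s'.idx k = s.idx k) →
      b.toIExp.eval s' = b.val n d := fun b s' h => by
    rw [b.eval_toIExp, h 0 (by omega), h 1 (by omega), hs0, hs1]
  have hbN₁ := hbN b₁
  have hbN₂ := hbN b₂
  generalize b₁.val n d = N₁ at *
  generalize b₂.val n d = N₂ at *
  generalize n * d = N at *
  obtain ⟨t, s', he, ht, h1, h2, h3, -⟩ := exec_forLoop (i := 4) (b := b₁) (p := forLoop 5 b₂ p)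
    (N := N₁) (tb := N * (tb + 7) + 5) (s := s)
    (fun k s' => (∀ k < 4, s'.idx k = s.idx k) ∧ s'.reg 0 = s.reg 0 ∧
      (s'.mem = fun a i j => if a = A ∧ i < k ∧ j < N₂ then g i j else s.mem a i j) ∧
      s'.idx 4 = k)
    (fun k s' h => hbN₁ s' h.1) (fun k s' h => h.2.2.2)
    ⟨fun k hk => State.setI_idx_of_ne _ _ (by omega), rfl, by
      funext a i j; simp [State.setI], State.setI_idx_self _ _ _⟩
    (fun k hk s₁ ⟨h1, h2, h3, h4⟩ => by
      obtain ⟨t, s', he, ht, h1', h2', h3', h4', -⟩ := exec_forLoop (i := 5) (b := b₂) (p := p)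
        (N := N₂) (tb := tb) (s := s₁)
        -- Within row `k` the written entries are the complete rows above it and the first `l`
        -- entries of that row.
        (fun l s' => (∀ k < 4, s'.idx k = s.idx k) ∧ s'.reg 0 = s.reg 0 ∧
          (s'.mem = fun a i j => if a = A ∧ ((i < k ∧ j < N₂) ∨ (i = k ∧ j < l)) then g i j
            else s.mem a i j) ∧ s'.idx 4 = k ∧ s'.idx 5 = l)
        (fun l s' h => hbN₂ s' h.1) (fun l s' h => h.2.2.2.2)
        ⟨fun k hk => (State.setI_idx_of_ne _ _ (by omega)).trans (h1 k hk), h2, by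
          simpa [State.setI] using h3, (State.setI_idx_of_ne _ _ (by omega)).trans h4,
          State.setI_idx_self _ _ _⟩
        (fun l hl s₂ ⟨g1, g2, g3, g4, g5⟩ => by
          obtain ⟨t, s₃, he, ht, f1, f2, f3⟩ := hbody k l s₂ g1 g2 (fun a ha => by
            rw [g3]; funext i j; simp [ha]) g4 g5
          refine ⟨t, s₃, he, ht, (f1 5 (by omega)).trans g5, fun q hq => ?_, f2.trans g2, ?_, ?_,
            State.setI_idx_self _ _ _⟩
          · exact (State.setI_idx_of_ne _ _ (by omega)).trans
              ((f1 q (by omega)).trans (g1 q hq))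
          · change s₃.mem = _
            rw [f3]
            funext a i j
            simp only [State.setM, g3]
            by_cases ha : a = A
            · by_cases hi : i = k
              · by_cases hj : j = l
                · simp [ha, hi, hj]
                · have : j < l + 1 ↔ j < l := by omega
                  simp [ha, hi, hj, this]
              · simp [ha, hi]
            · simp [ha]
          · exact (State.setI_idx_of_ne _ _ (by omega)).trans ((f1 4 (by omega)).trans g4))
      refine ⟨t, s', he, ?_, h4', fun q hq => ?_, h2', ?_, State.setI_idx_self _ _ _⟩
      · have := Nat.mul_le_mul_right (tb + 7) hle₂
        omega
      · exact (State.setI_idx_of_ne _ _ (by omega)).trans (h1' q hq)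
      · change s'.mem = _
        rw [h3']
        funext a i j
        have : (i < k ∧ j < N₂ ∨ i = k ∧ j < N₂) ↔ (i < k + 1 ∧ j < N₂) := by omega
        simp only [this])
  refine ⟨t, s', he, ?_, h1, h2, h3⟩
  rw [show N * (tb + 7) + 5 + 7 = N * (tb + 7) + 12 by ring] at ht
  have := Nat.mul_le_mul_right (N * (tb + 7) + 12) hle₁
  omega

theorem HProg.exec_compile {n d : ℕ} {ε : ℝ} (hn : 1 ≤ n) (hd : 1 ≤ d) (p : HProg) :
    ∀ (e : ℕ) (m : ℕ → ℕ → ℕ → ℝ) (s : State), e ≤ 2 → p.Scoped e → Represents n d ε m s →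
      ∃ t s', Exec (p.compile e) s t s' ∧ t ≤ p.time (n * d) ∧
        Represents n d ε (p.run n d ε m) s' ∧ ∀ k < e + 2, s'.idx k = s.idx k := by
  induction p with
  | assign a b₁ b₂ x =>
    intro e m s he hsc hs
    have hs0 := hs.idx_zero
    have hs1 := hs.idx_one
    obtain ⟨t₁, s₁, he₁, ht₁, hi₁, hr₁, hm₁⟩ := exec_blockLoop (b₁ := b₁) (b₂ := b₂)
      (p := .seq (x.compile 2 1) (.setM 2 (.var 4) (.var 5) (.var 1))) (A := 2)
      (tb := x.time (n * d) + 4) (g := fun i j => x.eval n d ε m 2 (blockEnv i j)) (s := s)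
      hn hd hs0 hs1 (fun i j s' h1 h2 h3 h4 h5 => by
        have hrep : Represents n d ε m s' := ⟨(h1 0 (by omega)).trans hs0,
          (h1 1 (by omega)).trans hs1, h2.trans hs.reg_zero,
          fun a => (h3 _ (arr_ne_two a)).trans (hs.mem_eq a)⟩
        obtain ⟨t, s'', he, ht, hv, hb⟩ := x.correct hn hd 2 1 (blockEnv i j) s' hsc le_rfl hrep
          (fun k hk => by
            interval_cases k
            · simpa [blockEnv] using h4
            · simpa [blockEnv] using h5)
        refine ⟨_, _, Exec.seq he (Exec.setM 2 (.var 4) (.var 5) (.var 1) s''), ?_,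
          fun k hk => hb.idx_eq k hk, hb.reg_eq 0 (by omega), ?_⟩
        · simp only [IExp.cost, RExp.cost]; omega
        · simp only [IExp.eval, RExp.eval, State.setM, hb.mem_eq, hb.idx_eq 4 (by omega),
            hb.idx_eq 5 (by omega), h4, h5, hv])
    have hi0 : s₁.idx 0 = n := (hi₁ 0 (by omega)).trans hs0
    have hi1 : s₁.idx 1 = d := (hi₁ 1 (by omega)).trans hs1
    obtain ⟨t₂, s₂, he₂, ht₂, hi₂, hr₂, hm₂⟩ := exec_blockLoop (b₁ := b₁) (b₂ := b₂)
      (p := .setM (arr a) (.var 4) (.var 5) (.get 2 (.var 4) (.var 5))) (A := arr a)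
      (tb := 6) (g := fun i j => s₁.mem 2 i j) (s := s₁)
      hn hd hi0 hi1 (fun i j s' h1 h2 h3 h4 h5 => by
        refine ⟨_, _, Exec.setM (arr a) (.var 4) (.var 5) (.get 2 (.var 4) (.var 5)) s', le_rfl,
          fun k hk => rfl, rfl, ?_⟩
        simp only [IExp.eval, RExp.eval, h4, h5]
        rw [h3 2 (arr_ne_two a).symm])
    refine ⟨_, s₂, Exec.seq he₁ he₂, ?_, ⟨(hi₂ 0 (by omega)).trans hi0,
      (hi₂ 1 (by omega)).trans hi1, hr₂.trans (hr₁.trans hs.reg_zero), fun a' => ?_⟩,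
      fun k hk => (hi₂ k (by omega)).trans (hi₁ k (by omega))⟩
    · simp only [HProg.time]
      rw [show x.time (n * d) + 4 + 7 = x.time (n * d) + 11 by ring] at ht₁
      norm_num at ht₂
      omega
    · rw [hm₂]
      funext i j
      simp only [HProg.run, arr_inj, hm₁, arr_ne_two, false_and, if_false, true_and]
      split_ifs with h1 h2
      · rfl
      · exact absurd h1.2 h2
      · rw [hs.mem_eq]
  | seq p q hp hq =>
    intro e m s he hsc hs
    obtain ⟨t₁, s₁, he₁, ht₁, hs₁, hi₁⟩ := hp e m s he hsc.1 hs
    obtain ⟨t₂, s₂, he₂, ht₂, hs₂, hi₂⟩ := hq e _ s₁ he hsc.2 hs₁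
    exact ⟨_, s₂, Exec.seq he₁ he₂, by simp only [HProg.time]; omega, hs₂,
      fun k hk => (hi₂ k hk).trans (hi₁ k hk)⟩
  | rep p hp =>
    intro e m s he hsc hs
    obtain ⟨t, s', hex, ht, h1, h2, -⟩ := exec_forLoop (i := e + 2) (b := .points)
      (p := p.compile (e + 1)) (N := n) (tb := p.time (n * d)) (s := s)
      (fun k s' => Represents n d ε ((p.run n d ε)^[k] m) s' ∧
        (∀ k < e + 2, s'.idx k = s.idx k) ∧ s'.idx (e + 2) = k)
      (fun k s' h => h.1.idx_zero) (fun k s' h => h.2.2)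
      ⟨hs.of_sameBelow (sameBelow_setI (e + 2) 1 s 0) (by omega) le_rfl,
        (sameBelow_setI (e + 2) 1 s 0).idx_eq, Function.update_self _ _ _⟩
      (fun k hk s' ⟨h1, h2, h3⟩ => by
        obtain ⟨t, s'', hex, ht, hs'', hi⟩ := hp (e + 1) _ s' (by have := hsc.1; omega) hsc.2 h1
        have hsb := sameBelow_setI (e + 2) 1 s'' (k + 1)
        refine ⟨t, s'', hex, ht, (hi _ (by omega)).trans h3, ?_, ?_, Function.update_self _ _ _⟩
        · rw [Function.iterate_succ_apply']
          exact hs''.of_sameBelow hsb (by omega) le_rfl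
        · exact fun l hl => (hsb.idx_eq l hl).trans ((hi l (by omega)).trans (h2 l hl)))
    refine ⟨t, s', hex, ?_, h1, h2⟩
    have := Nat.mul_le_mul_right (p.time (n * d) + 7) (Nat.le_mul_of_pos_right n hd)
    simp only [HProg.time]
    omega

/-- Functions bounded by a polynomial. -/
def PolyBounded (f : ℕ → ℕ) : Prop := ∃ C k, ∀ N, 1 ≤ N → f N ≤ C * N ^ k

theorem PolyBounded.const (c : ℕ) : PolyBounded fun _ => c := ⟨c, 0, fun N _ => by simp⟩

theorem PolyBounded.add {f g : ℕ → ℕ} (hf : PolyBounded f) (hg : PolyBounded g) :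
    PolyBounded fun N => f N + g N := by
  obtain ⟨C, k, hf⟩ := hf
  obtain ⟨D, l, hg⟩ := hg
  refine ⟨C + D, k + l, fun N hN => ?_⟩
  have h1 : N ^ k ≤ N ^ (k + l) := Nat.pow_le_pow_right hN (by omega)
  have h2 : N ^ l ≤ N ^ (k + l) := Nat.pow_le_pow_right hN (by omega)
  calc f N + g N ≤ C * N ^ k + D * N ^ l := add_le_add (hf N hN) (hg N hN)
    _ ≤ C * N ^ (k + l) + D * N ^ (k + l) := by gcongr
    _ = _ := by ring

theorem PolyBounded.id_mul {f : ℕ → ℕ} (hf : PolyBounded f) : PolyBounded fun N => N * f N := by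
  obtain ⟨C, k, hf⟩ := hf
  refine ⟨C, k + 1, fun N hN => ?_⟩
  calc N * f N ≤ N * (C * N ^ k) := Nat.mul_le_mul_left _ (hf N hN)
    _ = _ := by ring

theorem HExp.polyBounded_time (x : HExp) : PolyBounded fun N => x.time N := by
  induction x with
  | lit q | eps => exact .const 2
  | get a e f => exact .const 4
  | add x y hx hy | sub x y hx hy | mul x y hx hy | div x y hx hy => exact (hx.add hy).add (.const 4)
  | cond x y u v hx hy hu hv => exact ((hx.add hy).add (hu.add hv)).add (.const 3)
  | sum b x hx => exact (hx.add (.const 11)).id_mul.add (.const 7)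
  | max b x hx => exact (hx.add (.const 12)).id_mul.add (.const 7)

theorem HProg.polyBounded_time (p : HProg) : PolyBounded fun N => p.time N := by
  induction p with
  | assign a b₁ b₂ x =>
    exact ((((x.polyBounded_time.add (.const 11)).id_mul.add (.const 12)).id_mul).add
      (((PolyBounded.const 13).id_mul.add (.const 12)).id_mul)).add (.const 10)
  | seq p q hp hq => exact hp.add hq
  | rep p hp => exact (hp.add (.const 7)).id_mul.add (.const 5)

end Programs
end RobustMean
namespace RobustMean
open Finset Matrix

/-! ### The filter estimator as a program. -/

section FilterProgram

/-- The number of doublings of `ε` below `1`, among the first `k`. -/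
noncomputable def doublings (ε : ℝ) : ℕ → ℕ
  | 0 => 0
  | k + 1 => if 2 ^ doublings ε k * ε < 1 then doublings ε k + 1 else doublings ε k

namespace HProg

/-- Arrays: `0` points, `1` mean, `2` weights, `3` the level `L`, `4` the doubled `ε`, `5` total
weight, `6` scatter matrix, `7` its powers, `8` `frobSq`, `9` scores, `10` excesses, `11` their
maximum, `12` weighted total score. Counters `0` and `1` address the assigned entry; later ones are
bound by sums and maxima. -/
def entry (a : ℕ) : HExp := .get a .zero .zero

def wt (k : ℕ) : HExp := .get 2 .zero (.ctr k)

/-- Coordinate `l` of point `j`, relative to the current mean. -/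
def dev (j l : ℕ) : HExp := .sub (.get 0 (.ctr j) (.ctr l)) (.get 1 .zero (.ctr l))

def initProg : HProg :=
  .seq (.assign 2 .one .points (.lit 1)) (.seq (.assign 3 .one .one (.lit 0))
    (.assign 4 .one .one .eps))

/-- The count is updated before the product, so that both tests read the same value of array `4`. -/
def doubleProg : HProg :=
  .seq (.assign 3 .one .one
      (.cond (entry 4) (.lit 1) (.add (entry 3) (.lit 1)) (entry 3)))
    (.assign 4 .one .one (.cond (entry 4) (.lit 1) (.mul (.lit 2) (entry 4)) (entry 4)))

def meanProg : HProg :=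
  .seq (.assign 5 .one .one (.sum .points (wt 2)))
    (.assign 1 .one .dim
      (.div (.sum .points (.mul (wt 2) (.get 0 (.ctr 2) (.ctr 1)))) (entry 5)))

def scatterProg : HProg :=
  .assign 6 .dim .dim (.sum .points (.mul (wt 2) (.mul (dev 2 0) (dev 2 1))))

def copyProg : HProg := .assign 7 .dim .dim (.get 6 (.ctr 0) (.ctr 1))

def mulProg : HProg :=
  .assign 7 .dim .dim (.sum .dim (.mul (.get 6 (.ctr 0) (.ctr 2)) (.get 7 (.ctr 2) (.ctr 1))))

def powerProg : HProg := .seq copyProg (.rep mulProg)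

def frobProg : HProg :=
  .assign 8 .one .one
    (.sum .dim (.sum .dim (.mul (.get 7 (.ctr 2) (.ctr 3)) (.get 7 (.ctr 2) (.ctr 3)))))

def projExp : HExp := .sum .dim (.mul (.get 7 (.ctr 2) (.ctr 3)) (dev 1 3))

def scoreProg : HProg := .assign 9 .one .points (.sum .dim (.mul projExp projExp))

def rawExcessExp (CT : ℕ) : HExp :=
  .sub (.get 9 .zero (.ctr 1)) (.mul (.mul (.lit CT) (entry 3)) (entry 8))

def excessProg (CT : ℕ) : HProg :=
  .assign 10 .one .points (.cond (.lit 0) (rawExcessExp CT) (rawExcessExp CT) (.lit 0))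

def maxProg : HProg :=
  .assign 11 .one .one
    (.max .points (.cond (.lit 0) (wt 2) (.get 10 .zero (.ctr 2)) (.lit 0)))

def totalProg : HProg :=
  .assign 12 .one .one (.sum .points (.mul (wt 2) (.get 9 .zero (.ctr 2))))

def updateProg (Cθ : ℕ) : HProg :=
  .assign 2 .one .points
    (.cond (.mul (.mul (.add (.lit 1) (.mul (.lit Cθ) (.mul .eps (entry 3)))) (entry 5)) (entry 8))
      (entry 12)
      (.mul (wt 1) (.sub (.lit 1) (.div (.get 10 .zero (.ctr 1)) (entry 11)))) (wt 1))

def stepProg (CT Cθ : ℕ) : HProg :=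
  .seq meanProg (.seq scatterProg (.seq powerProg (.seq frobProg (.seq scoreProg
    (.seq (excessProg CT) (.seq maxProg (.seq totalProg (updateProg Cθ))))))))

/-- The program that computes the filter estimator. -/
def filterProg (CT Cθ : ℕ) : HProg :=
  .seq initProg (.seq (.rep doubleProg) (.seq (.rep (stepProg CT Cθ)) meanProg))

theorem scoped_filterProg (CT Cθ : ℕ) : (filterProg CT Cθ).Scoped 0 := by
  simp [filterProg, stepProg, updateProg, totalProg, maxProg, excessProg, rawExcessExp, scoreProg,
    projExp, frobProg, powerProg, mulProg, copyProg, scatterProg, meanProg, doubleProg, initProg,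
    dev, wt, entry, HProg.Scoped, HExp.Scoped, Ix.Scoped]

variable {n d : ℕ} {ε : ℝ} {m : ℕ → ℕ → ℕ → ℝ}

theorem run_assign_of_lt {a : ℕ} {b₁ b₂ : Bound} {x : HExp} {i j : ℕ} (hi : i < b₁.val n d)
    (hj : j < b₂.val n d) :
    (HProg.assign a b₁ b₂ x).run n d ε m a i j = x.eval n d ε m 2 (blockEnv i j) := by
  simp [HProg.run, hi, hj]

/-- The array `a` is not assigned to. -/
def Avoids (a : ℕ) : HProg → Prop
  | .assign a' _ _ _ => a ≠ a'
  | .seq p q => p.Avoids a ∧ q.Avoids a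
  | .rep p => p.Avoids a

theorem run_of_avoids {a : ℕ} {p : HProg} (h : p.Avoids a) (m : ℕ → ℕ → ℕ → ℝ) :
    p.run n d ε m a = m a := by
  induction p generalizing m with
  | assign a' b₁ b₂ x =>
    have h' : a ≠ a' := h
    funext i j; simp [HProg.run, h']
  | seq p q hp hq => rw [HProg.run, hq h.2, hp h.1]
  | rep p hp =>
    have : ∀ k, ((p.run n d ε)^[k] m) a = m a := by
      intro k
      induction k with
      | zero => rfl
      | succ k ih => rw [Function.iterate_succ_apply', hp h, ih]
    exact this n

end HProg

open HProg

/-- The arrays hold the points `T`, the weights `w` and the number `L`. -/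
structure FilterData {n d : ℕ} (T : Fin n → EuclideanSpace ℝ (Fin d)) (L : ℝ) (w : Fin n → ℝ)
    (m : ℕ → ℕ → ℕ → ℝ) : Prop where
  points : ∀ (j : Fin n) (l : Fin d), m 0 j l = T j l
  weights : ∀ j : Fin n, m 2 0 j = w j
  level : m 3 0 0 = L

variable {n d : ℕ} {ε L : ℝ} {m : ℕ → ℕ → ℕ → ℝ} {T : Fin n → EuclideanSpace ℝ (Fin d)}
  {w : Fin n → ℝ}

theorem run_meanProg (h : FilterData T L w m) :
    meanProg.run n d ε m 5 0 0 = ∑ j, w j ∧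
      ∀ l : Fin d, meanProg.run n d ε m 1 0 l = wMean T w l := by
  have h5 : (HProg.assign 5 .one .one (.sum .points (wt 2))).run n d ε m 5 0 0 = ∑ j, w j := by
    rw [run_assign_of_lt zero_lt_one zero_lt_one]
    simp [HExp.eval, wt, Ix.val, Bound.val, sum_range, h.weights]
  constructor
  · rw [meanProg, HProg.run, run_of_avoids (by simp [Avoids]), h5]
  · intro l
    rw [meanProg, HProg.run, run_assign_of_lt zero_lt_one (by simp [Bound.val])]
    simp only [HExp.eval, entry, Ix.val, h5]
    rw [wMean, div_eq_inv_mul]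
    simp only [wt, HExp.eval, Ix.val, Bound.val]
    rw [run_of_avoids (by simp [Avoids]), run_of_avoids (by simp [Avoids])]
    simp [sum_range, blockEnv, h.weights, h.points]

/-- A repetition runs exactly `n` times and starts from the scatter matrix itself, whence the
exponent `n + 1`. -/
theorem run_powerProg (hM : ∀ k l : Fin d, m 6 k l = scatter T w k l) (k l : Fin d) :
    powerProg.run n d ε m 7 k l = filterMatrix T w k l := by
  have key : ∀ q, (∀ k l : Fin d, ((mulProg.run n d ε)^[q] (copyProg.run n d ε m)) 7 k l =
      (scatter T w ^ (q + 1)) k l) ∧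
      ((mulProg.run n d ε)^[q] (copyProg.run n d ε m)) 6 = m 6 := by
    intro q
    induction q with
    | zero =>
      refine ⟨fun k l => ?_, run_of_avoids (by simp [Avoids, copyProg]) _⟩
      rw [zero_add, pow_one, Function.iterate_zero, id_eq, copyProg,
        run_assign_of_lt (by simp [Bound.val]) (by simp [Bound.val])]
      simp [HExp.eval, Ix.val, blockEnv, hM]
    | succ q ih =>
      rw [Function.iterate_succ_apply']
      refine ⟨fun k l => ?_, (run_of_avoids (by simp [Avoids, mulProg]) _).trans ih.2⟩
      rw [mulProg, run_assign_of_lt (by simp [Bound.val]) (by simp [Bound.val])]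
      simp only [← mulProg.eq_1, HExp.eval, Ix.val, ih.2]
      rw [pow_succ', mul_apply, Bound.val, sum_range]
      refine sum_congr rfl fun i _ => ?_
      simp [blockEnv, ih.1, hM]
  exact (key n).1 k l

theorem run_stepProg {CT Cθ : ℕ} (h : FilterData T L w m) :
    FilterData T L (filterStep CT Cθ ε L T w) ((stepProg CT Cθ).run n d ε m) := by
  set m₁ := meanProg.run n d ε m with hm₁
  set m₂ := scatterProg.run n d ε m₁ with hm₂
  set m₃ := powerProg.run n d ε m₂ with hm₃
  set m₄ := frobProg.run n d ε m₃ with hm₄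
  set m₅ := scoreProg.run n d ε m₄ with hm₅
  set m₆ := (excessProg CT).run n d ε m₅ with hm₆
  set m₇ := maxProg.run n d ε m₆ with hm₇
  set m₈ := totalProg.run n d ε m₇ with hm₈
  have hrun : (stepProg CT Cθ).run n d ε m = (updateProg Cθ).run n d ε m₈ := rfl
  -- Each stage writes only its own arrays; these facts carry every other array forward to where it
  -- is read.
  have f₁ : ∀ a, meanProg.Avoids a → m₁ a = m a := fun a ha => run_of_avoids ha _
  have f₂ : ∀ a, scatterProg.Avoids a → m₂ a = m₁ a := fun a ha => run_of_avoids ha _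
  have f₃ : ∀ a, powerProg.Avoids a → m₃ a = m₂ a := fun a ha => run_of_avoids ha _
  have f₄ : ∀ a, frobProg.Avoids a → m₄ a = m₃ a := fun a ha => run_of_avoids ha _
  have f₅ : ∀ a, scoreProg.Avoids a → m₅ a = m₄ a := fun a ha => run_of_avoids ha _
  have f₆ : ∀ a, (excessProg CT).Avoids a → m₆ a = m₅ a := fun a ha => run_of_avoids ha _
  have f₇ : ∀ a, maxProg.Avoids a → m₇ a = m₆ a := fun a ha => run_of_avoids ha _
  have f₈ : ∀ a, totalProg.Avoids a → m₈ a = m₇ a := fun a ha => run_of_avoids ha _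
  simp only [Avoids, meanProg, scatterProg, powerProg, copyProg, mulProg, frobProg, scoreProg,
    excessProg, maxProg, totalProg] at f₁ f₂ f₃ f₄ f₅ f₆ f₇ f₈
  obtain ⟨hW, hμ⟩ := run_meanProg (ε := ε) h
  rw [← hm₁] at hW hμ
  have hx₁ : ∀ (j : Fin n) (l : Fin d), m₁ 0 j l = T j l := by
    rw [f₁ 0 (by decide)]; exact h.points
  have hw₁ : ∀ j : Fin n, m₁ 2 0 j = w j := by rw [f₁ 2 (by decide)]; exact h.weights
  have hM : ∀ k l : Fin d, m₂ 6 k l = scatter T w k l := by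
    intro k l
    rw [hm₂, scatterProg, run_assign_of_lt (by simp [Bound.val]) (by simp [Bound.val])]
    simp [HExp.eval, wt, dev, Ix.val, Bound.val, sum_range, blockEnv, hx₁, hw₁, hμ, scatter]
  have hB : ∀ k l : Fin d, m₃ 7 k l = filterMatrix T w k l := run_powerProg hM
  have hden : m₄ 8 0 0 = frobSq T w := by
    rw [hm₄, frobProg, run_assign_of_lt zero_lt_one zero_lt_one]
    simp [HExp.eval, Ix.val, Bound.val, sum_range, hB, frobSq, sq]
  have hx₄ : m₄ 0 = m₁ 0 := by rw [f₄ 0 (by decide), f₃ 0 (by decide), f₂ 0 (by decide)]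
  have hμ₄ : m₄ 1 = m₁ 1 := by rw [f₄ 1 (by decide), f₃ 1 (by decide), f₂ 1 (by decide)]
  have hscore : ∀ j : Fin n, m₅ 9 0 j = score T w j := by
    intro j
    rw [hm₅, scoreProg, run_assign_of_lt zero_lt_one (by simp [Bound.val])]
    simp [HExp.eval, projExp, dev, Ix.val, Bound.val, sum_range, blockEnv, f₄ 7 (by decide), hB,
      hx₄, hμ₄, hx₁, hμ, score, sq]
  have hL₅ : m₅ 3 0 0 = L := by
    rw [f₅ 3 (by decide), f₄ 3 (by decide), f₃ 3 (by decide), f₂ 3 (by decide), f₁ 3 (by decide)]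
    exact h.level
  have hden₅ : m₅ 8 0 0 = frobSq T w := by rw [f₅ 8 (by decide)]; exact hden
  have hw₅ : ∀ j : Fin n, m₅ 2 0 j = w j := by
    rw [f₅ 2 (by decide), f₄ 2 (by decide), f₃ 2 (by decide), f₂ 2 (by decide)]
    exact hw₁
  have hexc : ∀ j : Fin n, m₆ 10 0 j = excess CT L T w j := by
    intro j
    rw [hm₆, excessProg, run_assign_of_lt zero_lt_one (by simp [Bound.val])]
    have hraw : (rawExcessExp CT).eval n d ε m₅ 2 (blockEnv 0 j) =
        score T w j - CT * L * frobSq T w := by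
      simp [HExp.eval, rawExcessExp, entry, Ix.val, blockEnv, hscore, hL₅, hden₅]
    simp only [HExp.eval, hraw, excess, Rat.cast_zero]
    split_ifs with h0
    · exact (max_eq_left h0.le).symm
    · exact (max_eq_right (not_lt.1 h0)).symm
  have hw₆ : ∀ j : Fin n, m₆ 2 0 j = w j := by rw [f₆ 2 (by decide)]; exact hw₅
  have hmax : m₇ 11 0 0 = maxExcess CT L T w := by
    rw [hm₇, maxProg, run_assign_of_lt zero_lt_one zero_lt_one]
    refine runMax_congr fun k hk => ?_
    have hk' : k < n := hk
    have h1 := hw₆ ⟨k, hk'⟩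
    have h2 := hexc ⟨k, hk'⟩
    simp only at h1 h2
    simp [HExp.eval, wt, Ix.val, h1, h2, hk']
  have hw₇ : ∀ j : Fin n, m₇ 2 0 j = w j := by rw [f₇ 2 (by decide)]; exact hw₆
  have hscore₇ : ∀ j : Fin n, m₇ 9 0 j = score T w j := by
    rw [f₇ 9 (by decide), f₆ 9 (by decide)]; exact hscore
  have htot : m₈ 12 0 0 = ∑ j, w j * score T w j := by
    rw [hm₈, totalProg, run_assign_of_lt zero_lt_one zero_lt_one]
    simp [HExp.eval, wt, Ix.val, Bound.val, sum_range, hw₇, hscore₇]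
  have hw₈ : ∀ j : Fin n, m₈ 2 0 j = w j := by rw [f₈ 2 (by decide)]; exact hw₇
  have hL₈ : m₈ 3 0 0 = L := by
    rw [f₈ 3 (by decide), f₇ 3 (by decide), f₆ 3 (by decide)]; exact hL₅
  have hW₈ : m₈ 5 0 0 = ∑ j, w j := by
    rw [f₈ 5 (by decide), f₇ 5 (by decide), f₆ 5 (by decide), f₅ 5 (by decide), f₄ 5 (by decide),
      f₃ 5 (by decide), f₂ 5 (by decide)]
    exact hW
  have hden₈ : m₈ 8 0 0 = frobSq T w := by
    rw [f₈ 8 (by decide), f₇ 8 (by decide), f₆ 8 (by decide)]; exact hden₅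
  have hexc₈ : ∀ j : Fin n, m₈ 10 0 j = excess CT L T w j := by
    rw [f₈ 10 (by decide), f₇ 10 (by decide)]; exact hexc
  have hmax₈ : m₈ 11 0 0 = maxExcess CT L T w := by rw [f₈ 11 (by decide)]; exact hmax
  rw [hrun]
  refine ⟨?_, fun j => ?_, ?_⟩
  · rw [run_of_avoids (by simp [Avoids, updateProg]), f₈ 0 (by decide), f₇ 0 (by decide),
      f₆ 0 (by decide), f₅ 0 (by decide), hx₄]
    exact hx₁
  · rw [updateProg, run_assign_of_lt zero_lt_one (by simp [Bound.val])]
    simp [HExp.eval, entry, wt, Ix.val, blockEnv, hw₈, hL₈, hW₈, hden₈, hexc₈, hmax₈, htot,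
      filterStep, IsActive]
    exact if_congr Iff.rfl rfl rfl
  · rw [run_of_avoids (by simp [Avoids, updateProg])]
    exact hL₈

theorem run_filterProg {CT Cθ : ℕ} (hx : ∀ (j : Fin n) (l : Fin d), m 0 j l = T j l)
    (l : Fin d) :
    (filterProg CT Cθ).run n d ε m 1 0 l = filterMean CT Cθ ε (doublings ε n) T l := by
  set m₀ := initProg.run n d ε m with hm₀
  have hdouble : ∀ k, FilterData T (doublings ε k) (fun _ => 1)
      ((doubleProg.run n d ε)^[k] m₀) ∧
      ((doubleProg.run n d ε)^[k] m₀) 4 0 0 = 2 ^ doublings ε k * ε := by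
    intro k
    induction k with
    | zero =>
      simp only [Function.iterate_zero, id_eq]
      refine ⟨⟨?_, fun j => ?_, ?_⟩, ?_⟩
      · rw [hm₀, run_of_avoids (by simp [Avoids, initProg])]; exact hx
      · simp [hm₀, initProg, HProg.run, HExp.eval, Bound.val]
      · simp [hm₀, initProg, HProg.run, HExp.eval, Bound.val, doublings]
      · simp [hm₀, initProg, HProg.run, HExp.eval, Bound.val, doublings]
    | succ k ih =>
      rw [Function.iterate_succ_apply']
      generalize (doubleProg.run n d ε)^[k] m₀ = m' at ih
      obtain ⟨⟨h1, h2, h3⟩, h4⟩ := ih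
      have hcond : m' 4 0 0 < 1 ↔ 2 ^ doublings ε k * ε < 1 := by rw [h4]
      refine ⟨⟨?_, ?_, ?_⟩, ?_⟩
      · rw [run_of_avoids (by simp [Avoids, doubleProg])]; exact h1
      · rw [run_of_avoids (by simp [Avoids, doubleProg])]; exact h2
      · by_cases hlt : 2 ^ doublings ε k * ε < 1 <;>
          simp [doubleProg, HProg.run, HExp.eval, Bound.val, entry, Ix.val, h3, hcond, doublings, hlt]
      · by_cases hlt : 2 ^ doublings ε k * ε < 1 <;>
          simp [doubleProg, HProg.run, HExp.eval, Bound.val, entry, Ix.val, h4, doublings, hlt]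
        ring
  have hstep : ∀ k, FilterData T (doublings ε n)
      ((filterStep CT Cθ ε (doublings ε n) T)^[k] fun _ => 1)
      (((stepProg CT Cθ).run n d ε)^[k] ((doubleProg.run n d ε)^[n] m₀)) := by
    intro k
    induction k with
    | zero => exact (hdouble n).1
    | succ k ih =>
      rw [Function.iterate_succ_apply', Function.iterate_succ_apply']
      exact run_stepProg ih
  exact (run_meanProg (hstep n)).2 l

end FilterProgram
end RobustMean
-- The level `L`, and assembly of the theorem.
namespace RobustMean
open Finset

theorem doublings_spec (ε : ℝ) (k : ℕ) :
    (∀ j < doublings ε k, 2 ^ j * ε < 1) ∧ (doublings ε k = k ∨ 1 ≤ 2 ^ doublings ε k * ε) := by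
  induction k with
  | zero => simp [doublings]
  | succ k ih =>
    rw [doublings]
    split_ifs with h
    · refine ⟨fun j hj => ?_, Or.inl ?_⟩
      · rcases Nat.lt_succ_iff_lt_or_eq.1 hj with h1 | rfl
        · exact ih.1 j h1
        · exact h
      · rw [ih.2.resolve_right (not_le.2 h)]
    · exact ⟨ih.1, Or.inr (not_lt.1 h)⟩

/-- The number of doublings is of the order of `log (1 / ε)`. -/
theorem doublings_bounds {ε : ℝ} (hε : 0 < ε) (hε2 : ε ≤ 1 / 2) {n : ℕ} (hn : 1 ≤ n * ε) :
    1 ≤ (doublings ε n : ℝ) ∧ Real.log (1 / ε) ≤ doublings ε n ∧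
      (doublings ε n : ℝ) ≤ 4 * Real.log (1 / ε) := by
  obtain ⟨h1, h2⟩ := doublings_spec ε n
  set q := doublings ε n with hq
  have hle : 1 ≤ 2 ^ q * ε := by
    rcases h2 with h2 | h2
    -- If all `n` rounds doubled, then `2 ^ n ≥ n` and `n * ε ≥ 1` suffice.
    · refine hn.trans (mul_le_mul_of_nonneg_right ?_ hε.le)
      rw [h2]
      exact_mod_cast (Nat.lt_two_pow_self).le
    · exact h2
  have hq1 : 1 ≤ q := by
    by_contra! h
    have : q = 0 := by omega
    rw [this] at hle
    norm_num at hle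
    linarith
  have hlast := h1 (q - 1) (by omega)
  have hlog2 : 1 / 2 < Real.log 2 := lt_trans (by norm_num) Real.log_two_gt_d9
  have hlog2' : Real.log 2 < 1 := lt_trans Real.log_two_lt_d9 (by norm_num)
  have hA : Real.log 2 ≤ Real.log (1 / ε) :=
    Real.log_le_log (by norm_num) (by rw [le_div_iff₀ hε]; linarith)
  have hB : Real.log (1 / ε) ≤ q * Real.log 2 := by
    rw [← Real.log_pow]
    exact Real.log_le_log (by positivity) (by rw [div_le_iff₀ hε]; exact hle)
  -- The doubling before the last left `ε` below `1`. With `log 2 ≤ log (1 / ε)` and `log 2 > 1 / 2`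
  -- this gives the factor `4`.
  have hC : ((q - 1 : ℕ) : ℝ) * Real.log 2 ≤ Real.log (1 / ε) := by
    rw [← Real.log_pow]
    exact Real.log_le_log (by positivity) (by rw [le_div_iff₀ hε]; exact hlast.le)
  rw [Nat.cast_sub hq1, Nat.cast_one] at hC
  have hq1' : (1 : ℝ) ≤ q := by exact_mod_cast hq1
  refine ⟨hq1', ?_, ?_⟩
  · nlinarith
  · nlinarith

theorem IsStable.comp_equiv {n d : ℕ} {c ε L : ℝ} {y : Fin n → EuclideanSpace ℝ (Fin d)}
    (h : IsStable c ε L y) (σ : Equiv.Perm (Fin n)) : IsStable c ε L fun j => y (σ j) := by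
  refine ⟨?_, fun v hv => ?_, fun v hv => ?_⟩
  · rw [Equiv.sum_comp σ y]; exact h.norm_sum_le
  · rw [Equiv.sum_comp σ fun j => (inner ℝ v (y j)) ^ 2 - 1]; exact h.abs_quadratic_le v hv
  · rw [Equiv.sum_comp σ fun j => max ((inner ℝ v (y j)) ^ 2 - c * L) 0]; exact h.excess_le v hv

theorem represents_inputState {n d : ℕ} (ε : ℝ) (T : Fin n → EuclideanSpace ℝ (Fin d)) :
    Represents n d ε (fun a => (inputState ε T).mem (arr a)) (inputState ε T) :=
  ⟨rfl, rfl, rfl, fun _ => rfl⟩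

/-- The compiled filter program computes the filter estimator. -/
theorem computes_filterMean {n d : ℕ} (hn : 1 ≤ n) (hd : 1 ≤ d) (CT Cθ : ℕ) (ε : ℝ)
    (T : Fin n → EuclideanSpace ℝ (Fin d)) :
    ∃ t, Computes ((HProg.filterProg CT Cθ).compile 0) ε T t
      (filterMean CT Cθ ε (doublings ε n) T) ∧ t ≤ (HProg.filterProg CT Cθ).time (n * d) := by
  obtain ⟨t, s', he, ht, hs', -⟩ := (HProg.filterProg CT Cθ).exec_compile hn hd 0 _ _ (by omega)
    (HProg.scoped_filterProg CT Cθ) (represents_inputState ε T)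
  refine ⟨t, ⟨s', he, ?_⟩, ht⟩
  ext l
  have h1 : s'.mem 1 = _ := hs'.mem_eq 1
  simp only [outputVec, h1]
  refine run_filterProg (fun j l => ?_) l
  simp [inputState, arr]

end RobustMean

theorem mainTheorem7 (K : ℝ) (hK : 0 < K) (ε₀ : ℝ) (hε₀ : 0 < ε₀) (hε₀' : ε₀ < 1 / 2) :
    ∃ (p : RobustMean.Prog) (C : ℝ) (k : ℕ), 0 < C ∧
      ∀ (d n : ℕ) (ε : ℝ), 1 ≤ d → 0 < ε → ε ≤ ε₀ → C * d / ε ^ 2 ≤ n →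
        ∃ muHat : (Fin n → EuclideanSpace ℝ (Fin d)) → EuclideanSpace ℝ (Fin d),
          (∀ T : Fin n → EuclideanSpace ℝ (Fin d), ∃ t : ℕ,
            RobustMean.Computes p ε T t (muHat T) ∧ (t : ℝ) ≤ C * ((n : ℝ) * d) ^ k) ∧
          ∀ (P : MeasureTheory.Measure (EuclideanSpace ℝ (Fin d)))
            [MeasureTheory.IsProbabilityMeasure P],
            RobustMean.IsIdentityCovSubgaussian K P →
            ∀ τ : ℝ, 0 < τ → τ < 1 → C * (d + Real.log (1 / τ)) / ε ^ 2 ≤ n →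
              (MeasureTheory.Measure.pi fun _ : Fin n => P)
                {S | ∃ T, RobustMean.IsCorruption ε S T ∧
                  C * (ε * √(Real.log (1 / ε))) < ‖muHat T - RobustMean.mean P‖} ≤
                ENNReal.ofReal τ := by
  obtain ⟨c, hc, hstable⟩ := RobustMean.exists_pi_not_isStable_le hK
  obtain ⟨CT, Cθ, C₁, hC₁, hacc⟩ := RobustMean.exists_norm_filterMean_sub_le hε₀ hε₀' hc.le
  obtain ⟨C₀, k, htime⟩ := (RobustMean.HProg.filterProg CT Cθ).polyBounded_time
  -- `7` serves the union bound, `C₀` the running time, and `2 * C₁` the accuracy, since `√L ≤ 2 *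
  -- √(log (1 / ε))`.
  refine ⟨(RobustMean.HProg.filterProg CT Cθ).compile 0, 7 + C₀ + 2 * C₁, k, by positivity, ?_⟩
  intro d n ε hd hε hεε₀ hn
  have hd' : (1 : ℝ) ≤ d := by exact_mod_cast hd
  have hC₀ : (0 : ℝ) ≤ C₀ := Nat.cast_nonneg _
  have hε2 : ε ≤ 1 / 2 := by linarith
  rw [div_le_iff₀ (by positivity)] at hn
  have hnd : (d : ℝ) ≤ n * ε ^ 2 := by
    refine le_trans ?_ hn
    exact le_mul_of_one_le_left (by positivity) (by linarith)
  have hnε : 1 ≤ n * ε := by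
    refine (hd'.trans hnd).trans (mul_le_mul_of_nonneg_left ?_ (Nat.cast_nonneg _))
    nlinarith
  have hn0 : 0 < n := by
    rcases Nat.eq_zero_or_pos n with h | h
    · rw [h] at hnε; norm_num at hnε
    · exact h
  obtain ⟨hL1, hLlow, hLup⟩ := RobustMean.doublings_bounds hε hε2 hnε
  set L : ℝ := ((RobustMean.doublings ε n : ℕ) : ℝ) with hL
  refine ⟨RobustMean.filterMean CT Cθ ε L, fun T => ?_, ?_⟩
  · obtain ⟨t, hcomp, ht⟩ := RobustMean.computes_filterMean hn0 hd CT Cθ ε T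
    refine ⟨t, hcomp, ?_⟩
    have h1 : (t : ℝ) ≤ C₀ * ((n : ℝ) * d) ^ k := by
      exact_mod_cast ht.trans (htime (n * d) (Nat.mul_pos hn0 hd))
    refine h1.trans (mul_le_mul_of_nonneg_right (by linarith) (by positivity))
  · intro P _ hP τ hτ hτ1 hnτ
    rw [div_le_iff₀ (by positivity)] at hnτ
    have hlogτ : 0 ≤ Real.log (1 / τ) := Real.log_nonneg (by rw [le_div_iff₀ hτ]; linarith)
    have h7 : 7 * (d + Real.log (1 / τ)) ≤ ε ^ 2 * n := by
      refine le_trans (mul_le_mul_of_nonneg_right ?_ (by positivity)) (hnτ.trans_eq (mul_comm _ _))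
      linarith
    -- Stability concerns `S` alone, so one event covers all corruptions `T` simultaneously.
    refine le_trans (MeasureTheory.measure_mono ?_)
      (hstable d n ε L τ hd hε hε2 hLlow hτ hτ1 h7 P hP)
    rintro S ⟨T, ⟨σ, hσ⟩, hlt⟩ hS
    refine absurd hlt (not_lt.2 ?_)
    classical
    -- The permutation is moved from `T` to `S`, as stability is invariant under reordering and the
    -- estimator then sees `T` as given.
    have hcard : (((Finset.univ.filter fun j => T j = S (σ.symm j))ᶜ.card : ℕ) : ℝ) ≤ ε * n := by
      refine le_trans (le_of_eq ?_) hσ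
      rw [← Set.ncard_coe_finset]
      congr 1
      rw [← Set.ncard_image_of_injective _ σ.symm.injective]
      congr 1
      ext i
      constructor
      · rintro ⟨j, hj, rfl⟩
        simpa using hj
      · intro h
        exact ⟨σ i, by simpa using h, by simp⟩
    have h := hacc hε hεε₀ hL1 hn0 hnd hcard (hS.comp_equiv σ.symm)
      (S := fun j => S (σ.symm j)) (μ := RobustMean.mean P) (T := T)
      fun j hj => (Finset.mem_filter.1 hj).2
    refine h.trans ?_
    have hsqrt : √L ≤ 2 * √(Real.log (1 / ε)) := by
      have h4 : √(4 : ℝ) = 2 := by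
        rw [show (4 : ℝ) = 2 ^ 2 by norm_num, Real.sqrt_sq (by norm_num)]
      calc √L ≤ √(4 * Real.log (1 / ε)) := Real.sqrt_le_sqrt hLup
        _ = 2 * √(Real.log (1 / ε)) := by rw [Real.sqrt_mul (by norm_num), h4]
    have hX : 0 ≤ ε * √(Real.log (1 / ε)) := by positivity
    calc C₁ * (ε * √L) ≤ C₁ * (ε * (2 * √(Real.log (1 / ε)))) := by gcongr
      _ = 2 * C₁ * (ε * √(Real.log (1 / ε))) := by ring
      _ ≤ _ := mul_le_mul_of_nonneg_right (by linarith) hX
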